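/- Setting. Let $d,K\in\mathbb N$, $\alpha>0$, $\beta=\max\{\tfrac12,1-\tfrac{\alpha}{2}\}$. Let $Q=(q_{kk'})$ be an irreducible rate matrix on $\mathcal K=\{1,\dots,K\}$ with stationary distribution $\pi$. For $n\ge1$, $i\in\mathcal I=\{1,\dots,d\}$, $k\in\mathcal K$ let $\lambda_i^n(k)\ge0$, $\mu_i^n(k)>0$, $\gamma_i^n(k)>0$ be the arrival, service and abandonment rates of class $i$ when the environment is in state $k$, and assume that, as $n\to\infty$, $$n^{-1}\lambda_i^n(k)\to\lambda_i(k)>0,\quad \mu_i^n(k)\to\mu_i(k)>0,\quad \gamma_i^n(k)\to\gamma_i(k)>0,$$ and that $n^{-\beta}(\lambda_i^n(k)-n\lambda_i(k))$ and $n^{1-\beta}(\mu_i^n(k)-\mu_i(k))$ converge in $\mathbb R$. Put $\rho_i=\frac{\sum_k\pi_k\lambda_i(k)}{\sum_k\pi_k\mu_i(k)}$ and assume $\sum_i\rho_i=1$. Let $$\tilde z_i^n(x)=x_i\wedge\Bigl(n-\sum_{i'<i}x_{i'}\Bigr)^+,\qquad \tilde q^n(x)=x-\tilde z^n(x)$$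 be the static priority policy. For vectors $l,u,g\in\mathbb R^d$ define $$\mathcal B^n_{l,u,g}f(x)=\sum_i l_i\,(f(x+e_i)-f(x))+\sum_i\bigl(u_i\tilde z^n_i(x)+g_i\tilde q^n_i(x)\bigr)(f(x-e_i)-f(x)).$$ Write $\bar\lambda^n_i=\sum_k\pi_k\lambda^n_i(k)$, and similarly $\bar\mu^n_i,\bar\gamma^n_i$. Set $$\bar{\mathcal L}_n=\mathcal B^n_{\bar\lambda^n,\bar\mu^n,\bar\gamma^n},\qquad \mathcal L_{n,k}=\mathcal B^n_{\lambda^n(k),\mu^n(k),\gamma^n(k)},\qquad \Delta\mathcal L_{n,k}=\bar{\mathcal L}_n-\mathcal L_{n,k}.$$ Let $(X^n,J^n)$ be the continuous-time Markov chain on $\mathbb Z_+^d\times\mathcal K$ with generator $$\widetilde{\mathcal L}_nf(x,k)=\mathcal L_{n,k}f(\cdot,k)(x)+\sum_{k'}n^\alpha q_{kk'}\,(f(x,k')-f(x,k)),$$ with $X^n(0)$ deterministic and $J^n(0)\sim\pi$. Let $\hat x^n(x)=n^{-\beta}(x-n\rho)$, $\hat X^n=\hat x^n(X^n)$, $\mathfrak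 X^n=\hat x^n(\mathbb Z_+^d)$, and let $\widehat{\mathcal L}_n$ and $\Delta\widehat{\mathcal L}_{n,k}$ be the operators $\widetilde{\mathcal L}_n$ and $\Delta\mathcal L_{n,k}$ transported by the bijection $\hat x^n$; thus $\widehat{\mathcal L}_n$ is the generator of $(\hat X^n,J^n)$. Theorem. (a) There are constants $(c_{kk'})_{k,k'\in\mathcal K}$, depending only on $Q$, that solve the Poisson equation of the environment: for every $h:\mathcal K\to\mathbb R$ with $\sum_k\pi_kh_k=0$, the function $\varphi_k=\sum_{l}c_{kl}h_l$ satisfies $\sum_{k'}q_{kk'}(\varphi_{k'}-\varphi_k)=h_k$ for all $k$. (b) Let $m\ge2$ be an even integer. For $\xi\in(0,\infty)^d$ put $\mathcal V_{m,\xi}(y)=\sum_i\xi_i|y_i|^m$ and $f_n(x)=\mathcal V_{m,\xi}(x-n\rho)$. There is a $\xi\in(0,\infty)^d$ for which there exist $C_1,C_2>0$ and $n_0\in\mathbb N$ such that $$\bar{\mathcal L}_nf_n(x)\le C_1n^{m\beta}-C_2f_n(x)\qquad\forall x\in\mathbb Z^d_+,\ \forall n\ge n_0.\tag{1}$$ (c)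 Let $m\ge2$ be an even integer, let $\xi\in(0,\infty)^d$ be any vector for which (1) holds for some $C_1,C_2,n_0$, let $c$ be as in (a), and set $$\widehat{\mathcal V}^n_{m,\xi}(y,k)=\mathcal V_{m,\xi}(y)+\frac1{n^\alpha}\sum_{k'}c_{kk'}\,\Delta\widehat{\mathcal L}_{n,k'}\mathcal V_{m,\xi}(y).$$ Then there exist $n_2\in\mathbb N$ and $\widetilde C_1,\widetilde C_2>0$ such that: 1. for all $n\ge n_2$ and all $(y,k)\in\mathfrak X^n\times\mathcal K$, $$\widehat{\mathcal L}_n\widehat{\mathcal V}^n_{m,\xi}(y,k)\le\widetilde C_1-\widetilde C_2\,\widehat{\mathcal V}^n_{m,\xi}(y,k);$$ 2. for every $n\ge n_2$ the chain $(\hat X^n,J^n)$ is geometrically ergodic: its transition function $P_t$ has an invariant probability measure $\varpi$ for which there are $\kappa>0$ and a finite function $M$ on the state space with $\sum_{s'}|P_t(s,s')-\varpi(s')|\le M(s)e^{-\kappa t}$ for all $t\ge0$ and all states $s$; 3. for every real $p>0$ there is a finite $B$, independent of $n$ and of the initial states $X^n(0)$, such that $$\sup_{n\ge n_2}\ \limsup_{T\to\infty}\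 \frac1T\,\mathbb E\Bigl[\int_0^T|\hat X^n(s)|^p\,ds\Bigr]\le B,$$ where $|\cdot|$ is the Euclidean norm. -/

import Mathlib

open Filter Topology MeasureTheory
open scoped NNReal ENNReal

noncomputable section

namespace MMQ

/-! ### Continuous-time Markov chains on a countable set -/

section Chain

variable {S : Type*} [DecidableEq S]

/-- Picard iterates of the backward integral equation of the conservative rate matrix `A`:
`iter A N t x y` is the probability that the jump chain with rates `A` started at `x` is at `y`
at time `t` having made fewer than `N` jumps. -/
def iter (A : S → S → ℝ) : ℕ → ℝ → S → S → ℝ≥0∞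
  | 0, _, _, _ => 0
  | N + 1, t, x, y =>
      (if x = y then ENNReal.ofReal (Real.exp (A x x * t)) else 0) +
        ∫⁻ s in Set.Icc 0 t, ∑' z : S,
          if z = x then 0
          else ENNReal.ofReal (Real.exp (A x x * s)) * ENNReal.ofReal (A x z) *
            iter A N (t - s) z y

/-- The (minimal) transition function `P_t(x,y)` of the continuous-time Markov chain with rate
matrix `A`. -/
def transition (A : S → S → ℝ) (t : ℝ) (x y : S) : ℝ≥0∞ := ⨆ N, iter A N t x y

/-- Geometric ergodicity of the chain with rate matrix `A`: there is an invariant probability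
measure `ϖ`, a rate `κ > 0`, and a finite function `M` such that
`∑ y, |P_t(x,y) - ϖ(y)| ≤ M(x) e^{-κ t}` for all `t ≥ 0` and all `x`.
(In `ℝ≥0∞`, where subtraction is truncated, `(a - b) + (b - a)` is `|a - b|`.) -/
def GeometricallyErgodic (A : S → S → ℝ) : Prop :=
  ∃ ϖ : PMF S,
    (∀ t : ℝ, 0 ≤ t → ∀ y, ∑' x, ϖ x * transition A t x y = ϖ y) ∧
    ∃ κ : ℝ, 0 < κ ∧ ∃ M : S → ℝ≥0, ∀ t : ℝ, 0 ≤ t → ∀ x,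
      ∑' y, ((transition A t x y - ϖ y) + (ϖ y - transition A t x y))
        ≤ (M x : ℝ≥0∞) * ENNReal.ofReal (Real.exp (-κ * t))

/-- `Y` is a (jointly measurable) Markov process on `(Ω, P)` with the transition function of the
rate matrix `A` and initial law `ν`. Right-continuous `S`-valued processes are jointly
measurable. -/
structure IsChain [MeasurableSpace S] (A : S → S → ℝ) (ν : S → ℝ≥0∞)
    {Ω : Type*} [MeasurableSpace Ω] (P : Measure Ω) (Y : ℝ≥0 → Ω → S) : Prop where
  measurable : Measurable (fun p : ℝ≥0 × Ω => Y p.1 p.2)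
  initial : ∀ y, P {ω | Y 0 ω = y} = ν y
  /-- Markov property with respect to the natural filtration. -/
  markov : ∀ (t s : ℝ≥0) (y : S) (B : Set Ω),
    MeasurableSet[⨆ r : Set.Iic t, MeasurableSpace.comap (Y r) inferInstance] B →
      P (B ∩ {ω | Y (t + s) ω = y}) = ∫⁻ ω in B, transition A s (Y t ω) y ∂P

end Chain

/-- The exponent `β = max {1/2, 1 - α/2}`. -/
def betaExp (α : ℝ) : ℝ := max (1 / 2) (1 - α / 2)

/-- Data of a sequence (indexed by the number `n` of servers) of `d`-class Markov-modulated
`M/M/n+M` queues whose environment has `K` states. -/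
structure Queue (d K : ℕ) where
  /-- exponent of the speed `n ^ α` of the environment -/
  α : ℝ
  /-- the environment of the `n`-th system has rate matrix `n ^ α • Q` -/
  Q : Fin K → Fin K → ℝ
  /-- stationary distribution of the environment -/
  π : Fin K → ℝ
  /-- arrival rates in the `n`-th system: class, environment state -/
  lam : ℕ → Fin d → Fin K → ℝ
  /-- service rates -/
  mu : ℕ → Fin d → Fin K → ℝ
  /-- abandonment rates -/
  gam : ℕ → Fin d → Fin K → ℝ
  /-- limit of `λⁿ / n` -/
  lamLim : Fin d → Fin K → ℝ
  /-- limit of `μⁿ` -/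
  muLim : Fin d → Fin K → ℝ
  /-- limit of `γⁿ` -/
  gamLim : Fin d → Fin K → ℝ
  /-- limit of `n ^ (-β) (λⁿ - n λ)` -/
  lamHat : Fin d → Fin K → ℝ
  /-- limit of `n ^ (1 - β) (μⁿ - μ)` -/
  muHat : Fin d → Fin K → ℝ

namespace Queue

variable {d K : ℕ} (M : Queue d K)

def β : ℝ := betaExp M.α

/-- Average of an environment-dependent quantity under the stationary distribution. -/
def avg (a : Fin d → Fin K → ℝ) (i : Fin d) : ℝ := ∑ k, M.π k * a i k

/-- `ρ_i = λ_i^π / μ_i^π`. -/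
def ρ (i : Fin d) : ℝ := M.avg M.lamLim i / M.avg M.muLim i

/-- The standing assumptions: `Q` is an irreducible rate matrix with stationary distribution `π`,
the rates obey the averaged Halfin-Whitt scaling, and the system is critically loaded. -/
structure Standing : Prop where
  α_pos : 0 < M.α
  Q_nonneg : ∀ k k', k ≠ k' → 0 ≤ M.Q k k'
  Q_row : ∀ k, ∑ k', M.Q k k' = 0
  Q_irred : ∀ k k', Relation.ReflTransGen (fun a b => 0 < M.Q a b) k k'
  π_nonneg : ∀ k, 0 ≤ M.π k
  π_sum : ∑ k, M.π k = 1
  π_stat : ∀ k', ∑ k, M.π k * M.Q k k' = 0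
  lam_nonneg : ∀ n i k, 0 < n → 0 ≤ M.lam n i k
  mu_pos : ∀ n i k, 0 < n → 0 < M.mu n i k
  gam_pos : ∀ n i k, 0 < n → 0 < M.gam n i k
  lamLim_pos : ∀ i k, 0 < M.lamLim i k
  muLim_pos : ∀ i k, 0 < M.muLim i k
  gamLim_pos : ∀ i k, 0 < M.gamLim i k
  lam_tendsto : ∀ i k, Tendsto (fun n : ℕ => (n : ℝ)⁻¹ * M.lam n i k) atTop (𝓝 (M.lamLim i k))
  mu_tendsto : ∀ i k, Tendsto (fun n : ℕ => M.mu n i k) atTop (𝓝 (M.muLim i k))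
  gam_tendsto : ∀ i k, Tendsto (fun n : ℕ => M.gam n i k) atTop (𝓝 (M.gamLim i k))
  lamHat_tendsto : ∀ i k,
    Tendsto (fun n : ℕ => (n : ℝ) ^ (-M.β) * (M.lam n i k - n * M.lamLim i k)) atTop
      (𝓝 (M.lamHat i k))
  muHat_tendsto : ∀ i k,
    Tendsto (fun n : ℕ => (n : ℝ) ^ (1 - M.β) * (M.mu n i k - M.muLim i k)) atTop
      (𝓝 (M.muHat i k))
  critical : ∑ i, M.ρ i = 1

/-- The static priority policy: number of class-`i` customers in service when the numbers of
customers are `x`; class `0` has the highest priority. -/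
def priority (n : ℕ) (x : Fin d → ℝ) (i : Fin d) : ℝ :=
  min (x i) (max ((n : ℝ) - ∑ j ∈ Finset.Iio i, x j) 0)

/-- The birth-death operator with arrival, service and abandonment coefficients `l`, `u`, `g`
under the stationary Markov policy `z`, the queue lengths being `x - z x`. -/
def birthDeath (l u g : Fin d → ℝ) (z : (Fin d → ℝ) → Fin d → ℝ)
    (f : (Fin d → ℝ) → ℝ) (x : Fin d → ℝ) : ℝ :=
  ∑ i, l i * (f (x + Pi.single i 1) - f x)
    + ∑ i, u i * z x i * (f (x - Pi.single i 1) - f x)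
    + ∑ i, g i * (x i - z x i) * (f (x - Pi.single i 1) - f x)

/-- Generator of the averaged process under the static priority policy. -/
def genAvg (n : ℕ) : ((Fin d → ℝ) → ℝ) → (Fin d → ℝ) → ℝ :=
  birthDeath (M.avg (M.lam n)) (M.avg (M.mu n)) (M.avg (M.gam n)) (priority n)

/-- The operator `Lⁿ_k` (environment frozen in state `k`). -/
def genEnv (n : ℕ) (k : Fin K) : ((Fin d → ℝ) → ℝ) → (Fin d → ℝ) → ℝ :=
  birthDeath (M.lam n · k) (M.mu n · k) (M.gam n · k) (priority n)

/-- The operator `ΔLⁿ_k`, with coefficients `Δλ = λ̄ⁿ - λⁿ(k)` etc. -/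
def genDelta (n : ℕ) (k : Fin K) : ((Fin d → ℝ) → ℝ) → (Fin d → ℝ) → ℝ :=
  birthDeath (fun i => M.avg (M.lam n) i - M.lam n i k) (fun i => M.avg (M.mu n) i - M.mu n i k)
    (fun i => M.avg (M.gam n) i - M.gam n i k) (priority n)

/-- Generator of `(Xⁿ, Jⁿ)` under the static priority policy. -/
def gen (n : ℕ) (f : (Fin d → ℝ) → Fin K → ℝ) (x : Fin d → ℝ) (k : Fin K) : ℝ :=
  M.genEnv n k (fun y => f y k) x + ∑ k', (n : ℝ) ^ M.α * M.Q k k' * (f x k' - f x k)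

/-- Diffusion scaling `x̂ⁿ(x) = n^{-β} (x - n ρ)`. -/
def scale (n : ℕ) (x : Fin d → ℝ) : Fin d → ℝ :=
  fun i => (n : ℝ) ^ (-M.β) * (x i - M.ρ i * n)

/-- Inverse of the diffusion scaling (for `n > 0`). -/
def unscale (n : ℕ) (y : Fin d → ℝ) : Fin d → ℝ :=
  fun i => (n : ℝ) ^ M.β * y i + M.ρ i * n

/-- The scaled lattice `𝔛ⁿ = x̂ⁿ(ℤ₊^d)`. -/
def lattice (n : ℕ) : Set (Fin d → ℝ) :=
  Set.range fun x : Fin d → ℕ => M.scale n (fun i => (x i : ℝ))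

/-- Generator of `(X̂ⁿ, Jⁿ)`: the generator of `(Xⁿ, Jⁿ)` transported by the scaling. -/
def genHat (n : ℕ) (f : (Fin d → ℝ) → Fin K → ℝ) (y : Fin d → ℝ) (k : Fin K) : ℝ :=
  M.gen n (fun x l => f (M.scale n x) l) (M.unscale n y) k

/-- The operator `ΔLⁿ_k` transported by the scaling. -/
def genDeltaHat (n : ℕ) (k : Fin K) (f : (Fin d → ℝ) → ℝ) (y : Fin d → ℝ) : ℝ :=
  M.genDelta n k (fun x => f (M.scale n x)) (M.unscale n y)

/-- `V_{m,ξ}(y) = ∑ ξ_i |y_i|^m`. -/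
def V (m : ℕ) (ξ : Fin d → ℝ) (y : Fin d → ℝ) : ℝ := ∑ i, ξ i * |y i| ^ m

/-- The corrected Lyapunov function `V̂ⁿ_{m,ξ}`. -/
def VHat (c : Fin K → Fin K → ℝ) (n m : ℕ) (ξ : Fin d → ℝ) (y : Fin d → ℝ) (k : Fin K) : ℝ :=
  V m ξ y + (1 / (n : ℝ) ^ M.α) * ∑ k', c k k' * M.genDeltaHat n k' (V m ξ) y

/-- `c` solves the Poisson equation of the environment: for every centered `h`, the function
`φ k = ∑ l, c k l * h l` satisfies `∑ k', Q k k' * (φ k' - φ k) = h k`. -/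
def PoissonKernel (c : Fin K → Fin K → ℝ) : Prop :=
  ∀ h : Fin K → ℝ, ∑ k, M.π k * h k = 0 →
    ∀ k, ∑ k', M.Q k k' * ((∑ l, c k' l * h l) - ∑ l, c k l * h l) = h k

/-- `ξ` is a weight for which the uncorrected function `f_n(x) = ∑ ξ_i |x_i - n ρ_i|^m` is a
Foster-Lyapunov function of the averaged process:
`L̄ⁿ f_n ≤ C₁ n^{mβ} - C₂ f_n` on `ℤ₊^d` for all large `n`. -/
def AveragedWeight (m : ℕ) (ξ : Fin d → ℝ) : Prop :=
  (∀ i, 0 < ξ i) ∧ ∃ C₁ > 0, ∃ C₂ > 0, ∃ n₀ : ℕ, ∀ n ≥ n₀, ∀ x : Fin d → ℕ,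
    M.genAvg n (fun y => V m ξ (fun i => y i - M.ρ i * n)) (fun i => (x i : ℝ))
      ≤ C₁ * (n : ℝ) ^ (m * M.β) - C₂ * V m ξ (fun i => (x i : ℝ) - M.ρ i * n)

/-- Rate matrix of the chain `(Xⁿ, Jⁿ)` on `ℤ₊^d × {1,…,K}` under the static priority policy:
the entry at `(s, s')` is the generator applied to the indicator of `s'`, evaluated at `s`. -/
def rate (n : ℕ) (s s' : (Fin d → ℕ) × Fin K) : ℝ :=
  M.gen n
    (fun y l => Set.indicator {((fun i => (s'.1 i : ℝ)), s'.2)} (fun _ => (1 : ℝ)) (y, l))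
    (fun i => (s.1 i : ℝ)) s.2

/-- Initial law of `(Xⁿ, Jⁿ)`: `Xⁿ(0) = x₀` is deterministic and `Jⁿ(0)` has law `π`. -/
def initialLaw (x₀ : Fin d → ℕ) (s : (Fin d → ℕ) × Fin K) : ℝ≥0∞ :=
  if s.1 = x₀ then ENNReal.ofReal (M.π s.2) else 0

/-- `limsup_{T → ∞} (1/T) E ∫₀ᵀ |X̂ⁿ(s)|^p ds`, with the Euclidean norm, where `X̂ⁿ` is the scaled
first component of `Y`. -/
def longRunMoment (n : ℕ) (p : ℝ) {Ω : Type*} [MeasurableSpace Ω] (P : Measure Ω)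
    (Y : ℝ≥0 → Ω → (Fin d → ℕ) × Fin K) : ℝ≥0∞ :=
  limsup (fun T : ℝ => (ENNReal.ofReal T)⁻¹ *
    ∫⁻ ω, (∫⁻ s : ℝ in Set.Icc 0 T,
      ENNReal.ofReal (‖WithLp.toLp 2 (M.scale n (fun i => ((Y s.toNNReal ω).1 i : ℝ)))‖ ^ p)) ∂P)
    atTop

end Queue

end MMQ

end

/-!
The proof has three independent ingredients.

**Lyapunov functions and chains.** For the minimal transition function of a conservative rate matrix
`A` on a countable set, the first-jump equation and induction on the number of jumps give the
Chapman-Kolmogorov equation (`transition_add`) and show that a drift condition `A V ≤ C - c V`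
implies `P_t V ≤ e^{-ct} V + (C/c) (1 - e^{-ct})` (`HasDrift.transAct_le`). If `V` has finite
sublevel sets the chain does not explode (`HasDrift.tsum_transition`); if moreover one state is
accessible from everywhere, the Hairer-Mattingly form of Harris' theorem
(`IsMarkovFamily.exists_invariant`) yields geometric ergodicity, because on the finite sublevel sets
of `V` the transition probabilities to that state have a positive minimum. Integrating the bound on
`P_t V` in time controls the long-run averages of functions dominated by `V`
(`HasDrift.limsup_average_le`).

**The averaged process.** Under the priority policy class `i` finds at least
`n ρ_i - ∑ j < i, |x_j - n ρ_j|` servers, so that its drift points towards `n ρ_i` up to an error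
caused by the classes of higher priority (`Standing.restoring_drift`). Weights `ξ_i = θ^i` with small
`θ` absorb this error through Young's inequality (`Standing.exists_averagedWeight`).

**The correction.** The Poisson equation of the environment, solvable because the harmonic functions
of an irreducible `Q` are constant (`Standing.exists_poissonKernel`), makes the action of the
environment generator on the correction cancel the difference between the frozen and the averaged
generator. What remains is `n^{-α}` times a composition of two birth-death operators applied to `f_n`
(`Standing.gen_corrected`). With `s = n^β + ∑ |x_i - n ρ_i|`, each such operator costs a factor
`n + s` and gains a factor `1/s`, so the remainder is of order
`n^{-α} (n + s)^2 s^{m-2}`, and `β ≥ 1 - α/2` bounds this by `n^β s^{m-1} + n^{-α} s^m`, which is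
negligible with respect to `f_n` up to a multiple of `n^{mβ}`
(`Standing.eventually_correction_small`, `Standing.exists_corrected_drift`).

Geometric ergodicity does not need the correction: for each fixed `n ≥ 1` abandonment alone makes
`∑ (x_i + 1)^m` a Lyapunov function (`Standing.hasDrift_powLyapunov`), and the empty system is
accessible. The same function bounds the `p`-th long-run moments for the finitely many `n` below the
threshold, depending on `p`, from which the corrected function of an even order above `p` gives a
bound that is uniform in `n`.
-/

namespace MMQ

/-! ### The minimal transition function -/

section Chain

variable {S : Type*} [DecidableEq S]

/-- The first-jump operator of the rate matrix `A`: `u (t, ·)` is the value collected over a time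
`t`, and `jumpInt A u t x` averages `u` at the state and the remaining time right after the first
jump from `x`, on the event that this jump occurs before time `t`. -/
noncomputable def jumpInt (A : S → S → ℝ) (u : ℝ → S → ℝ≥0∞) (t : ℝ) (x : S) : ℝ≥0∞ :=
  ∫⁻ s in Set.Icc 0 t, ∑' z : S,
    if z = x then 0
    else ENNReal.ofReal (Real.exp (A x x * s)) * ENNReal.ofReal (A x z) * u (t - s) z

lemma iter_succ (A : S → S → ℝ) (N : ℕ) (t : ℝ) (x y : S) :
    iter A (N + 1) t x y = (if x = y then ENNReal.ofReal (Real.exp (A x x * t)) else 0) +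
      jumpInt A (fun r z => iter A N r z y) t x := rfl

lemma jumpInt_mono (A : S → S → ℝ) {u v : ℝ → S → ℝ≥0∞} {t : ℝ} (x : S)
    (h : ∀ r, 0 ≤ r → r ≤ t → ∀ z, u r z ≤ v r z) : jumpInt A u t x ≤ jumpInt A v t x := by
  refine setLIntegral_mono' measurableSet_Icc fun s hs => ENNReal.tsum_le_tsum fun z => ?_
  split_ifs
  · exact le_rfl
  · gcongr
    exact h _ (by linarith [hs.2]) (by linarith [hs.1]) z

variable [Countable S]

lemma measurable_jumpInt_integrand (A : S → S → ℝ) {u : ℝ → S → ℝ≥0∞}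
    (hu : ∀ z, Measurable fun t => u t z) (x : S) :
    Measurable (fun p : ℝ × ℝ => ∑' z : S, if z = x then 0
    else ENNReal.ofReal (Real.exp (A x x * p.2)) * ENNReal.ofReal (A x z) * u (p.1 - p.2) z) := by
  refine Measurable.tsum fun z => ?_
  split_ifs
  · exact measurable_const
  · have := (hu z).comp (measurable_fst.sub measurable_snd : Measurable fun p : ℝ × ℝ => p.1 - p.2)
    exact Measurable.mul (by fun_prop) this

lemma measurable_jumpInt_slice (A : S → S → ℝ) {u : ℝ → S → ℝ≥0∞}
    (hu : ∀ z, Measurable fun t => u t z) (t : ℝ) (x : S) :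
    Measurable (fun s : ℝ => ∑' z : S, if z = x then 0
    else ENNReal.ofReal (Real.exp (A x x * s)) * ENNReal.ofReal (A x z) * u (t - s) z) :=
  (measurable_jumpInt_integrand A hu x).comp (measurable_prodMk_left (x := t))

lemma measurable_jumpInt (A : S → S → ℝ) {u : ℝ → S → ℝ≥0∞}
    (hu : ∀ z, Measurable fun t => u t z) (x : S) : Measurable fun t => jumpInt A u t x := by
  have h : Measurable fun t => ∫⁻ s, ({p : ℝ × ℝ | 0 ≤ p.2 ∧ p.2 ≤ p.1}.indicator
      (fun p : ℝ × ℝ => ∑' z : S, if z = x then 0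
        else ENNReal.ofReal (Real.exp (A x x * p.2)) * ENNReal.ofReal (A x z) *
          u (p.1 - p.2) z)) (t, s) := by
    refine Measurable.lintegral_prod_right' ?_
    refine (measurable_jumpInt_integrand A hu x).indicator ?_
    exact (measurableSet_le measurable_const measurable_snd).inter
      (measurableSet_le measurable_snd measurable_fst)
  convert h using 2 with t
  rw [jumpInt, ← lintegral_indicator measurableSet_Icc]
  rfl

lemma measurable_iter (A : S → S → ℝ) (N : ℕ) (x y : S) : Measurable fun t => iter A N t x y := by
  induction N generalizing x with
  | zero => exact measurable_const
  | succ N ih =>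
    simp only [iter_succ]
    refine Measurable.add ?_ (measurable_jumpInt A ih x)
    split_ifs <;> fun_prop

lemma measurable_transition (A : S → S → ℝ) (x y : S) :
    Measurable fun t => transition A t x y :=
  Measurable.iSup fun N => measurable_iter A N x y

lemma jumpInt_add (A : S → S → ℝ) {u v : ℝ → S → ℝ≥0∞} (hu : ∀ z, Measurable fun t => u t z)
    (t : ℝ) (x : S) :
    jumpInt A (fun r z => u r z + v r z) t x = jumpInt A u t x + jumpInt A v t x := by
  have hm := measurable_jumpInt_slice A hu t x
  rw [jumpInt, jumpInt, jumpInt, ← lintegral_add_left hm]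
  refine lintegral_congr fun s => ?_
  rw [← ENNReal.tsum_add]
  refine tsum_congr fun z => ?_
  split_ifs <;> simp [mul_add]

lemma jumpInt_tsum_mul (A : S → S → ℝ) {u : S → ℝ → S → ℝ≥0∞}
    (hu : ∀ y z, Measurable fun t => u y t z) (f : S → ℝ≥0∞) (t : ℝ) (x : S) :
    jumpInt A (fun r z => ∑' y, u y r z * f y) t x = ∑' y, jumpInt A (u y) t x * f y := by
  have hm := fun y => measurable_jumpInt_slice A (hu y) t x
  simp only [jumpInt]
  simp_rw [fun y => (lintegral_mul_const (μ := volume.restrict (Set.Icc 0 t)) (f y) (hm y)).symm]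
  rw [← lintegral_tsum fun y => ((hm y).mul_const _).aemeasurable]
  refine lintegral_congr fun s => ?_
  simp only [← ENNReal.tsum_mul_right]
  rw [ENNReal.tsum_comm]
  refine tsum_congr fun z => ?_
  split_ifs
  · simp
  · rw [← ENNReal.tsum_mul_left]
    exact tsum_congr fun y => (mul_assoc _ _ _).symm

lemma jumpInt_iSup (A : S → S → ℝ) {u : ℕ → ℝ → S → ℝ≥0∞}
    (hu : ∀ N z, Measurable fun t => u N t z) (hmono : ∀ t z, Monotone fun N => u N t z)
    (t : ℝ) (x : S) :
    jumpInt A (fun r z => ⨆ N, u N r z) t x = ⨆ N, jumpInt A (u N) t x := by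
  have hm := fun N => measurable_jumpInt_slice A (hu N) t x
  have hle : ∀ s, Monotone fun N => ∑' z : S, if z = x then 0
      else ENNReal.ofReal (Real.exp (A x x * s)) * ENNReal.ofReal (A x z) * u N (t - s) z := by
    intro s N N' hN
    refine ENNReal.tsum_le_tsum fun z => ?_
    split_ifs
    · exact le_rfl
    · gcongr
      exact hmono _ _ hN
  simp only [jumpInt]
  rw [← lintegral_iSup hm fun N N' hN s => hle s hN]
  refine lintegral_congr fun s => ?_
  simp only [ENNReal.tsum_eq_iSup_sum]
  rw [iSup_comm]
  refine iSup_congr fun F => ?_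
  rw [← ENNReal.finsetSum_iSup_of_monotone]
  · refine Finset.sum_congr rfl fun z _ => ?_
    split_ifs
    · simp
    · rw [ENNReal.mul_iSup]
  · intro z N N' hN
    dsimp only
    split_ifs
    · exact le_rfl
    · gcongr
      exact hmono _ _ hN

omit [Countable S] in
/-- Restarting after time `t`: either the first jump occurs before `t`, or the state is kept up to
time `t` and the first jump occurs in the remaining time `s`. -/
lemma jumpInt_add_time (A : S → S → ℝ) (u : ℝ → S → ℝ≥0∞) {t s : ℝ} (ht : 0 ≤ t) (hs : 0 ≤ s)
    (x : S) :
    jumpInt A u (t + s) x = jumpInt A (fun r z => u (r + s) z) t x +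
      ENNReal.ofReal (Real.exp (A x x * t)) * jumpInt A u s x := by
  have hU : Set.Icc (0 : ℝ) (t + s) = Set.Ico 0 t ∪ Set.Icc t (t + s) :=
    (Set.Ico_union_Icc_eq_Icc ht (by linarith)).symm
  have hd : Disjoint (Set.Ico (0 : ℝ) t) (Set.Icc t (t + s)) := by
    rw [Set.disjoint_left]
    intro a ha hb
    exact absurd hb.1 (not_le.2 ha.2)
  rw [jumpInt, hU, lintegral_union measurableSet_Icc hd]
  congr 1
  · rw [jumpInt, setLIntegral_congr Ico_ae_eq_Icc]
    refine lintegral_congr fun r => ?_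
    simp only [show t + s - r = t - r + s by ring]
  · rw [jumpInt, ← lintegral_const_mul' _ _ ENNReal.ofReal_ne_top]
    have hmp : MeasurePreserving (fun r : ℝ => r + t) volume volume :=
      measurePreserving_add_right _ t
    have := hmp.setLIntegral_comp_preimage_emb (measurableEmbedding_addRight t)
      (fun r => ∑' z : S, if z = x then 0 else ENNReal.ofReal (Real.exp (A x x * r)) *
        ENNReal.ofReal (A x z) * u (t + s - r) z) (Set.Icc t (t + s))
    rw [← this]
    have hpre : (fun r : ℝ => r + t) ⁻¹' Set.Icc t (t + s) = Set.Icc 0 s := by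
      ext r; simp only [Set.mem_preimage, Set.mem_Icc]; constructor <;> rintro ⟨h1, h2⟩ <;>
        constructor <;> linarith
    rw [hpre]
    refine lintegral_congr fun r => ?_
    rw [← ENNReal.tsum_mul_left]
    refine tsum_congr fun z => ?_
    split_ifs
    · simp
    · rw [show t + s - (r + t) = s - r by ring, mul_add, Real.exp_add,
        ENNReal.ofReal_mul (Real.exp_pos _).le]
      ring

omit [Countable S] in
lemma iter_le_succ (A : S → S → ℝ) (N : ℕ) (t : ℝ) (x y : S) :
    iter A N t x y ≤ iter A (N + 1) t x y := by
  induction N generalizing t x with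
  | zero => exact zero_le
  | succ N ih =>
    rw [iter_succ, iter_succ A (N + 1)]
    gcongr
    exact jumpInt_mono A x fun r _ _ z => ih r z

omit [Countable S] in
lemma iter_mono (A : S → S → ℝ) (t : ℝ) (x y : S) : Monotone fun N => iter A N t x y :=
  monotone_nat_of_le_succ fun N => iter_le_succ A N t x y

omit [Countable S] in
lemma iter_le_transition (A : S → S → ℝ) (N : ℕ) (t : ℝ) (x y : S) :
    iter A N t x y ≤ transition A t x y := le_iSup (fun N => iter A N t x y) N

/-- The backward equation in integrated form. -/
lemma transition_eq (A : S → S → ℝ) (t : ℝ) (x y : S) :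
    transition A t x y = (if x = y then ENNReal.ofReal (Real.exp (A x x * t)) else 0) +
      jumpInt A (fun r z => transition A r z y) t x := by
  have h1 : transition A t x y = ⨆ N, iter A (N + 1) t x y :=
    ((iter_mono A t x y).iSup_nat_add 1).symm
  simp only [h1, iter_succ]
  rw [← ENNReal.add_iSup, ← jumpInt_iSup A (fun N z => measurable_iter A N z y)
    fun r z => iter_mono A r z y]
  rfl

/-- `∑ y, iter A N t x y * f y`: the expectation of `f` at time `t` on the event of fewer than `N`
jumps. -/
noncomputable def iterAct (A : S → S → ℝ) (f : S → ℝ≥0∞) (N : ℕ) (t : ℝ) (x : S) : ℝ≥0∞ :=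
  ∑' y, iter A N t x y * f y

/-- `∑ y, P_t(x,y) f(y)`. -/
noncomputable def transAct (A : S → S → ℝ) (f : S → ℝ≥0∞) (t : ℝ) (x : S) : ℝ≥0∞ :=
  ∑' y, transition A t x y * f y

lemma iterAct_succ (A : S → S → ℝ) (f : S → ℝ≥0∞) (N : ℕ) (t : ℝ) (x : S) :
    iterAct A f (N + 1) t x = ENNReal.ofReal (Real.exp (A x x * t)) * f x +
      jumpInt A (iterAct A f N) t x := by
  simp only [iterAct, iter_succ, add_mul]
  rw [ENNReal.tsum_add]
  congr 1
  · rw [tsum_eq_single x fun y hy => by simp [hy.symm]]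
    simp
  · exact (jumpInt_tsum_mul A (fun y z => measurable_iter A N z y) f t x).symm

lemma transAct_eq (A : S → S → ℝ) (f : S → ℝ≥0∞) (t : ℝ) (x : S) :
    transAct A f t x = ENNReal.ofReal (Real.exp (A x x * t)) * f x +
      jumpInt A (transAct A f) t x := by
  simp only [transAct]
  simp_rw [fun y => transition_eq A t x y, add_mul]
  rw [ENNReal.tsum_add]
  congr 1
  · rw [tsum_eq_single x fun y hy => by simp [hy.symm]]
    simp
  · exact (jumpInt_tsum_mul A (fun y z => measurable_transition A z y) f t x).symm

lemma measurable_iterAct (A : S → S → ℝ) (f : S → ℝ≥0∞) (N : ℕ) (x : S) :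
    Measurable fun t => iterAct A f N t x :=
  Measurable.tsum fun y => (measurable_iter A N x y).mul_const _

omit [Countable S] in
lemma transAct_eq_iSup (A : S → S → ℝ) (f : S → ℝ≥0∞) (t : ℝ) (x : S) :
    transAct A f t x = ⨆ N, iterAct A f N t x := by
  simp only [transAct, iterAct, transition, ENNReal.iSup_mul, ENNReal.tsum_eq_iSup_sum]
  rw [iSup_comm]
  refine iSup_congr fun F => ?_
  rw [ENNReal.finsetSum_iSup_of_monotone]
  intro y N N' hN
  dsimp only
  gcongr
  exact iter_mono A t x y hN

/-- The Chapman-Kolmogorov equation. -/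
lemma transition_add (A : S → S → ℝ) {t s : ℝ} (ht : 0 ≤ t) (hs : 0 ≤ s) (x y : S) :
    transition A (t + s) x y = ∑' z, transition A t x z * transition A s z y := by
  have key : ∀ {t : ℝ} (x : S), (if x = y then ENNReal.ofReal (Real.exp (A x x * (t + s))) else 0)
      = ENNReal.ofReal (Real.exp (A x x * t)) *
        (if x = y then ENNReal.ofReal (Real.exp (A x x * s)) else 0) := by
    intro t x
    split_ifs
    · rw [mul_add, Real.exp_add, ENNReal.ofReal_mul (Real.exp_pos _).le]
    · simp
  apply le_antisymm
  · refine iSup_le fun N => ?_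
    change iter A N (t + s) x y ≤ transAct A (fun z => transition A s z y) t x
    induction N generalizing t x with
    | zero => exact zero_le
    | succ N ih =>
      rw [iter_succ, key, jumpInt_add_time A _ ht hs, transAct_eq, add_left_comm, ← mul_add,
        ← iter_succ, add_comm]
      gcongr
      · exact iter_le_transition A _ _ _ _
      · exact jumpInt_mono A x fun r hr _ z => ih hr z
  · change transAct A (fun z => transition A s z y) t x ≤ _
    rw [transAct_eq_iSup]
    refine iSup_le fun N => ?_
    induction N generalizing t x with
    | zero => simp [iterAct, iter]
    | succ N ih =>
      rw [iterAct_succ, transition_eq A (t + s), key, jumpInt_add_time A _ ht hs, add_left_comm,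
        ← mul_add, ← transition_eq, add_comm]
      gcongr
      exact jumpInt_mono A x fun r hr _ z => ih hr z

/-! ### Lyapunov functions and non-explosion -/

/-- `A` is a conservative rate matrix: the off-diagonal entries of each row are nonnegative and add
up to minus the diagonal entry. -/
structure IsConservative (A : S → S → ℝ) : Prop where
  diag : ∀ x, A x x ≤ 0
  row : ∀ x, ∑' z, (if z = x then 0 else ENNReal.ofReal (A x z)) = ENNReal.ofReal (-A x x)

/-- The Foster-Lyapunov condition `∑ z, A x z * V z ≤ C - c * V x`, with the diagonal term moved to
the right-hand side so that the sum over `z ≠ x` has nonnegative terms. -/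
structure HasDrift (A : S → S → ℝ) (V : S → ℝ) (c C : ℝ) : Prop where
  c_pos : 0 < c
  C_nonneg : 0 ≤ C
  one_le : ∀ x, 1 ≤ V x
  rhs_nonneg : ∀ x, 0 ≤ (-A x x - c) * V x + C
  drift : ∀ x, ∑' z, (if z = x then 0 else ENNReal.ofReal (A x z) * ENNReal.ofReal (V z)) ≤
    ENNReal.ofReal ((-A x x - c) * V x + C)

/-- The solution `e^{-ct} v + (C/c) (1 - e^{-ct})` of `h' = C - c h`, `h 0 = v`. -/
noncomputable def driftBound (c C t v : ℝ) : ℝ :=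
  Real.exp (-c * t) * v + C / c * (1 - Real.exp (-c * t))

omit [Countable S] in
lemma HasDrift.driftBound_nonneg {A : S → S → ℝ} {V : S → ℝ} {c C : ℝ} (h : HasDrift A V c C)
    {t : ℝ} (ht : 0 ≤ t) (x : S) : 0 ≤ driftBound c C t (V x) := by
  have h1 : Real.exp (-c * t) ≤ 1 := Real.exp_le_one_iff.2 (by nlinarith [h.c_pos])
  have h2 := h.one_le x
  have h3 : 0 ≤ C / c := div_nonneg h.C_nonneg h.c_pos.le
  unfold driftBound
  have := Real.exp_pos (-c * t)
  have h4 : 0 ≤ 1 - Real.exp (-c * t) := by linarith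
  positivity

omit [Countable S] in
/-- `driftBound` is a supersolution of the first-jump equation. -/
lemma HasDrift.supersolution {A : S → S → ℝ} {V : S → ℝ} {c C : ℝ} (h : HasDrift A V c C)
    (hA : IsConservative A) {t : ℝ} (ht : 0 ≤ t) (x : S) :
    ENNReal.ofReal (Real.exp (A x x * t)) * ENNReal.ofReal (V x) +
      jumpInt A (fun r z => ENNReal.ofReal (driftBound c C r (V z))) t x ≤
    ENNReal.ofReal (driftBound c C t (V x)) := by
  have hc := h.c_pos
  have hV := h.one_le x
  set a := A x x with ha
  have hD : 0 ≤ C / c := div_nonneg h.C_nonneg hc.le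
  let G : ℝ → ℝ := fun s => -(Real.exp (a * s) * driftBound c C (t - s) (V x))
  let g : ℝ → ℝ := fun s => Real.exp (a * s) * (Real.exp (-c * (t - s)) * ((-a - c) * V x + C) +
    C / c * (1 - Real.exp (-c * (t - s))) * (-a))
  have hG : ∀ s, HasDerivAt G (g s) s := by
    intro s
    have h1 : HasDerivAt (fun s => Real.exp (a * s)) (Real.exp (a * s) * (a * 1)) s :=
      ((hasDerivAt_id s).const_mul a).exp
    have h2 : HasDerivAt (fun s => Real.exp (-c * (t - s)))
        (Real.exp (-c * (t - s)) * (-c * (-1))) s :=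
      (((hasDerivAt_id s).const_sub t).const_mul (-c)).exp
    have h3 := (h1.mul ((h2.mul_const (V x)).add ((h2.const_sub 1).const_mul (C / c)))).neg
    refine h3.congr_deriv ?_
    simp only [g, Pi.add_apply]
    field_simp
    ring
  have hg0 : ∀ s ∈ Set.Icc 0 t, 0 ≤ g s := by
    intro s hs
    have h1 : Real.exp (-c * (t - s)) ≤ 1 := Real.exp_le_one_iff.2 (by nlinarith [hs.2])
    have h4 : 0 ≤ 1 - Real.exp (-c * (t - s)) := by linarith
    have h5 : 0 ≤ -a := by linarith [hA.diag x]
    have h6 := h.rhs_nonneg x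
    positivity
  have hle : jumpInt A (fun r z => ENNReal.ofReal (driftBound c C r (V z))) t x ≤
      ∫⁻ s in Set.Icc 0 t, ENNReal.ofReal (g s) := by
    refine setLIntegral_mono' measurableSet_Icc fun s hs => ?_
    have h1 : Real.exp (-c * (t - s)) ≤ 1 := Real.exp_le_one_iff.2 (by nlinarith [hs.2])
    have h4 : 0 ≤ 1 - Real.exp (-c * (t - s)) := by linarith
    have hsplit : ∀ z, (if z = x then 0 else ENNReal.ofReal (Real.exp (a * s)) *
        ENNReal.ofReal (A x z) * ENNReal.ofReal (driftBound c C (t - s) (V z))) =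
        ENNReal.ofReal (Real.exp (a * s)) * (ENNReal.ofReal (Real.exp (-c * (t - s))) *
          (if z = x then 0 else ENNReal.ofReal (A x z) * ENNReal.ofReal (V z)) +
          ENNReal.ofReal (C / c * (1 - Real.exp (-c * (t - s)))) *
          (if z = x then 0 else ENNReal.ofReal (A x z))) := by
      intro z
      split_ifs
      · simp
      · have := h.one_le z
        rw [driftBound, ENNReal.ofReal_add (by positivity) (by positivity),
          ENNReal.ofReal_mul (by positivity)]
        ring
    rw [tsum_congr hsplit, ENNReal.tsum_mul_left, ENNReal.tsum_add, ENNReal.tsum_mul_left, ENNReal.tsum_mul_left,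
      hA.row]
    have h5 : 0 ≤ -a := by linarith [hA.diag x]
    have h6 := h.rhs_nonneg x
    rw [ENNReal.ofReal_mul (Real.exp_pos _).le, ENNReal.ofReal_add (by positivity)
      (by positivity), ENNReal.ofReal_mul (Real.exp_pos _).le,
      ENNReal.ofReal_mul (by positivity : 0 ≤ C / c * (1 - Real.exp (-c * (t - s))))]
    gcongr
    exact h.drift x
  have hgc : Continuous g := by fun_prop
  have hint : ∫⁻ s in Set.Icc 0 t, ENNReal.ofReal (g s) = ENNReal.ofReal (G t - G 0) := by
    rw [← ofReal_integral_eq_lintegral_ofReal (hgc.integrableOn_Icc)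
      ((ae_restrict_iff' measurableSet_Icc).2 (Eventually.of_forall hg0)),
      integral_Icc_eq_integral_Ioc, ← intervalIntegral.integral_of_le ht,
      intervalIntegral.integral_eq_sub_of_hasDerivAt (fun s _ => hG s)
        (hgc.intervalIntegrable _ _)]
  have hG0 : G t - G 0 = driftBound c C t (V x) - Real.exp (a * t) * V x := by
    simp only [G, driftBound]
    simp
    ring
  have hGnn : 0 ≤ G t - G 0 := by
    have : 0 ≤ ∫ s in (0:ℝ)..t, g s := intervalIntegral.integral_nonneg ht fun s hs => hg0 s hs
    rwa [intervalIntegral.integral_eq_sub_of_hasDerivAt (fun s _ => hG s)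
        (hgc.intervalIntegrable _ _)] at this
  calc _ ≤ ENNReal.ofReal (Real.exp (a * t) * V x) + ENNReal.ofReal (G t - G 0) := by
        rw [← ENNReal.ofReal_mul (Real.exp_pos _).le]
        gcongr
        exact hle.trans hint.le
    _ = ENNReal.ofReal (driftBound c C t (V x)) := by
        rw [← ENNReal.ofReal_add (by positivity) hGnn, hG0]
        congr 1
        ring

/-- Under a Foster-Lyapunov condition, `P_t V ≤ e^{-ct} V + (C/c) (1 - e^{-ct})`. -/
lemma HasDrift.transAct_le {A : S → S → ℝ} {V : S → ℝ} {c C : ℝ} (h : HasDrift A V c C)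
    (hA : IsConservative A) {t : ℝ} (ht : 0 ≤ t) (x : S) :
    transAct A (fun y => ENNReal.ofReal (V y)) t x ≤ ENNReal.ofReal (driftBound c C t (V x)) := by
  rw [transAct_eq_iSup]
  refine iSup_le fun N => ?_
  induction N generalizing t x with
  | zero => simp [iterAct, iter]
  | succ N ih =>
    rw [iterAct_succ]
    refine le_trans ?_ (h.supersolution hA ht x)
    gcongr
    exact jumpInt_mono A x fun r hr _ z => ih hr z

/-- The probability that at least `N` jumps occur up to time `t`. -/
noncomputable def jumpTail (A : S → S → ℝ) : ℕ → ℝ → S → ℝ≥0∞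
  | 0 => fun _ _ => 1
  | N + 1 => jumpInt A (jumpTail A N)

omit [Countable S] in
lemma IsConservative.jumpInt_one {A : S → S → ℝ} (hA : IsConservative A) {t : ℝ} (ht : 0 ≤ t)
    (x : S) :
    ENNReal.ofReal (Real.exp (A x x * t)) + jumpInt A (fun _ _ => 1) t x = 1 := by
  have h1 : jumpInt A (fun _ _ => 1) t x =
      ∫⁻ s in Set.Icc 0 t, ENNReal.ofReal (Real.exp (A x x * s) * -A x x) := by
    refine lintegral_congr fun s => ?_
    rw [ENNReal.ofReal_mul (Real.exp_pos _).le, ← hA.row, ← ENNReal.tsum_mul_left]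
    refine tsum_congr fun z => ?_
    split_ifs <;> simp
  have hG : ∀ s, HasDerivAt (fun s => -Real.exp (A x x * s)) (Real.exp (A x x * s) * -A x x) s := by
    intro s
    refine ((hasDerivAt_id s).const_mul (A x x)).exp.neg.congr_deriv ?_
    simp
  have hgc : Continuous fun s => Real.exp (A x x * s) * -A x x := by fun_prop
  have h5 : 0 ≤ -A x x := by linarith [hA.diag x]
  rw [h1, ← ofReal_integral_eq_lintegral_ofReal (hgc.integrableOn_Icc)
      (Eventually.of_forall fun s => by positivity),
      integral_Icc_eq_integral_Ioc, ← intervalIntegral.integral_of_le ht,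
      intervalIntegral.integral_eq_sub_of_hasDerivAt (fun s _ => hG s)
        (hgc.intervalIntegrable _ _), ← ENNReal.ofReal_add (Real.exp_pos _).le]
  · simp
  · have : Real.exp (A x x * t) ≤ 1 := Real.exp_le_one_iff.2 (by nlinarith)
    simpa using this

lemma IsConservative.iterAct_one_add {A : S → S → ℝ} (hA : IsConservative A) (N : ℕ) {t : ℝ}
    (ht : 0 ≤ t) (x : S) : iterAct A (fun _ => 1) N t x + jumpTail A N t x = 1 := by
  induction N generalizing t x with
  | zero => simp [iterAct, iter, jumpTail]
  | succ N ih =>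
    rw [iterAct_succ, jumpTail, mul_one, add_assoc, ← jumpInt_add A (measurable_iterAct A _ N)]
    refine Eq.trans ?_ (hA.jumpInt_one ht x)
    refine congrArg (ENNReal.ofReal (Real.exp (A x x * t)) + ·) ?_
    exact le_antisymm (jumpInt_mono A x fun r hr _ z => (ih hr z).le)
      (jumpInt_mono A x fun r hr _ z => (ih hr z).ge)

/-- On a finite time interval the probability of `N` jumps is at most `ε` times the Lyapunov bound
plus a Poisson-type term: where the Lyapunov function is large the first term exceeds one, and
elsewhere the jump rates are bounded by some `q`. -/
lemma HasDrift.jumpTail_le {A : S → S → ℝ} {V : S → ℝ} {c C : ℝ} (h : HasDrift A V c C)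
    (hA : IsConservative A) {T ε q : ℝ} (hε : 0 < ε) (hq : 0 ≤ q)
    (hrate : ∀ x, ε * (Real.exp (-c * T) * V x) ≤ 1 → -A x x ≤ q) (N : ℕ) {t : ℝ} (ht : 0 ≤ t)
    (htT : t ≤ T) (x : S) :
    jumpTail A N t x ≤ ENNReal.ofReal ε * ENNReal.ofReal (driftBound c C t (V x)) +
      ENNReal.ofReal ((q * t) ^ N / N.factorial) := by
  induction N generalizing t x with
  | zero => simp [jumpTail]
  | succ N ih =>
    by_cases hx : ε * (Real.exp (-c * T) * V x) ≤ 1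
    · set u : ℝ → S → ℝ≥0∞ := fun r z =>
        ENNReal.ofReal ε * ENNReal.ofReal (driftBound c C r (V z)) with hu
      set v : ℝ → S → ℝ≥0∞ := fun r _ => ENNReal.ofReal ((q * r) ^ N / N.factorial) with hv
      have hmono : jumpTail A (N + 1) t x ≤ jumpInt A (fun r z => u r z + v r z) t x :=
        jumpInt_mono A x fun r hr hrt z => ih hr (hrt.trans htT) z
      have hum : ∀ z, Measurable fun t => u t z := by
        intro z
        simp only [hu, driftBound]
        fun_prop
      rw [jumpInt_add A hum] at hmono
      have h1 : jumpInt A u t x ≤ ENNReal.ofReal ε * ENNReal.ofReal (driftBound c C t (V x)) := by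
        have : jumpInt A u t x = ENNReal.ofReal ε *
            jumpInt A (fun r z => ENNReal.ofReal (driftBound c C r (V z))) t x := by
          rw [jumpInt, jumpInt, ← lintegral_const_mul' _ _ ENNReal.ofReal_ne_top]
          refine lintegral_congr fun s => ?_
          rw [← ENNReal.tsum_mul_left]
          refine tsum_congr fun z => ?_
          split_ifs
          · simp
          · simp only [hu]; ring
        rw [this]
        gcongr
        exact le_add_self.trans (h.supersolution hA ht x)
      have h2 : jumpInt A v t x ≤ ENNReal.ofReal ((q * t) ^ (N + 1) / (N + 1).factorial) := by
        have hle : jumpInt A v t x ≤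
            ∫⁻ s in Set.Icc 0 t, ENNReal.ofReal (q * ((q * (t - s)) ^ N / N.factorial)) := by
          refine setLIntegral_mono' measurableSet_Icc fun s hs => ?_
          have h3 : ∀ z, (if z = x then 0 else ENNReal.ofReal (Real.exp (A x x * s)) *
              ENNReal.ofReal (A x z) * v (t - s) z) = ENNReal.ofReal (Real.exp (A x x * s)) *
              (if z = x then 0 else ENNReal.ofReal (A x z)) *
                ENNReal.ofReal ((q * (t - s)) ^ N / N.factorial) := by
            intro z
            split_ifs <;> simp [hv]
          simp only [h3]
          rw [ENNReal.tsum_mul_right, ENNReal.tsum_mul_left, hA.row, ENNReal.ofReal_mul hq]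
          gcongr
          have h4 : ENNReal.ofReal (Real.exp (A x x * s)) ≤ 1 := by
            rw [ENNReal.ofReal_le_one]
            exact Real.exp_le_one_iff.2 (mul_nonpos_of_nonpos_of_nonneg (hA.diag x) hs.1)
          calc _ ≤ 1 * ENNReal.ofReal q := by
                gcongr
                exact hrate x hx
            _ = _ := one_mul _
        refine hle.trans (le_of_eq ?_)
        have hG : ∀ s, HasDerivAt (fun s => -((q * (t - s)) ^ (N + 1) / (N + 1).factorial))
            (q * ((q * (t - s)) ^ N / N.factorial)) s := by
          intro s
          have h6 := (((((hasDerivAt_id s).const_sub t).const_mul q).pow (N + 1)).div_const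
            ((N + 1).factorial : ℝ)).neg
          refine h6.congr_deriv ?_
          rw [Nat.factorial_succ]
          have : (N.factorial : ℝ) ≠ 0 := by positivity
          push_cast
          simp only [id]
          field_simp
        have hgc : Continuous fun s => q * ((q * (t - s)) ^ N / N.factorial) := by fun_prop
        rw [← ofReal_integral_eq_lintegral_ofReal (hgc.integrableOn_Icc)
          ((ae_restrict_iff' measurableSet_Icc).2 (Eventually.of_forall fun s hs => by
            have : 0 ≤ t - s := by linarith [hs.2]
            positivity)),
          integral_Icc_eq_integral_Ioc, ← intervalIntegral.integral_of_le ht,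
          intervalIntegral.integral_eq_sub_of_hasDerivAt (fun s _ => hG s)
            (hgc.intervalIntegrable _ _)]
        simp
      exact hmono.trans (add_le_add h1 h2)
    · push Not at hx
      have hr1 : jumpTail A (N + 1) t x ≤ 1 :=
        le_add_self.trans (hA.iterAct_one_add (N + 1) ht x).le
      refine hr1.trans (le_add_right ?_)
      rw [← ENNReal.ofReal_mul hε.le, ENNReal.one_le_ofReal]
      refine hx.le.trans ?_
      have h2 := h.one_le x
      have hc := h.c_pos
      have hD : 0 ≤ C / c := div_nonneg h.C_nonneg hc.le
      have h1 : Real.exp (-c * t) ≤ 1 := Real.exp_le_one_iff.2 (by nlinarith)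
      have h3 : Real.exp (-c * T) ≤ Real.exp (-c * t) := Real.exp_le_exp.2 (by nlinarith)
      unfold driftBound
      have h4 : 0 ≤ C / c * (1 - Real.exp (-c * t)) := mul_nonneg hD (by linarith)
      have h5 : Real.exp (-c * T) * V x ≤ Real.exp (-c * t) * V x := by gcongr
      gcongr
      linarith

/-- A chain with a Lyapunov function whose sublevel sets are finite does not explode. -/
lemma HasDrift.tsum_transition {A : S → S → ℝ} {V : S → ℝ} {c C : ℝ} (h : HasDrift A V c C)
    (hA : IsConservative A) (hfin : ∀ R : ℝ, {x | V x ≤ R}.Finite) {t : ℝ} (ht : 0 ≤ t) (x : S) :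
    ∑' y, transition A t x y = 1 := by
  have hP : ∑' y, transition A t x y = ⨆ N, iterAct A (fun _ => 1) N t x := by
    rw [← transAct_eq_iSup]; simp [transAct]
  rw [hP]
  refine le_antisymm (iSup_le fun N => ?_) ?_
  · exact le_self_add.trans (hA.iterAct_one_add N ht x).le
  refine ENNReal.le_of_forall_pos_le_add fun δ hδ _ => ?_
  set L := driftBound c C t (V x) with hL
  have hLn : 0 ≤ L := h.driftBound_nonneg ht x
  -- `ε` makes the Lyapunov term of the tail bound at most `δ / 2`
  set ε : ℝ := δ / (2 * (L + 1)) with hε'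
  have hε : 0 < ε := by positivity
  have hset : {z | ε * (Real.exp (-c * t) * V z) ≤ 1}.Finite := by
    refine (hfin ((ε * Real.exp (-c * t))⁻¹)).subset fun z hz => ?_
    simp only [Set.mem_ofPred_eq] at hz ⊢
    rw [← mul_assoc] at hz
    rwa [← one_div, le_div_iff₀ (by positivity), mul_comm]
  obtain ⟨q, hq⟩ : ∃ q : ℝ, ∀ z, ε * (Real.exp (-c * t) * V z) ≤ 1 → -A z z ≤ q := by
    obtain ⟨q, hq⟩ := (hset.image fun z => -A z z).bddAbove
    exact ⟨q, fun z hz => hq ⟨z, hz, rfl⟩⟩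
  have hfac : Tendsto (fun N : ℕ => (max q 0 * t) ^ N / N.factorial) atTop (𝓝 0) :=
    FloorSemiring.tendsto_pow_div_factorial_atTop _
  obtain ⟨N, hN⟩ := (hfac.eventually (gt_mem_nhds (show (0:ℝ) < δ / 2 by positivity))).exists
  have htail := h.jumpTail_le hA hε (le_max_right q 0)
    (fun z hz => (hq z hz).trans (le_max_left _ _)) N ht le_rfl x
  rw [← ENNReal.ofReal_mul hε.le, ← ENNReal.ofReal_add (mul_nonneg hε.le hLn) (by positivity)]
    at htail
  have hδ2 : ε * L + (max q 0 * t) ^ N / N.factorial ≤ δ := by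
    have : ε * L ≤ δ / 2 := by
      rw [hε', div_mul_eq_mul_div, div_le_div_iff₀ (by positivity) (by positivity)]
      nlinarith [show (0:ℝ) < δ from hδ]
    linarith
  refine (hA.iterAct_one_add N ht x).ge.trans ?_
  gcongr
  · exact le_iSup (fun N => iterAct A (fun _ => 1) N t x) N
  · refine htail.trans ((ENNReal.ofReal_le_ofReal hδ2).trans ?_)
    simp

/-- States that communicate through positive rates do so in every positive time. -/
lemma transition_pos {A : S → S → ℝ} {x y : S}
    (hpath : Relation.ReflTransGen (fun a b => a ≠ b ∧ 0 < A a b) x y) {t : ℝ} (ht : 0 < t) :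
    0 < transition A t x y := by
  induction hpath using Relation.ReflTransGen.head_induction_on generalizing t with
  | refl =>
    rw [transition_eq]
    simp only [if_true]
    exact lt_of_lt_of_le (ENNReal.ofReal_pos.2 (Real.exp_pos _)) le_self_add
  | @head a b hab _ ih =>
    rw [transition_eq]
    refine lt_of_lt_of_le ?_ le_add_self
    have hm := measurable_jumpInt_slice A (fun z => measurable_transition A z y) t a
    rw [jumpInt, setLIntegral_pos_iff hm]
    have hsub : Set.Ico 0 t ⊆ (Function.support (fun s : ℝ => ∑' z : S, if z = a then 0
        else ENNReal.ofReal (Real.exp (A a a * s)) * ENNReal.ofReal (A a z) *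
          transition A (t - s) z y) ∩ Set.Icc 0 t) := by
      intro s hs
      refine ⟨?_, Set.Ico_subset_Icc_self hs⟩
      rw [Function.mem_support]
      refine ne_of_gt (lt_of_lt_of_le ?_ (ENNReal.le_tsum b))
      rw [if_neg hab.1.symm]
      have := ih (t := t - s) (by linarith [hs.2])
      have h1 : 0 < ENNReal.ofReal (Real.exp (A a a * s)) := ENNReal.ofReal_pos.2 (Real.exp_pos _)
      have h2 : 0 < ENNReal.ofReal (A a b) := ENNReal.ofReal_pos.2 hab.2
      positivity
    refine lt_of_lt_of_le ?_ (measure_mono hsub)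
    simp [ht]

end Chain

/-! ### Harris' theorem with a single recurrent state -/

section Harris

variable {S : Type*}

/-- A conservative transition function: stochastic matrices `p t`, `t ≥ 0`, obeying the
Chapman-Kolmogorov equation. -/
structure IsMarkovFamily (p : ℝ → S → S → ℝ) : Prop where
  nonneg : ∀ t, 0 ≤ t → ∀ x y, 0 ≤ p t x y
  sum : ∀ t, 0 ≤ t → ∀ x, HasSum (p t x) 1
  ck : ∀ t s, 0 ≤ t → 0 ≤ s → ∀ x y, HasSum (fun z => p t x z * p s z y) (p (t + s) x y)

/-- A function whose oscillation is dominated by `w x + w y` is dominated by `w` after subtracting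
a constant. -/
lemma exists_abs_sub_le [Nonempty S] {ψ w : S → ℝ} (h : ∀ x y, |ψ x - ψ y| ≤ w x + w y) :
    ∃ a, ∀ x, |ψ x - a| ≤ w x := by
  have hle : ∀ x y, ψ x - w x ≤ ψ y + w y := fun x y => by linarith [le_abs_self (ψ x - ψ y), h x y]
  have hb : BddAbove (Set.range fun x => ψ x - w x) := by
    obtain ⟨y⟩ := ‹Nonempty S›
    exact ⟨ψ y + w y, by rintro _ ⟨x, rfl⟩; exact hle x y⟩
  refine ⟨⨆ x, (ψ x - w x), fun x => abs_le.2 ⟨?_, ?_⟩⟩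
  · have := ciSup_le fun z => hle z x
    linarith
  · have := le_ciSup hb x
    linarith

lemma summable_mul_of_abs_le_one {a φ : S → ℝ} (ha : ∀ z, 0 ≤ a z) (hs : Summable a)
    (hφ : ∀ z, |φ z| ≤ 1) : Summable fun z => a z * φ z := by
  refine Summable.of_norm_bounded hs fun z => ?_
  rw [Real.norm_eq_abs, abs_mul, abs_of_nonneg (ha z)]
  exact mul_le_of_le_one_right (ha z) (hφ z)

/-- One step of a kernel with a drift condition and a common atom on sublevel sets contracts the
weighted oscillation. The two cases are those of large `W x + W y`, where the drift condition
contracts, and of small `W x + W y`, where the common mass `ε` at the atom does. -/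
lemma exists_contraction [Nonempty S] {p : S → S → ℝ} (hp : ∀ x y, 0 ≤ p x y)
    (hsum : ∀ x, HasSum (p x) 1) {W : S → ℝ} (hW : ∀ x, 0 ≤ W x) {γ D : ℝ}
    (hγ1 : γ < 1) (hD : 0 ≤ D) (hWs : ∀ x, Summable fun z => p x z * W z)
    (hdrift : ∀ x, ∑' z, p x z * W z ≤ γ * W x + D)
    (hmin : ∀ R : ℝ, ∃ ε : ℝ, 0 < ε ∧ ∃ y₀, ∀ x, W x ≤ R → ε ≤ p x y₀) :
    ∃ a : ℝ, 1 / 2 ≤ a ∧ a < 1 ∧ ∃ b : ℝ, 0 < b ∧ ∀ L : ℝ, 0 ≤ L → ∀ ψ : S → ℝ,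
      (∀ x, Summable fun z => p x z * ψ z) →
      (∀ x y, |ψ x - ψ y| ≤ L * (1 + b * W x) + L * (1 + b * W y)) →
      ∀ x y, |∑' z, p x z * ψ z - ∑' z, p y z * ψ z| ≤
        a * L * (1 + b * W x) + a * L * (1 + b * W y) := by
  classical
  obtain ⟨ε, hε, y₀, hy₀⟩ := hmin ((4 * D + 4) / (1 - γ))
  set b := ε / (2 * (D + 1)) with hb
  have hb0 : 0 < b := by positivity
  have hbD : b * D ≤ ε / 2 := by
    rw [hb, div_mul_eq_mul_div, div_le_div_iff₀ (by positivity) (by positivity)]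
    nlinarith
  set a := max (max (1 / 2) ((1 + γ) / 2)) (max (1 - b) (1 - ε / 2)) with ha
  have ha1 : a < 1 := by
    refine max_lt (max_lt ?_ ?_) (max_lt ?_ ?_) <;> linarith
  have ha2 : 1 / 2 ≤ a := (le_max_left _ _).trans (le_max_left _ _)
  have ha3 : (1 + γ) / 2 ≤ a := (le_max_right _ _).trans (le_max_left _ _)
  have ha4 : 1 - b ≤ a := (le_max_left _ _).trans (le_max_right _ _)
  have ha5 : 1 - ε / 2 ≤ a := (le_max_right _ _).trans (le_max_right _ _)
  refine ⟨a, ha2, ha1, b, hb0, fun L hL ψ hψs hψ x y => ?_⟩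
  obtain ⟨q, hq⟩ := exists_abs_sub_le hψ
  have hws : ∀ x, HasSum (fun z => p x z * (1 + b * W z)) (1 + b * ∑' z, p x z * W z) := by
    intro x
    refine ((hsum x).add ((hWs x).hasSum.mul_left b)).congr_fun ?_
    intro z; ring
  have hdiff : ∑' z, p x z * ψ z - ∑' z, p y z * ψ z = ∑' z, (p x z - p y z) * (ψ z - q) := by
    have h1 := ((hψs x).hasSum.sub ((hsum x).mul_right q)).sub
      ((hψs y).hasSum.sub ((hsum y).mul_right q))
    rw [show ∑' z, p x z * ψ z - ∑' z, p y z * ψ z = ∑' z, p x z * ψ z - 1 * q -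
      (∑' z, p y z * ψ z - 1 * q) by ring, ← h1.tsum_eq]
    exact tsum_congr fun z => by ring
  -- `e` is the common mass at `y₀`, zero outside the sublevel set
  have hmain : ∀ e : ℝ, 0 ≤ e → e ≤ p x y₀ → e ≤ p y y₀ →
      |∑' z, (p x z - p y z) * (ψ z - q)| ≤
        L * (2 + b * (γ * (W x + W y) + 2 * D) - 2 * e) := by
    intro e he hex hey
    have hs := (((hws x).add (hws y)).sub (hasSum_ite_eq y₀ (2 * e))).mul_left L
    have hbound : ∀ z, ‖(p x z - p y z) * (ψ z - q)‖ ≤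
        L * (p x z * (1 + b * W z) + p y z * (1 + b * W z) - if z = y₀ then 2 * e else 0) := by
      intro z
      rw [Real.norm_eq_abs, abs_mul]
      have hw : 1 ≤ 1 + b * W z := by have := hW z; nlinarith [mul_nonneg hb0.le this]
      have habs : |p x z - p y z| * (1 + b * W z) ≤
          p x z * (1 + b * W z) + p y z * (1 + b * W z) - if z = y₀ then 2 * e else 0 := by
        have hpx := hp x z
        have hpy := hp y z
        split_ifs with hz
        · subst hz
          rcases abs_cases (p x z - p y z) with ⟨h, _⟩ | ⟨h, _⟩ <;> rw [h] <;> nlinarith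
        · rcases abs_cases (p x z - p y z) with ⟨h, _⟩ | ⟨h, _⟩ <;> rw [h] <;> nlinarith
      calc |p x z - p y z| * |ψ z - q| ≤ |p x z - p y z| * (L * (1 + b * W z)) := by
            gcongr; exact hq z
        _ = L * (|p x z - p y z| * (1 + b * W z)) := by ring
        _ ≤ _ := by gcongr
    have := tsum_of_norm_bounded hs hbound
    rw [Real.norm_eq_abs] at this
    refine this.trans (mul_le_mul_of_nonneg_left ?_ hL)
    linarith [mul_le_mul_of_nonneg_left (hdrift x) hb0.le,
      mul_le_mul_of_nonneg_left (hdrift y) hb0.le]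
  rw [hdiff]
  have hWx := hW x
  have hWy := hW y
  have hγ' : 0 < 1 - γ := by linarith
  by_cases hcase : (4 * D + 4) / (1 - γ) ≤ W x + W y
  · refine (hmain 0 le_rfl (hp _ _) (hp _ _)).trans ?_
    rw [div_le_iff₀ hγ'] at hcase
    have h1 : (2 * D + 2) ≤ (a - γ) * (W x + W y) := by nlinarith
    have h2 := mul_le_mul_of_nonneg_left h1 hb0.le
    have h3 : 2 + b * (γ * (W x + W y) + 2 * D) - 2 * 0 ≤ a * (2 + b * (W x + W y)) := by nlinarith
    nlinarith [mul_le_mul_of_nonneg_left h3 hL]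
  · push Not at hcase
    refine (hmain ε hε.le (hy₀ x (by linarith)) (hy₀ y (by linarith))).trans ?_
    have h1 : γ * (b * (W x + W y)) ≤ a * (b * (W x + W y)) := by
      gcongr
      linarith
    have h3 : 2 + b * (γ * (W x + W y) + 2 * D) - 2 * ε ≤ a * (2 + b * (W x + W y)) := by nlinarith
    nlinarith [mul_le_mul_of_nonneg_left h3 hL]

/-- The total variation distance is attained at the sign of the difference. -/
lemma tsum_abs_sub_le {a a' : S → ℝ} (hs : Summable a) (hs' : Summable a') {δ : ℝ}
    (h : ∀ φ : S → ℝ, (∀ z, |φ z| ≤ 1) → |∑' z, a z * φ z - ∑' z, a' z * φ z| ≤ δ) :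
    ∑' z, |a z - a' z| ≤ δ := by
  let φ : S → ℝ := fun z => if 0 ≤ a z - a' z then 1 else -1
  have hφ : ∀ z, |φ z| ≤ 1 := fun z => by simp only [φ]; split_ifs <;> simp
  have key : ∀ {b : S → ℝ}, Summable b → Summable fun z => b z * φ z := by
    intro b hb
    refine Summable.of_norm_bounded hb.norm fun z => ?_
    rw [norm_mul]
    exact mul_le_of_le_one_right (norm_nonneg _) (hφ z)
  have := h φ hφ
  rw [← (key hs).tsum_sub (key hs')] at this
  refine le_trans (le_of_eq (tsum_congr fun z => ?_)) ((le_abs_self _).trans this)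
  rw [← sub_mul]
  simp only [φ]
  split_ifs with hz
  · rw [abs_of_nonneg hz, mul_one]
  · rw [abs_of_neg (not_le.1 hz)]; ring

namespace IsMarkovFamily

variable {p : ℝ → S → S → ℝ} (hp : IsMarkovFamily p)
include hp

lemma abs_tsum_le_one {φ : S → ℝ} (hφ : ∀ z, |φ z| ≤ 1) {t : ℝ} (ht : 0 ≤ t) (x : S) :
    |∑' z, p t x z * φ z| ≤ 1 := by
  have := tsum_of_norm_bounded (hp.sum t ht x) (f := fun z => p t x z * φ z) fun z => by
    rw [Real.norm_eq_abs, abs_mul, abs_of_nonneg (hp.nonneg t ht x z)]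
    exact mul_le_of_le_one_right (hp.nonneg t ht x z) (hφ z)
  simpa using this

lemma summable_mul {φ : S → ℝ} (hφ : ∀ z, |φ z| ≤ 1) {t : ℝ} (ht : 0 ≤ t) (x : S) :
    Summable fun z => p t x z * φ z :=
  summable_mul_of_abs_le_one (hp.nonneg t ht x) (hp.sum t ht x).summable hφ

lemma tsum_add {φ : S → ℝ} (hφ : ∀ z, |φ z| ≤ 1) {t s : ℝ} (ht : 0 ≤ t) (hs : 0 ≤ s) (x : S) :
    ∑' y, p (t + s) x y * φ y = ∑' z, p t x z * ∑' y, p s z y * φ y := by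
  have hprod : Summable fun q : S × S => p t x q.1 * p s q.1 q.2 := by
    rw [summable_prod_of_nonneg fun q => mul_nonneg (hp.nonneg t ht _ _) (hp.nonneg s hs _ _)]
    refine ⟨fun z => Summable.mul_left (p t x z) (hp.sum s hs z).summable, ?_⟩
    simp only [tsum_mul_left, (hp.sum s hs _).tsum_eq, mul_one]
    exact (hp.sum t ht x).summable
  have hprod' : Summable fun q : S × S => p t x q.1 * p s q.1 q.2 * φ q.2 := by
    exact summable_mul_of_abs_le_one
      (fun q => mul_nonneg (hp.nonneg t ht _ _) (hp.nonneg s hs _ _)) hprod fun q => hφ q.2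
  have := Summable.tsum_comm (f := fun z y => p t x z * p s z y * φ y) hprod'
  calc ∑' y, p (t + s) x y * φ y = ∑' y, ∑' z, p t x z * p s z y * φ y := by
        refine tsum_congr fun y => ?_
        rw [tsum_mul_right, (hp.ck t s ht hs x y).tsum_eq]
    _ = ∑' z, ∑' y, p t x z * p s z y * φ y := this
    _ = _ := by
        refine tsum_congr fun z => ?_
        rw [← tsum_mul_left]
        exact tsum_congr fun y => by ring

/-- Harris' theorem: a drift condition together with a common atom on the sublevel sets of the
Lyapunov function implies geometric ergodicity. -/
theorem exists_invariant [Nonempty S] {W : S → ℝ} (hW : ∀ x, 0 ≤ W x) {c D : ℝ} (hc : 0 < c)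
    (hD : 0 ≤ D) (hWs : ∀ t, 0 ≤ t → ∀ x, Summable fun z => p t x z * W z)
    (hdrift : ∀ t, 0 ≤ t → ∀ x, ∑' z, p t x z * W z ≤ Real.exp (-c * t) * W x + D)
    (hmin : ∀ R : ℝ, ∃ ε : ℝ, 0 < ε ∧ ∃ y₀, ∀ x, W x ≤ R → ε ≤ p 1 x y₀) :
    ∃ ϖ : S → ℝ, (∀ y, 0 ≤ ϖ y) ∧ HasSum ϖ 1 ∧
      (∀ t, 0 ≤ t → ∀ y, HasSum (fun x => ϖ x * p t x y) (ϖ y)) ∧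
      ∃ κ : ℝ, 0 < κ ∧ ∃ M : S → ℝ, ∀ t, 0 ≤ t → ∀ x,
        ∑' y, |p t x y - ϖ y| ≤ M x * Real.exp (-κ * t) := by
  obtain ⟨a, ha2, ha1, b, hb, hcon⟩ := exists_contraction (fun x y => hp.nonneg 1 zero_le_one x y)
    (hp.sum 1 zero_le_one) hW
    (Real.exp_lt_one_iff.2 (by linarith)) hD (hWs 1 zero_le_one) (hdrift 1 zero_le_one) hmin
  have ha0 : 0 < a := by linarith
  set w : S → ℝ := fun x => 1 + b * W x with hw
  have hw1 : ∀ x, 1 ≤ w x := fun x => by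
    have := mul_nonneg hb.le (hW x); simp only [hw]; linarith
  -- contraction over `n` unit time steps, then over any time
  have hn : ∀ (n : ℕ) (φ : S → ℝ), (∀ z, |φ z| ≤ 1) → ∀ x y,
      |∑' z, p n x z * φ z - ∑' z, p n y z * φ z| ≤ a ^ n * w x + a ^ n * w y := by
    intro n
    induction n with
    | zero =>
      intro φ hφ x y
      have h1 := hp.abs_tsum_le_one hφ le_rfl x
      have h2 := hp.abs_tsum_le_one hφ le_rfl y
      have := abs_sub (∑' z, p 0 x z * φ z) (∑' z, p 0 y z * φ z)
      simp only [Nat.cast_zero, pow_zero, one_mul]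
      linarith [hw1 x, hw1 y]
    | succ n ih =>
      intro φ hφ x y
      have hb1 : ∀ z, |∑' y, p n z y * φ y| ≤ 1 :=
        fun z => hp.abs_tsum_le_one hφ (Nat.cast_nonneg n) z
      have := hcon (a ^ n) (by positivity) (fun z => ∑' y, p n z y * φ y)
        (fun x => hp.summable_mul hb1 zero_le_one x) (ih φ hφ) x y
      rw [Nat.cast_succ, add_comm (n : ℝ) 1, hp.tsum_add hφ zero_le_one (Nat.cast_nonneg n),
        hp.tsum_add hφ zero_le_one (Nat.cast_nonneg n), pow_succ']
      exact this
  have ht : ∀ t, 0 ≤ t → ∀ (φ : S → ℝ), (∀ z, |φ z| ≤ 1) → ∀ x y,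
      |∑' z, p t x z * φ z - ∑' z, p t y z * φ z| ≤ a ^ ⌊t⌋₊ * (w x + w y) := by
    intro t ht φ hφ x y
    have hfl := Nat.floor_le ht
    have hsub : 0 ≤ t - ⌊t⌋₊ := by linarith
    have hb1 : ∀ z, |∑' y, p (t - ⌊t⌋₊) z y * φ y| ≤ 1 := fun z => hp.abs_tsum_le_one hφ hsub z
    have := hn ⌊t⌋₊ _ hb1 x y
    rw [← hp.tsum_add hφ (Nat.cast_nonneg _) hsub, ← hp.tsum_add hφ (Nat.cast_nonneg _) hsub]
      at this
    rw [mul_add]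
    simpa using this
  -- Cauchy property in the time variable
  set m : S → ℝ := fun x => 1 + b * (W x + D) + w x with hm
  have hcau : ∀ t s, 0 ≤ t → 0 ≤ s → ∀ x,
      ∑' y, |p (s + t) x y - p t x y| ≤ a ^ ⌊t⌋₊ * m x := by
    intro t s ht0 hs0 x
    refine tsum_abs_sub_le (hp.sum _ (by positivity) x).summable (hp.sum t ht0 x).summable ?_
    intro φ hφ
    set ψ : S → ℝ := fun z => ∑' y, p t z y * φ y with hψ
    have hb1 : ∀ z, |ψ z| ≤ 1 := fun z => hp.abs_tsum_le_one hφ ht0 z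
    have h1 : ∑' y, p (s + t) x y * φ y - ψ x = ∑' z, p s x z * (ψ z - ψ x) := by
      rw [hp.tsum_add hφ hs0 ht0]
      have := (hp.summable_mul hb1 hs0 x).hasSum.sub ((hp.sum s hs0 x).mul_right (ψ x))
      rw [one_mul] at this
      rw [← this.tsum_eq]
      exact tsum_congr fun z => by ring
    have hsum : HasSum (fun z => a ^ ⌊t⌋₊ * (p s x z * (w z + w x)))
        (a ^ ⌊t⌋₊ * (1 + b * ∑' z, p s x z * W z + w x)) := by
      refine HasSum.mul_left _ ?_
      have := ((hp.sum s hs0 x).add ((hWs s hs0 x).hasSum.mul_left b)).add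
        ((hp.sum s hs0 x).mul_right (w x))
      rw [one_mul] at this
      refine this.congr_fun fun z => ?_
      simp only [hw]
      ring
    have h2 := tsum_of_norm_bounded hsum (f := fun z => p s x z * (ψ z - ψ x)) fun z => by
      rw [Real.norm_eq_abs, abs_mul, abs_of_nonneg (hp.nonneg s hs0 x z), mul_left_comm]
      exact mul_le_mul_of_nonneg_left (ht t ht0 φ hφ z x) (hp.nonneg s hs0 x z)
    change |∑' y, p (s + t) x y * φ y - ψ x| ≤ _
    rw [h1]
    rw [Real.norm_eq_abs] at h2
    refine h2.trans ?_
    simp only [hm]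
    have h3 : ∑' z, p s x z * W z ≤ W x + D := by
      refine (hdrift s hs0 x).trans ?_
      have : Real.exp (-c * s) ≤ 1 := Real.exp_le_one_iff.2 (by nlinarith)
      have := mul_le_mul_of_nonneg_right this (hW x)
      linarith
    gcongr
  have hsabs : ∀ t s x y, 0 ≤ t → 0 ≤ s → Summable fun z => |p t x z - p s y z| := by
    intro t s x y ht0 hs0
    exact ((hp.sum t ht0 x).summable.sub (hp.sum s hs0 y).summable).abs
  obtain ⟨x₀⟩ := ‹Nonempty S›
  have hpow : Tendsto (fun n : ℕ => a ^ n * m x₀) atTop (𝓝 0) := by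
    simpa using (tendsto_pow_atTop_nhds_zero_of_lt_one ha0.le ha1).mul_const (m x₀)
  have hpt : ∀ t s, 0 ≤ t → 0 ≤ s → ∀ y, |p (s + t) x₀ y - p t x₀ y| ≤ a ^ ⌊t⌋₊ * m x₀ :=
    fun t s ht0 hs0 y => ((hsabs _ _ x₀ x₀ (by positivity) ht0).le_tsum y
      fun _ _ => abs_nonneg _).trans (hcau t s ht0 hs0 x₀)
  have hlim : ∀ y, ∃ l, Tendsto (fun n : ℕ => p n x₀ y) atTop (𝓝 l) := by
    intro y
    refine cauchySeq_tendsto_of_complete (cauchySeq_of_le_tendsto_0' (fun n => a ^ n * m x₀)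
      (fun n k hnk => ?_) hpow)
    have := hpt n (k - n : ℕ) (Nat.cast_nonneg _) (Nat.cast_nonneg _) y
    rw [← Nat.cast_add, Nat.sub_add_cancel hnk, Nat.floor_natCast, abs_sub_comm] at this
    exact this
  choose ϖ hϖ using hlim
  have hϖt : ∀ t, 0 ≤ t → ∀ y, Tendsto (fun n : ℕ => p (n + t) x₀ y) atTop (𝓝 (ϖ y)) := by
    intro t ht0 y
    have h1 : Tendsto (fun n : ℕ => p (n + t) x₀ y - p n x₀ y) atTop (𝓝 0) := by
      refine squeeze_zero_norm (fun n => ?_) hpow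
      have := hpt n t (Nat.cast_nonneg _) ht0 y
      rw [Nat.floor_natCast, add_comm] at this
      exact this
    simpa using h1.add (hϖ y)
  have hϖ0 : ∀ y, 0 ≤ ϖ y := fun y =>
    ge_of_tendsto' (hϖ y) fun n => hp.nonneg n (Nat.cast_nonneg n) x₀ y
  have hconv : ∀ t, 0 ≤ t → Summable (fun y => |p t x₀ y - ϖ y|) ∧
      ∑' y, |p t x₀ y - ϖ y| ≤ a ^ ⌊t⌋₊ * m x₀ := by
    intro t ht0
    have hF : ∀ F : Finset S, ∑ y ∈ F, |p t x₀ y - ϖ y| ≤ a ^ ⌊t⌋₊ * m x₀ := by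
      intro F
      have h1 : Tendsto (fun n : ℕ => ∑ y ∈ F, |p t x₀ y - p (n + t) x₀ y|) atTop
          (𝓝 (∑ y ∈ F, |p t x₀ y - ϖ y|)) :=
        tendsto_finsetSum _ fun y _ => (tendsto_const_nhds.sub (hϖt t ht0 y)).abs
      refine le_of_tendsto' h1 fun n => ?_
      refine le_trans ?_ (hcau t n ht0 (Nat.cast_nonneg n) x₀)
      simp only [abs_sub_comm (p t x₀ _)]
      exact (hsabs _ _ x₀ x₀ (by positivity) ht0).sum_le_tsum _ fun _ _ => abs_nonneg _
    have hs := summable_of_sum_le (fun y => abs_nonneg _) hF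
    exact ⟨hs, hs.tsum_le_of_sum_le hF⟩
  have hϖs : Summable ϖ := by
    have := (hp.sum 0 le_rfl x₀).summable.sub (hconv 0 le_rfl).1.of_abs
    refine this.congr fun y => ?_
    ring
  have hϖ1 : ∑' y, ϖ y = 1 := by
    have h1 : Tendsto (fun _ : ℕ => 1 - ∑' y, ϖ y) atTop (𝓝 0) := by
      refine squeeze_zero_norm (fun n => ?_) hpow
      have hn0 : (0 : ℝ) ≤ n := Nat.cast_nonneg n
      rw [← (hp.sum n hn0 x₀).tsum_eq, ← (hp.sum n hn0 x₀).summable.tsum_sub hϖs]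
      have := (hconv n hn0).2
      rw [Nat.floor_natCast] at this
      exact (tsum_of_norm_bounded (hconv n hn0).1.hasSum fun y => le_rfl).trans this
    linarith [tendsto_nhds_unique h1 tendsto_const_nhds]
  refine ⟨ϖ, hϖ0, hϖ1 ▸ hϖs.hasSum, fun t ht0 y => ?_, -Real.log a,
    neg_pos.2 (Real.log_neg ha0 ha1), fun x => a⁻¹ * (w x + w x₀ + m x₀), fun t ht0 x => ?_⟩
  · have hple : ∀ x, |p t x y| ≤ 1 := fun x => by
      rw [abs_of_nonneg (hp.nonneg t ht0 x y)]
      exact le_hasSum (hp.sum t ht0 x) y fun z _ => hp.nonneg t ht0 x z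
    have hsϖ := summable_mul_of_abs_le_one hϖ0 hϖs hple
    have h1 : Tendsto (fun n : ℕ => p (n + t) x₀ y - ∑' x, ϖ x * p t x y) atTop (𝓝 0) := by
      refine squeeze_zero_norm (fun n => ?_) hpow
      have hn0 : (0 : ℝ) ≤ n := Nat.cast_nonneg n
      have hck := hp.ck n t hn0 ht0 x₀ y
      rw [← hck.tsum_eq, ← hck.summable.tsum_sub hsϖ]
      have h2 := (hconv n hn0).2
      rw [Nat.floor_natCast] at h2
      refine (tsum_of_norm_bounded (hconv n hn0).1.hasSum fun x => ?_).trans h2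
      rw [← sub_mul, norm_mul, Real.norm_eq_abs, Real.norm_eq_abs]
      exact mul_le_of_le_one_right (abs_nonneg _) (hple x)
    have h2 := tendsto_nhds_unique h1 ((hϖt t ht0 y).sub_const _)
    rw [show ϖ y = ∑' x, ϖ x * p t x y by linarith]
    exact hsϖ.hasSum
  · have h1 : ∑' y, |p t x y - p t x₀ y| ≤ a ^ ⌊t⌋₊ * (w x + w x₀) :=
      tsum_abs_sub_le (hp.sum t ht0 x).summable (hp.sum t ht0 x₀).summable fun φ hφ =>
        ht t ht0 φ hφ x x₀
    have hs1 := hsabs t t x x₀ ht0 ht0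
    have h2 := hconv t ht0
    have h3 : ∑' y, |p t x y - ϖ y| ≤ ∑' y, (|p t x y - p t x₀ y| + |p t x₀ y - ϖ y|) :=
      Summable.tsum_le_tsum (fun y => abs_sub_le _ _ _)
        ((hp.sum t ht0 x).summable.sub hϖs).abs (hs1.add h2.1)
    rw [hs1.tsum_add h2.1] at h3
    have h4 : a ^ ⌊t⌋₊ ≤ a⁻¹ * Real.exp (-(-Real.log a) * t) := by
      rw [neg_neg, ← Real.rpow_def_of_pos ha0, ← Real.rpow_neg_one a, ← Real.rpow_add ha0,
        ← Real.rpow_natCast]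
      refine Real.rpow_le_rpow_of_exponent_ge ha0 ha1.le ?_
      linarith [Nat.lt_floor_add_one t]
    have h5 : 0 ≤ w x + w x₀ + m x₀ := by
      have := mul_nonneg hb.le (add_nonneg (hW x₀) hD)
      simp only [hm]
      linarith [hw1 x, hw1 x₀]
    nlinarith [mul_le_mul_of_nonneg_right h4 h5]

end IsMarkovFamily

end Harris

/-! ### Consequences of a Foster-Lyapunov condition for a chain -/

section Consequences

variable {S : Type*} [DecidableEq S] [Countable S]

/-- The minimal transition function of a rate matrix with a Lyapunov function is conservative. -/
lemma HasDrift.isMarkovFamily {A : S → S → ℝ} {V : S → ℝ} {c C : ℝ} (h : HasDrift A V c C)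
    (hA : IsConservative A) (hfin : ∀ R : ℝ, {x | V x ≤ R}.Finite) :
    IsMarkovFamily fun t x y => (transition A t x y).toReal := by
  have hsum := fun t (ht : 0 ≤ t) x => h.tsum_transition hA hfin ht x
  refine ⟨fun t _ x y => ENNReal.toReal_nonneg, fun t ht x => ?_, fun t s ht hs x y => ?_⟩
  · have h1 : ∑' y, transition A t x y ≠ ∞ := by simp [hsum t ht x]
    have := ENNReal.hasSum_toReal h1
    rwa [← ENNReal.tsum_toReal_eq (ENNReal.ne_top_of_tsum_ne_top h1), hsum t ht x,
      ENNReal.toReal_one] at this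
  · have h0 : ∑' y, transition A (t + s) x y ≠ ∞ := by simp [hsum (t + s) (by positivity) x]
    have h2 := ENNReal.ne_top_of_tsum_ne_top h0 y
    rw [transition_add A ht hs x y] at h2
    have := ENNReal.hasSum_toReal h2
    rw [← ENNReal.tsum_toReal_eq (ENNReal.ne_top_of_tsum_ne_top h2),
      ← transition_add A ht hs x y] at this
    simpa [ENNReal.toReal_mul] using this

lemma ofReal_abs_sub {a b : ℝ≥0∞} (ha : a ≠ ∞) (hb : b ≠ ∞) :
    (a - b) + (b - a) = ENNReal.ofReal |a.toReal - b.toReal| := by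
  rcases le_total a b with hab | hab
  · rw [tsub_eq_zero_of_le hab, zero_add, abs_sub_comm, ← ENNReal.toReal_sub_of_le hab hb,
      abs_of_nonneg ENNReal.toReal_nonneg, ENNReal.ofReal_toReal (ENNReal.sub_ne_top hb)]
  · rw [tsub_eq_zero_of_le hab, add_zero, ← ENNReal.toReal_sub_of_le hab ha,
      abs_of_nonneg ENNReal.toReal_nonneg, ENNReal.ofReal_toReal (ENNReal.sub_ne_top ha)]

/-- A chain with a Lyapunov function with finite sublevel sets and with a state that is accessible
from everywhere is geometrically ergodic. -/
theorem HasDrift.geometricallyErgodic {A : S → S → ℝ} {V : S → ℝ} {c C : ℝ} (h : HasDrift A V c C)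
    (hA : IsConservative A) (hfin : ∀ R : ℝ, {x | V x ≤ R}.Finite) (y₀ : S)
    (hpath : ∀ x, Relation.ReflTransGen (fun a b => a ≠ b ∧ 0 < A a b) x y₀) :
    GeometricallyErgodic A := by
  have hp := h.isMarkovFamily hA hfin
  have hsum := fun t (ht : 0 ≤ t) x => h.tsum_transition hA hfin ht x
  have hne : ∀ t, 0 ≤ t → ∀ x y, transition A t x y ≠ ∞ := fun t ht x =>
    ENNReal.ne_top_of_tsum_ne_top (by simp [hsum t ht x])
  have hc := h.c_pos
  have hD : 0 ≤ C / c := div_nonneg h.C_nonneg hc.le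
  have hact : ∀ t, 0 ≤ t → ∀ x, ∑' y, transition A t x y * ENNReal.ofReal (V y) ≤
      ENNReal.ofReal (driftBound c C t (V x)) := fun t ht x => h.transAct_le hA ht x
  have hreal : ∀ t x y, (transition A t x y * ENNReal.ofReal (V y)).toReal =
      (transition A t x y).toReal * V y := fun t x y => by
    rw [ENNReal.toReal_mul, ENNReal.toReal_ofReal (zero_le_one.trans (h.one_le y))]
  have hneV : ∀ t, 0 ≤ t → ∀ x, ∑' y, transition A t x y * ENNReal.ofReal (V y) ≠ ∞ :=
    fun t ht x => ne_top_of_le_ne_top ENNReal.ofReal_ne_top (hact t ht x)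
  have : Nonempty S := ⟨y₀⟩
  obtain ⟨ϖ, hϖ0, hϖ1, hinv, κ, hκ, M, hM⟩ := hp.exists_invariant (W := V) (c := c) (D := C / c)
    (fun x => zero_le_one.trans (h.one_le x)) hc hD
    (fun t ht x => by
      simpa only [hreal] using ENNReal.summable_toReal (hneV t ht x))
    (fun t ht x => by
      have h1 := ENNReal.toReal_mono ENNReal.ofReal_ne_top (hact t ht x)
      rw [ENNReal.tsum_toReal_eq (ENNReal.ne_top_of_tsum_ne_top (hneV t ht x)),
        ENNReal.toReal_ofReal (h.driftBound_nonneg ht x)] at h1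
      simp only [hreal] at h1
      refine h1.trans ?_
      unfold driftBound
      have := mul_nonneg hD (Real.exp_pos (-c * t)).le
      linarith)
    (fun R => by
      by_cases hR : (hfin R).toFinset.Nonempty
      · obtain ⟨x₁, -, hx₁⟩ := (hfin R).toFinset.exists_min_image
          (fun x => (transition A 1 x y₀).toReal) hR
        refine ⟨(transition A 1 x₁ y₀).toReal, ENNReal.toReal_pos
          (transition_pos (hpath x₁) one_pos).ne' (hne 1 zero_le_one _ _), y₀, fun x hx => ?_⟩
        exact hx₁ x (by simpa using hx)
      · refine ⟨1, one_pos, y₀, fun x hx => absurd ⟨x, ?_⟩ hR⟩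
        simpa using hx)
  have hϖE : HasSum (fun y => ENNReal.ofReal (ϖ y)) 1 := by
    have := ENNReal.ofReal_tsum_of_nonneg hϖ0 hϖ1.summable
    rw [hϖ1.tsum_eq, ENNReal.ofReal_one] at this
    rw [this]
    exact ENNReal.summable.hasSum
  refine ⟨⟨fun y => ENNReal.ofReal (ϖ y), hϖE⟩, fun t ht y => ?_, κ, hκ,
    fun x => (M x).toNNReal, fun t ht x => ?_⟩
  · change ∑' x, ENNReal.ofReal (ϖ x) * transition A t x y = ENNReal.ofReal (ϖ y)
    rw [← (hinv t ht y).tsum_eq, ENNReal.ofReal_tsum_of_nonneg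
      (fun x => mul_nonneg (hϖ0 x) ENNReal.toReal_nonneg) (hinv t ht y).summable]
    refine tsum_congr fun x => ?_
    rw [ENNReal.ofReal_mul (hϖ0 x), ENNReal.ofReal_toReal (hne t ht x y)]
  · change ∑' y, ((transition A t x y - ENNReal.ofReal (ϖ y)) +
      (ENNReal.ofReal (ϖ y) - transition A t x y)) ≤ _
    have h1 : ∀ y, ((transition A t x y - ENNReal.ofReal (ϖ y)) +
        (ENNReal.ofReal (ϖ y) - transition A t x y)) =
        ENNReal.ofReal |(transition A t x y).toReal - ϖ y| := fun y => by
      rw [ofReal_abs_sub (hne t ht x y) ENNReal.ofReal_ne_top, ENNReal.toReal_ofReal (hϖ0 y)]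
    rw [tsum_congr h1, ← ENNReal.ofReal_tsum_of_nonneg (fun y => abs_nonneg _)
      ((hp.sum t ht x).summable.sub hϖ1.summable).abs]
    refine (ENNReal.ofReal_le_ofReal (hM t ht x)).trans ?_
    rw [ENNReal.ofReal_mul' (Real.exp_pos _).le]
    rfl

variable [MeasurableSpace S] [MeasurableSingletonClass S]

omit [DecidableEq S] in
lemma lintegral_comp_countable {Ω : Type*} [MeasurableSpace Ω] (P : Measure Ω) {Z : Ω → S}
    (hZ : Measurable Z) (g : S → ℝ≥0∞) :
    ∫⁻ ω, g (Z ω) ∂P = ∑' y, g y * P {ω | Z ω = y} := by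
  rw [← lintegral_map (measurable_of_countable g) hZ, lintegral_countable']
  refine tsum_congr fun y => ?_
  rw [Measure.map_apply hZ (measurableSet_singleton y)]
  rfl

lemma IsChain.lintegral_eq {A : S → S → ℝ} {ν : S → ℝ≥0∞} {Ω : Type*} [MeasurableSpace Ω]
    {P : Measure Ω} {Y : ℝ≥0 → Ω → S} (hY : IsChain A ν P Y) (g : S → ℝ≥0∞) (s : ℝ≥0) :
    ∫⁻ ω, g (Y s ω) ∂P = ∑' x, ν x * transAct A g s x := by
  have hm : ∀ r, Measurable (Y r) := fun r => hY.measurable.comp measurable_prodMk_left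
  have h1 : ∀ y, P {ω | Y s ω = y} = ∑' x, transition A s x y * ν x := by
    intro y
    have := hY.markov 0 s y Set.univ MeasurableSet.univ
    rw [zero_add, Set.univ_inter, setLIntegral_univ,
      lintegral_comp_countable P (hm 0) (fun x => transition A s x y)] at this
    simpa only [hY.initial] using this
  rw [lintegral_comp_countable P (hm s) g]
  simp only [h1, transAct, ← ENNReal.tsum_mul_left]
  rw [ENNReal.tsum_comm]
  exact tsum_congr fun x => tsum_congr fun y => by ring

/-- Under a Foster-Lyapunov condition the long-run average of a function dominated by a multiple of
the Lyapunov function is bounded by the constants of that condition, whatever the initial law. -/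
theorem HasDrift.limsup_average_le {A : S → S → ℝ} {V : S → ℝ} {c C : ℝ} (h : HasDrift A V c C)
    (hA : IsConservative A) {ν : S → ℝ≥0∞} (hν : ∑' x, ν x ≤ 1)
    (hνV : ∑' x, ν x * ENNReal.ofReal (V x) ≠ ∞) {Ω : Type*} [MeasurableSpace Ω]
    {P : Measure Ω} [IsProbabilityMeasure P] {Y : ℝ≥0 → Ω → S} (hY : IsChain A ν P Y)
    (g : S → ℝ≥0∞) (b : ℝ≥0) (hg : ∀ x, g x ≤ b * ENNReal.ofReal (V x)) :
    limsup (fun T : ℝ => (ENNReal.ofReal T)⁻¹ *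
      ∫⁻ ω, (∫⁻ s : ℝ in Set.Icc 0 T, g (Y s.toNNReal ω)) ∂P) atTop ≤
      b * ENNReal.ofReal (C / c) := by
  have hc := h.c_pos
  have hD : 0 ≤ C / c := div_nonneg h.C_nonneg hc.le
  set v := ∑' x, ν x * ENNReal.ofReal (V x) with hv
  have hE : ∀ s : ℝ, 0 ≤ s → ∫⁻ ω, g (Y s.toNNReal ω) ∂P ≤
      b * (ENNReal.ofReal (Real.exp (-c * s)) * v + ENNReal.ofReal (C / c)) := by
    intro s hs
    rw [hY.lintegral_eq, Real.coe_toNNReal s hs]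
    have h1 : ∀ x, transAct A g s x ≤ b * (ENNReal.ofReal (Real.exp (-c * s)) *
        ENNReal.ofReal (V x) + ENNReal.ofReal (C / c)) := by
      intro x
      have h2 : transAct A g s x ≤ b * transAct A (fun y => ENNReal.ofReal (V y)) s x := by
        rw [transAct, transAct, ← ENNReal.tsum_mul_left]
        refine ENNReal.tsum_le_tsum fun y => ?_
        rw [mul_left_comm]
        gcongr
        exact hg y
      refine h2.trans ?_
      gcongr
      refine (h.transAct_le hA hs x).trans ?_
      rw [← ENNReal.ofReal_mul (Real.exp_pos _).le, ← ENNReal.ofReal_add (mul_nonneg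
        (Real.exp_pos _).le (zero_le_one.trans (h.one_le x))) hD]
      refine ENNReal.ofReal_le_ofReal ?_
      unfold driftBound
      have := mul_nonneg hD (Real.exp_pos (-c * s)).le
      linarith
    calc ∑' x, ν x * transAct A g s x
        ≤ ∑' x, (b * (ENNReal.ofReal (Real.exp (-c * s)) * (ν x * ENNReal.ofReal (V x))) +
            b * (ENNReal.ofReal (C / c) * ν x)) := by
          refine ENNReal.tsum_le_tsum fun x => ?_
          refine (mul_le_mul_right (h1 x) (ν x)).trans (le_of_eq ?_)
          ring
      _ = b * (ENNReal.ofReal (Real.exp (-c * s)) * v + ENNReal.ofReal (C / c) * ∑' x, ν x) := by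
          rw [ENNReal.tsum_add, ENNReal.tsum_mul_left, ENNReal.tsum_mul_left,
            ENNReal.tsum_mul_left, ENNReal.tsum_mul_left, mul_add]
      _ ≤ _ := by
          gcongr
          exact mul_le_of_le_one_right' hν
  have hexp : ∀ T : ℝ, 0 ≤ T → ∫⁻ s in Set.Icc 0 T, ENNReal.ofReal (Real.exp (-c * s)) ≤
      ENNReal.ofReal (1 / c) := by
    intro T hT
    have hG : ∀ s, HasDerivAt (fun s => -(Real.exp (-c * s) / c)) (Real.exp (-c * s)) s := by
      intro s
      refine ((((hasDerivAt_id s).const_mul (-c)).exp).div_const c).neg.congr_deriv ?_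
      field_simp
      simp
    have hgc : Continuous fun s => Real.exp (-c * s) := by fun_prop
    rw [← ofReal_integral_eq_lintegral_ofReal (hgc.integrableOn_Icc)
      (Eventually.of_forall fun s => (Real.exp_pos _).le),
      integral_Icc_eq_integral_Ioc, ← intervalIntegral.integral_of_le hT,
      intervalIntegral.integral_eq_sub_of_hasDerivAt (fun s _ => hG s)
        (hgc.intervalIntegrable _ _)]
    refine ENNReal.ofReal_le_ofReal ?_
    have : 0 ≤ Real.exp (-c * T) / c := by positivity
    simp only [mul_zero, Real.exp_zero]
    linarith
  have hbound : ∀ T : ℝ, 0 < T → (ENNReal.ofReal T)⁻¹ *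
      ∫⁻ ω, (∫⁻ s : ℝ in Set.Icc 0 T, g (Y s.toNNReal ω)) ∂P ≤
      (ENNReal.ofReal T)⁻¹ * (b * (ENNReal.ofReal (1 / c) * v)) + b * ENNReal.ofReal (C / c) := by
    intro T hT
    have hmeas : Measurable (Function.uncurry fun (ω : Ω) (s : ℝ) => g (Y s.toNNReal ω)) := by
      refine (measurable_of_countable g).comp ?_
      exact hY.measurable.comp ((measurable_real_toNNReal.comp measurable_snd).prodMk measurable_fst)
    rw [lintegral_lintegral_swap hmeas.aemeasurable]
    have h1 : ∫⁻ s in Set.Icc 0 T, ∫⁻ ω, g (Y s.toNNReal ω) ∂P ≤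
        b * (ENNReal.ofReal (1 / c) * v) + ENNReal.ofReal T * (b * ENNReal.ofReal (C / c)) := by
      calc _ ≤ ∫⁻ s in Set.Icc 0 T,
            (b * (ENNReal.ofReal (Real.exp (-c * s)) * v) + b * ENNReal.ofReal (C / c)) := by
            refine setLIntegral_mono' measurableSet_Icc fun s hs => ?_
            rw [← mul_add]
            exact hE s hs.1
        _ = b * ((∫⁻ s in Set.Icc 0 T, ENNReal.ofReal (Real.exp (-c * s))) * v) +
            ENNReal.ofReal T * (b * ENNReal.ofReal (C / c)) := by
            rw [lintegral_add_right _ measurable_const, lintegral_const_mul _ (by fun_prop),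
              lintegral_mul_const _ (by fun_prop), setLIntegral_const, Real.volume_Icc, sub_zero,
              mul_comm (ENNReal.ofReal T)]
        _ ≤ _ := by
            gcongr
            exact hexp T hT.le
    refine (mul_le_mul_right h1 _).trans (le_of_eq ?_)
    rw [mul_add, ← mul_assoc _ (ENNReal.ofReal T), ENNReal.inv_mul_cancel
      (ENNReal.ofReal_pos.2 hT).ne' ENNReal.ofReal_ne_top, one_mul]
  have hK : (b : ℝ≥0∞) * (ENNReal.ofReal (1 / c) * v) ≠ ∞ :=
    ENNReal.mul_ne_top ENNReal.coe_ne_top (ENNReal.mul_ne_top ENNReal.ofReal_ne_top hνV)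
  have hlim : Tendsto (fun T : ℝ => (ENNReal.ofReal T)⁻¹ * (b * (ENNReal.ofReal (1 / c) * v)) +
      b * ENNReal.ofReal (C / c)) atTop (𝓝 (b * ENNReal.ofReal (C / c))) := by
    have h1 : Tendsto (fun T : ℝ => (ENNReal.ofReal T)⁻¹) atTop (𝓝 0) := by
      rw [← ENNReal.inv_top]
      exact tendsto_inv_iff.2 ENNReal.tendsto_ofReal_atTop
    have h2 := (ENNReal.Tendsto.mul_const h1 (Or.inr hK)).add_const (b * ENNReal.ofReal (C / c))
    simpa using h2
  rw [← hlim.limsup_eq]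
  exact limsup_le_limsup ((eventually_gt_atTop 0).mono fun T hT => hbound T hT)

end Consequences

/-! ### Rate matrices with finitely many transitions per state -/

section JumpRate

variable {S ι : Type*} [DecidableEq S] [Fintype ι]

/-- `A` is the rate matrix of the chain that jumps from `x` to `T x j` at rate `r x j`, for every
`j : ι`. Different labels `j` may lead to the same state, also to `x` itself. -/
structure IsJumpRate (A : S → S → ℝ) (r : S → ι → ℝ) (T : S → ι → S) : Prop where
  nonneg : ∀ x j, 0 ≤ r x j
  eq : ∀ x z, A x z = ∑ j, r x j * ((if T x j = z then 1 else 0) - if x = z then 1 else 0)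

namespace IsJumpRate

variable {A : S → S → ℝ} {r : S → ι → ℝ} {T : S → ι → S} (hA : IsJumpRate A r T)
include hA

lemma diag_eq (x : S) : -A x x = ∑ j, if T x j = x then 0 else r x j := by
  rw [hA.eq, ← Finset.sum_neg_distrib]
  refine Finset.sum_congr rfl fun j _ => ?_
  split_ifs <;> simp_all

lemma sum_add_diag (V : S → ℝ) (x : S) :
    ∑ j, r x j * (V (T x j) - V x) + -A x x * V x =
      ∑ j, if T x j = x then 0 else r x j * V (T x j) := by
  rw [hA.diag_eq, Finset.sum_mul, ← Finset.sum_add_distrib]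
  refine Finset.sum_congr rfl fun j _ => ?_
  split_ifs with h
  · simp [h]
  · ring

lemma tsum_eq {V : S → ℝ} (hV : ∀ z, 0 ≤ V z) (x : S) :
    ∑' z, (if z = x then 0 else ENNReal.ofReal (A x z) * ENNReal.ofReal (V z)) =
      ENNReal.ofReal (∑ j, r x j * (V (T x j) - V x) + -A x x * V x) := by
  have h2 : ∀ j, 0 ≤ if T x j = x then 0 else r x j * V (T x j) := fun j => by
    split_ifs
    · exact le_rfl
    · exact mul_nonneg (hA.nonneg x j) (hV _)
  rw [hA.sum_add_diag, ENNReal.ofReal_sum_of_nonneg fun j _ => h2 j]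
  have h3 : ∀ z, (if z = x then 0 else ENNReal.ofReal (A x z) * ENNReal.ofReal (V z)) =
      ∑ j, if z = x then 0 else if T x j = z then ENNReal.ofReal (r x j * V z) else 0 := by
    intro z
    split_ifs with hz
    · simp
    · rw [hA.eq, ← ENNReal.ofReal_mul' (hV z), Finset.sum_mul, ENNReal.ofReal_sum_of_nonneg]
      · refine Finset.sum_congr rfl fun j _ => ?_
        rw [if_neg (Ne.symm hz)]
        split_ifs <;> simp
      · intro j _
        rw [if_neg (Ne.symm hz)]
        have := mul_nonneg (hA.nonneg x j) (hV z)
        split_ifs <;> simp [this]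
  rw [tsum_congr h3, Summable.tsum_finsetSum fun _ _ => ENNReal.summable]
  refine Finset.sum_congr rfl fun j _ => ?_
  rw [tsum_eq_single (T x j)]
  · rw [if_pos rfl]
    split_ifs <;> simp
  · intro z hz
    simp [Ne.symm hz]

lemma isConservative : IsConservative A := by
  refine ⟨fun x => ?_, fun x => ?_⟩
  · have := hA.diag_eq x
    have h2 : 0 ≤ ∑ j, if T x j = x then 0 else r x j := Finset.sum_nonneg fun j _ => by
      split_ifs
      · exact le_rfl
      · exact hA.nonneg x j
    linarith
  · simpa using hA.tsum_eq (V := fun _ => 1) (fun _ => zero_le_one) x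

lemma hasDrift {V : S → ℝ} {c C : ℝ} (hc : 0 < c) (hC : 0 ≤ C) (hV : ∀ x, 1 ≤ V x)
    (h : ∀ x, ∑ j, r x j * (V (T x j) - V x) ≤ C - c * V x) : HasDrift A V c C := by
  have hV0 : ∀ x, 0 ≤ V x := fun x => zero_le_one.trans (hV x)
  have hle : ∀ x, ∑ j, r x j * (V (T x j) - V x) + -A x x * V x ≤ (-A x x - c) * V x + C :=
    fun x => by linarith [h x]
  refine ⟨hc, hC, hV, fun x => le_trans ?_ (hle x), fun x => ?_⟩
  · rw [hA.sum_add_diag]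
    refine Finset.sum_nonneg fun j _ => ?_
    split_ifs
    · exact le_rfl
    · exact mul_nonneg (hA.nonneg x j) (hV0 _)
  · rw [hA.tsum_eq hV0]
    exact ENNReal.ofReal_le_ofReal (hle x)

lemma pos_of_rate_pos {x z : S} (hxz : x ≠ z) {j : ι} (hj : T x j = z) (hr : 0 < r x j) :
    0 < A x z := by
  rw [hA.eq]
  refine Finset.sum_pos' (fun i _ => ?_) ⟨j, Finset.mem_univ j, ?_⟩
  · have := hA.nonneg x i
    rw [if_neg hxz]
    split_ifs <;> simp [this]
  · rw [if_pos hj, if_neg hxz]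
    simpa using hr

end IsJumpRate

end JumpRate

/-! ### Elementary inequalities -/

section Elementary

/-- Young's inequality in the form used to absorb lower-order terms. -/
lemma mul_pow_le_young {a b ε : ℝ} (ha : 0 ≤ a) (hb : 0 ≤ b) (hε : 0 < ε) (k : ℕ) :
    b * a ^ k ≤ ε * a ^ (k + 1) + b ^ (k + 1) / ε ^ k := by
  rcases le_total b (ε * a) with h | h
  · have h1 : b * a ^ k ≤ (ε * a) * a ^ k := by gcongr
    have h2 : 0 ≤ b ^ (k + 1) / ε ^ k := by positivity
    calc b * a ^ k ≤ (ε * a) * a ^ k := h1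
      _ = ε * a ^ (k + 1) := by ring
      _ ≤ _ := by linarith
  · have h1 : a ≤ b / ε := by rwa [le_div_iff₀ hε, mul_comm]
    have h2 : 0 ≤ ε * a ^ (k + 1) := by positivity
    calc b * a ^ k ≤ b * (b / ε) ^ k := by gcongr
      _ = b ^ (k + 1) / ε ^ k := by rw [div_pow]; ring
      _ ≤ _ := by linarith

lemma add_sum_pow_le {d : ℕ} {a : Fin d → ℝ} (ha : ∀ i, 0 ≤ a i) {b : ℝ} (hb : 0 ≤ b) (k : ℕ) :
    (b + ∑ i, a i) ^ (k + 1) ≤ 2 ^ k * ((d : ℝ) ^ k + 1) * (b ^ (k + 1) + ∑ i, a i ^ (k + 1)) := by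
  have h1 := add_pow_le hb (Finset.sum_nonneg fun i (_ : i ∈ Finset.univ) => ha i) (k + 1)
  rw [Nat.add_sub_cancel] at h1
  have h2 : (∑ i, a i) ^ (k + 1) ≤ (d : ℝ) ^ k * ∑ i, a i ^ (k + 1) := by
    rcases Nat.eq_zero_or_pos d with rfl | hd
    · simp
    · have := pow_sum_div_card_le_sum_pow (s := Finset.univ) (f := a) (n := k) fun i _ => ha i
      rw [Finset.card_univ, Fintype.card_fin, div_le_iff₀ (by positivity)] at this
      linarith
  refine h1.trans ?_
  rw [mul_assoc]
  gcongr
  have h3 : 0 ≤ b ^ (k + 1) := by positivity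
  have h4 : 0 ≤ ∑ i, a i ^ (k + 1) := Finset.sum_nonneg fun i _ => pow_nonneg (ha i) _
  have h5 : (0 : ℝ) ≤ (d : ℝ) ^ k := by positivity
  nlinarith [mul_nonneg h5 h3]

lemma exists_pos_le {ι : Type*} [Finite ι] (a : ι → ℝ) (ha : ∀ i, 0 < a i) :
    ∃ c, 0 < c ∧ ∀ i, c ≤ a i := by
  cases isEmpty_or_nonempty ι
  · exact ⟨1, one_pos, fun i => isEmptyElim i⟩
  · obtain ⟨i, hi⟩ := Finite.exists_min a
    exact ⟨a i, ha i, hi⟩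

lemma exists_abs_le {ι : Type*} [Finite ι] (a : ι → ℝ) : ∃ C, 0 < C ∧ ∀ i, |a i| ≤ C := by
  obtain ⟨C, hC⟩ := (Set.finite_range fun i => |a i|).bddAbove
  exact ⟨max C 1, by positivity, fun i => (hC ⟨i, rfl⟩).trans (le_max_left _ _)⟩

lemma norm_toLp_le_sum {d : ℕ} (y : Fin d → ℝ) : ‖WithLp.toLp 2 y‖ ≤ ∑ i, |y i| := by
  rw [EuclideanSpace.norm_eq]
  have h : ∀ i ∈ Finset.univ, 0 ≤ |y i| := fun i _ => abs_nonneg _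
  refine Real.sqrt_le_iff.2 ⟨Finset.sum_nonneg h, ?_⟩
  simpa using Finset.sum_sq_le_sq_sum_of_nonneg h

lemma norm_toLp_rpow_le {d : ℕ} (y : Fin d → ℝ) {p : ℝ} (hp : 0 ≤ p) {k : ℕ}
    (hk : p ≤ (k + 1 : ℕ)) :
    ‖WithLp.toLp 2 y‖ ^ p ≤ 2 ^ k * ((d : ℝ) ^ k + 1) * (1 + ∑ i, |y i| ^ (k + 1)) := by
  have h0 : 0 ≤ ∑ i, |y i| := Finset.sum_nonneg fun i _ => abs_nonneg _
  calc ‖WithLp.toLp 2 y‖ ^ p ≤ (1 + ∑ i, |y i|) ^ p := by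
        gcongr
        linarith [norm_toLp_le_sum y]
    _ ≤ (1 + ∑ i, |y i|) ^ ((k + 1 : ℕ) : ℝ) :=
        Real.rpow_le_rpow_of_exponent_le (by linarith) hk
    _ = (1 + ∑ i, |y i|) ^ (k + 1) := Real.rpow_natCast _ _
    _ ≤ _ := by
        simpa using add_sum_pow_le (fun i => abs_nonneg (y i)) zero_le_one k

end Elementary

namespace Queue

variable {d K : ℕ} {M : Queue d K}

lemma Standing.nonempty_env (hM : M.Standing) : Nonempty (Fin K) := by
  by_contra h
  rw [not_nonempty_iff] at h
  simpa using hM.π_sum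

lemma Standing.nonempty_class (hM : M.Standing) : Nonempty (Fin d) := by
  by_contra h
  rw [not_nonempty_iff] at h
  simpa using hM.critical

/-! ### The Poisson equation of the environment -/

/-- A harmonic function of the environment is constant, by the maximum principle. -/
lemma Standing.harmonic_const (hM : M.Standing) {φ : Fin K → ℝ}
    (hφ : ∀ k, ∑ k', M.Q k k' * (φ k' - φ k) = 0) (k k' : Fin K) : φ k = φ k' := by
  have := hM.nonempty_env
  obtain ⟨k₀, hk₀⟩ := Finite.exists_max φ
  have hstep : ∀ a b, φ a = φ k₀ → 0 < M.Q a b → φ b = φ k₀ := by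
    intro a b ha hab
    have h1 : ∀ l ∈ Finset.univ, M.Q a l * (φ a - φ l) ≥ 0 := by
      intro l _
      by_cases hl : a = l
      · simp [hl]
      · exact mul_nonneg (hM.Q_nonneg a l hl) (by rw [ha]; linarith [hk₀ l])
    have h2 : ∑ l, M.Q a l * (φ a - φ l) = 0 := by
      rw [← neg_eq_zero, ← hφ a, ← Finset.sum_neg_distrib]
      exact Finset.sum_congr rfl fun l _ => by ring
    have h3 := (Finset.sum_eq_zero_iff_of_nonneg h1).1 h2 b (Finset.mem_univ b)
    rcases mul_eq_zero.1 h3 with h | h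
    · exact absurd h hab.ne'
    · linarith
  have hall : ∀ b, φ b = φ k₀ := fun b => by
    induction hM.Q_irred k₀ b with
    | refl => rfl
    | tail _ hab ih => exact hstep _ _ ih hab
  rw [hall k, hall k']

/-- The range of the generator of the environment consists of all centered functions, by counting
dimensions. -/
theorem Standing.exists_poissonKernel (hM : M.Standing) : ∃ c, M.PoissonKernel c := by
  have := hM.nonempty_env
  let T : (Fin K → ℝ) →ₗ[ℝ] (Fin K → ℝ) :=
    { toFun := fun φ k => ∑ k', M.Q k k' * (φ k' - φ k)
      map_add' := fun φ ψ => by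
        ext k
        simp only [Pi.add_apply, ← Finset.sum_add_distrib]
        exact Finset.sum_congr rfl fun l _ => by ring
      map_smul' := fun a φ => by
        ext k
        simp only [Pi.smul_apply, smul_eq_mul, RingHom.id_apply, Finset.mul_sum]
        exact Finset.sum_congr rfl fun l _ => by ring }
  let p : (Fin K → ℝ) →ₗ[ℝ] ℝ :=
    { toFun := fun h => ∑ k, M.π k * h k
      map_add' := fun φ ψ => by
        simp only [Pi.add_apply, ← Finset.sum_add_distrib, mul_add]
      map_smul' := fun a φ => by
        simp only [Pi.smul_apply, smul_eq_mul, RingHom.id_apply, Finset.mul_sum]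
        exact Finset.sum_congr rfl fun l _ => by ring }
  have hle : LinearMap.range T ≤ LinearMap.ker p := by
    rintro _ ⟨φ, rfl⟩
    rw [LinearMap.mem_ker]
    change ∑ k, M.π k * ∑ k', M.Q k k' * (φ k' - φ k) = 0
    have h1 : ∀ k, M.π k * ∑ k', M.Q k k' * (φ k' - φ k) =
        ∑ k', M.π k * M.Q k k' * φ k' - M.π k * φ k * ∑ k', M.Q k k' := by
      intro k
      rw [Finset.mul_sum, Finset.mul_sum, ← Finset.sum_sub_distrib]
      exact Finset.sum_congr rfl fun l _ => by ring
    simp only [h1, hM.Q_row, mul_zero, sub_zero]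
    rw [Finset.sum_comm]
    simp only [← Finset.sum_mul, hM.π_stat, zero_mul, Finset.sum_const_zero]
  have hker : LinearMap.ker T ≤ Submodule.span ℝ {fun _ => (1 : ℝ)} := by
    intro φ hφ
    obtain ⟨k₀⟩ := hM.nonempty_env
    refine Submodule.mem_span_singleton.2 ⟨φ k₀, ?_⟩
    ext k
    rw [Pi.smul_apply, smul_eq_mul, mul_one]
    exact hM.harmonic_const (fun l => congrFun (LinearMap.mem_ker.1 hφ) l) k₀ k
  have hp : Function.Surjective p := fun a => ⟨fun _ => a, by
    change ∑ k, M.π k * a = a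
    rw [← Finset.sum_mul, hM.π_sum, one_mul]⟩
  have heq : LinearMap.range T = LinearMap.ker p := by
    refine Submodule.eq_of_le_of_finrank_le hle ?_
    have h1 := T.finrank_range_add_finrank_ker
    have h2 := p.finrank_range_add_finrank_ker
    rw [LinearMap.range_eq_top.2 hp, finrank_top, Module.finrank_self] at h2
    have h3 := Submodule.finrank_mono hker
    rw [finrank_span_singleton fun h => one_ne_zero (congrFun h (Classical.arbitrary (Fin K)))] at h3
    omega
  obtain ⟨g, hg⟩ := T.rangeRestrict.exists_rightInverse_of_surjective T.range_rangeRestrict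
  obtain ⟨G, hG⟩ := g.exists_extend
  refine ⟨fun k l => G (Pi.single l 1) k, fun h hh k => ?_⟩
  have hsum : ∀ k, ∑ l, G (Pi.single l 1) k * h l = G h k := by
    intro k
    conv_rhs => rw [pi_eq_sum_univ' h]
    simp only [map_sum, map_smul, Finset.sum_apply, Pi.smul_apply, smul_eq_mul]
    exact Finset.sum_congr rfl fun l _ => by rw [mul_comm]
  simp only [hsum]
  have hmem : h ∈ LinearMap.range T := by rw [heq]; exact hh
  have h1 : G h = g ⟨h, hmem⟩ := by rw [← hG]; rfl
  have h2 : T (g ⟨h, hmem⟩) = h := by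
    have := congrArg Subtype.val (LinearMap.congr_fun hg ⟨h, hmem⟩)
    simpa using this
  rw [← h1] at h2
  exact congrFun h2 k

/-! ### The priority policy -/

lemma priority_le (n : ℕ) (x : Fin d → ℝ) (i : Fin d) : priority n x i ≤ x i := min_le_left _ _

lemma priority_nonneg (n : ℕ) {x : Fin d → ℝ} {i : Fin d} (hx : 0 ≤ x i) : 0 ≤ priority n x i :=
  le_min hx (le_max_right _ _)

lemma abs_priority_le (n : ℕ) (x : Fin d → ℝ) (i : Fin d) : |priority n x i| ≤ |x i| := by
  unfold priority
  have := le_max_right ((n : ℝ) - ∑ j ∈ Finset.Iio i, x j) 0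
  rcases le_total 0 (x i) with h | h
  · rw [abs_of_nonneg h, abs_of_nonneg (le_min h this)]
    exact min_le_left _ _
  · rw [min_eq_left (h.trans this)]

lemma abs_sub_priority_le (n : ℕ) (x : Fin d → ℝ) (i : Fin d) : |x i - priority n x i| ≤ |x i| := by
  unfold priority
  have := le_max_right ((n : ℝ) - ∑ j ∈ Finset.Iio i, x j) 0
  rcases min_cases (x i) (max ((n : ℝ) - ∑ j ∈ Finset.Iio i, x j) 0) with ⟨h, _⟩ | ⟨h, h'⟩ <;>
    rw [h]
  · simp
  · rw [abs_of_nonneg (by linarith), abs_of_nonneg (by linarith)]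
    linarith

lemma abs_priority_sub_le (n : ℕ) (x y : Fin d → ℝ) (i : Fin d) :
    |priority n x i - priority n y i| ≤ ∑ j, |x j - y j| := by
  unfold priority
  refine (abs_min_sub_min_le_max _ _ _ _).trans (max_le ?_ ?_)
  · exact Finset.single_le_sum (f := fun j => |x j - y j|) (fun j _ => abs_nonneg _)
      (Finset.mem_univ i)
  · refine (abs_max_sub_max_le_abs _ _ _).trans ?_
    rw [sub_sub_sub_cancel_left, ← Finset.sum_sub_distrib]
    refine (Finset.abs_sum_le_sum_abs _ _).trans ?_
    simp only [abs_sub_comm (y _)]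
    exact Finset.sum_le_sum_of_subset_of_nonneg (Finset.subset_univ _) fun j _ _ => abs_nonneg _

/-! ### The queue as a chain with finitely many transitions per state -/

/-- Labels of the transitions: an arrival or a departure of some class, or an environment jump. -/
abbrev Label (d K : ℕ) : Type := (Fin d ⊕ Fin d) ⊕ Fin K

/-- The embedding of the state space into the domain of the test functions. -/
def embed (s : (Fin d → ℕ) × Fin K) : (Fin d → ℝ) × Fin K := (fun i => (s.1 i : ℝ), s.2)

lemma embed_injective : Function.Injective (embed : (Fin d → ℕ) × Fin K → _) := by
  rintro ⟨x, k⟩ ⟨y, l⟩ h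
  simp only [embed, Prod.mk.injEq] at h
  refine Prod.ext (funext fun i => ?_) h.2
  exact_mod_cast congrFun h.1 i

/-- The state reached by a transition. Departures use the truncated subtraction of `ℕ`; their rate
vanishes when there is no customer. -/
def target (s : (Fin d → ℕ) × Fin K) : Label d K → (Fin d → ℕ) × Fin K
  | .inl (.inl i) => (s.1 + Pi.single i 1, s.2)
  | .inl (.inr i) => (s.1 - Pi.single i 1, s.2)
  | .inr k => (s.1, k)

variable (M) in
/-- The rate of a transition. -/
noncomputable def labelRate (n : ℕ) (s : (Fin d → ℕ) × Fin K) : Label d K → ℝ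
  | .inl (.inl i) => M.lam n i s.2
  | .inl (.inr i) => M.mu n i s.2 * priority n (embed s).1 i +
      M.gam n i s.2 * ((embed s).1 i - priority n (embed s).1 i)
  | .inr k => if k = s.2 then 0 else (n : ℝ) ^ M.α * M.Q s.2 k

lemma gen_embed (n : ℕ) (f : (Fin d → ℝ) → Fin K → ℝ) (s : (Fin d → ℕ) × Fin K) :
    M.gen n f (embed s).1 (embed s).2 =
      ∑ j, M.labelRate n s j * (Function.uncurry f (embed (target s j)) -
        Function.uncurry f (embed s)) := by
  rw [Fintype.sum_sum_type, Fintype.sum_sum_type, gen, genEnv, birthDeath]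
  congr 1
  · rw [add_assoc]
    congr 1
    · refine Finset.sum_congr rfl fun i _ => ?_
      have : (embed (target s (.inl (.inl i)))).1 = (embed s).1 + Pi.single i 1 := by
        ext j
        simp only [embed, target, Pi.add_apply, Nat.cast_add, Pi.single_apply]
        split_ifs <;> simp
      rw [← this]
      rfl
    · rw [← Finset.sum_add_distrib]
      refine Finset.sum_congr rfl fun i _ => ?_
      rcases Nat.eq_zero_or_pos (s.1 i) with hi | hi
      · have h0 : (embed s).1 i = 0 := by simp [embed, hi]
        have h1 : priority n (embed s).1 i = 0 := le_antisymm ((priority_le n _ i).trans h0.le)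
          (priority_nonneg n h0.ge)
        simp [labelRate, h0, h1]
      · have : (embed (target s (.inl (.inr i)))).1 = (embed s).1 - Pi.single i 1 := by
          ext j
          simp only [embed, target, Pi.sub_apply, Pi.single_apply]
          split_ifs with hj
          · subst hj
            rw [Nat.cast_sub hi]
            simp
          · simp
        rw [← this, ← add_mul]
        rfl
  · refine Finset.sum_congr rfl fun k _ => ?_
    by_cases hk : k = s.2
    · subst hk
      simp [embed, labelRate]
    · simp [embed, labelRate, hk, target, Function.uncurry]

lemma Standing.min_mul_le_departure (hM : M.Standing) {n : ℕ} (hn : 0 < n) :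
    ∃ c, 0 < c ∧ ∀ (x : Fin d → ℝ), (∀ i, 0 ≤ x i) → ∀ i k, c * x i ≤
      M.mu n i k * priority n x i + M.gam n i k * (x i - priority n x i) := by
  obtain ⟨c₁, hc₁, h₁⟩ := exists_pos_le (fun q : Fin d × Fin K => M.mu n q.1 q.2)
    fun q => hM.mu_pos n _ _ hn
  obtain ⟨c₂, hc₂, h₂⟩ := exists_pos_le (fun q : Fin d × Fin K => M.gam n q.1 q.2)
    fun q => hM.gam_pos n _ _ hn
  refine ⟨min c₁ c₂, lt_min hc₁ hc₂, fun x hx i k => ?_⟩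
  have h3 := priority_nonneg n (hx i)
  have h4 := priority_le n x i
  have h5 : min c₁ c₂ ≤ M.mu n i k := (min_le_left _ _).trans (h₁ (i, k))
  have h6 : min c₁ c₂ ≤ M.gam n i k := (min_le_right _ _).trans (h₂ (i, k))
  nlinarith [mul_le_mul_of_nonneg_right h5 h3, mul_le_mul_of_nonneg_right h6 (sub_nonneg.2 h4)]

lemma Standing.isJumpRate (hM : M.Standing) {n : ℕ} (hn : 0 < n) :
    IsJumpRate (M.rate n) (M.labelRate n) target := by
  refine ⟨fun s j => ?_, fun s s' => ?_⟩
  · rcases j with (i | i) | k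
    · exact hM.lam_nonneg n i _ hn
    · obtain ⟨c, hc, h⟩ := hM.min_mul_le_departure hn
      exact le_trans (mul_nonneg hc.le (Nat.cast_nonneg (s.1 i)))
        (h (embed s).1 (fun i => Nat.cast_nonneg _) i s.2)
    · simp only [labelRate]
      split_ifs with hk
      · exact le_rfl
      · exact mul_nonneg (by positivity) (hM.Q_nonneg _ _ (Ne.symm hk))
  · have := gen_embed (M := M) n (fun y l => Set.indicator {embed s'} (fun _ => (1 : ℝ)) (y, l)) s
    rw [show M.rate n s s' = M.gen n (fun y l => Set.indicator {embed s'}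
      (fun _ => (1 : ℝ)) (y, l)) (embed s).1 (embed s).2 from rfl, this]
    refine Finset.sum_congr rfl fun j _ => ?_
    have hind : ∀ u, Function.uncurry (fun y l => Set.indicator {embed s'} (fun _ => (1 : ℝ)) (y, l))
        (embed u) = if u = s' then 1 else 0 := by
      intro u
      simp only [Function.uncurry, Set.indicator_apply, Prod.mk.eta, Set.mem_singleton_iff,
        embed_injective.eq_iff]
    rw [hind, hind]

/-! ### Stability for a fixed number of servers -/

lemma birthDeath_separable (l u g : Fin d → ℝ) (z : (Fin d → ℝ) → Fin d → ℝ)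
    (φ : Fin d → ℝ → ℝ) (x : Fin d → ℝ) :
    birthDeath l u g z (fun y => ∑ i, φ i (y i)) x =
      ∑ i, (l i * (φ i (x i + 1) - φ i (x i)) +
        (u i * z x i + g i * (x i - z x i)) * (φ i (x i - 1) - φ i (x i))) := by
  have h1 : ∀ i, ∑ j, φ j ((x + Pi.single i 1 : Fin d → ℝ) j) - ∑ j, φ j (x j) =
      φ i (x i + 1) - φ i (x i) := by
    intro i
    rw [← Finset.sum_sub_distrib, Finset.sum_eq_single i]
    · simp
    · intro j _ hj; simp [hj]
    · simp
  have h2 : ∀ i, ∑ j, φ j ((x - Pi.single i 1 : Fin d → ℝ) j) - ∑ j, φ j (x j) =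
      φ i (x i - 1) - φ i (x i) := by
    intro i
    rw [← Finset.sum_sub_distrib, Finset.sum_eq_single i]
    · simp
    · intro j _ hj; simp [hj]
    · simp
  simp only [birthDeath, h1, h2, ← Finset.sum_add_distrib]
  exact Finset.sum_congr rfl fun i _ => by ring

/-- The Lyapunov function `∑ (x_i + 1)^m` of a system with fixed `n`. -/
noncomputable def powLyapunov (m : ℕ) (s : (Fin d → ℕ) × Fin K) : ℝ := ∑ i, ((s.1 i : ℝ) + 1) ^ m

/-- For fixed `n`, abandonment alone makes the departure rates grow linearly with the numbers of
customers. -/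
lemma Standing.hasDrift_powLyapunov (hM : M.Standing) {n : ℕ} (hn : 0 < n) (k : ℕ) :
    ∃ c C, HasDrift (M.rate n) (powLyapunov (k + 1)) c C := by
  obtain ⟨c, hc, hdep⟩ := hM.min_mul_le_departure hn
  obtain ⟨Λ, hΛ, hlam⟩ := exists_abs_le fun q : Fin d × Fin K => M.lam n q.1 q.2
  have := hM.nonempty_class
  set b : ℝ := Λ * ((k + 1 : ℕ) * 2 ^ k) + c with hb
  have hb0 : 0 < b := by positivity
  set C : ℝ := b ^ (k + 1) / (c / 2) ^ k with hC
  refine ⟨c / 2, d * C, (hM.isJumpRate hn).hasDrift (by positivity) (by positivity) ?_ ?_⟩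
  · intro s
    obtain ⟨i⟩ := hM.nonempty_class
    refine le_trans ?_ (Finset.single_le_sum (f := fun i => ((s.1 i : ℝ) + 1) ^ (k + 1))
      (fun j _ => by positivity) (Finset.mem_univ i))
    exact one_le_pow₀ (by linarith [Nat.cast_nonneg (α := ℝ) (s.1 i)])
  · intro s
    have h1 := gen_embed (M := M) n (fun y _ => ∑ i, (y i + 1) ^ (k + 1)) s
    refine (le_of_eq h1.symm).trans ?_
    simp only [gen, sub_self, mul_zero, Finset.sum_const_zero, add_zero, genEnv]
    rw [birthDeath_separable _ _ _ _ (fun _ t => (t + 1) ^ (k + 1)), powLyapunov, Finset.mul_sum]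
    have hdC : (d : ℝ) * C = ∑ _i : Fin d, C := by simp
    rw [hdC, ← Finset.sum_sub_distrib]
    refine Finset.sum_le_sum fun i _ => ?_
    set y : ℝ := (s.1 i : ℝ) + 1 with hy
    have hx0 : (0 : ℝ) ≤ s.1 i := Nat.cast_nonneg _
    have hy1 : 1 ≤ y := by linarith
    have hd := hdep (embed s).1 (fun i => Nat.cast_nonneg _) i (embed s).2
    set B := M.mu n i (embed s).2 * priority n (embed s).1 i +
      M.gam n i (embed s).2 * ((embed s).1 i - priority n (embed s).1 i)
    have he : (embed s).1 i = y - 1 := by simp [embed, hy]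
    rw [he] at hd ⊢
    have hup : (y + 1) ^ (k + 1) - y ^ (k + 1) ≤ ((k + 1 : ℕ) * 2 ^ k) * y ^ k := by
      have h2 := (le_abs_self _).trans (abs_pow_sub_pow_le (y + 1) y (k + 1))
      rw [add_sub_cancel_left, abs_one, one_mul, Nat.add_sub_cancel, abs_of_nonneg (by linarith),
        abs_of_nonneg (by linarith), max_eq_left (by linarith)] at h2
      refine h2.trans ?_
      rw [mul_assoc, ← mul_pow]
      gcongr
      linarith
    have hdown : (y - 1) ^ (k + 1) - y ^ (k + 1) ≤ -y ^ k := by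
      have h3 : (y - 1) ^ k ≤ y ^ k := pow_le_pow_left₀ (by linarith) (by linarith) k
      have h4 := mul_le_mul_of_nonneg_right h3 (sub_nonneg.2 hy1)
      rw [pow_succ, pow_succ]
      linarith
    have hyoung := mul_pow_le_young (by linarith : 0 ≤ y) hb0.le (by positivity : 0 < c / 2) k
    have hl : M.lam n i (embed s).2 ≤ Λ := (le_abs_self _).trans (hlam (i, _))
    have hyk : 0 ≤ y ^ k := by positivity
    have hl0 := hM.lam_nonneg n i (embed s).2 hn
    have hB0 : 0 ≤ B := le_trans (mul_nonneg hc.le (by linarith)) hd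
    have e1 : M.lam n i (embed s).2 * ((y + 1) ^ (k + 1) - y ^ (k + 1)) ≤
        Λ * (((k + 1 : ℕ) * 2 ^ k) * y ^ k) := by
      calc _ ≤ M.lam n i (embed s).2 * (((k + 1 : ℕ) * 2 ^ k) * y ^ k) := by gcongr
        _ ≤ _ := by gcongr
    have e2 : B * ((y - 1) ^ (k + 1) - y ^ (k + 1)) ≤ -(c * (y - 1) * y ^ k) := by
      have := mul_le_mul_of_nonneg_left hdown hB0
      have := mul_le_mul_of_nonneg_right hd hyk
      linarith
    have e3 : c * (y - 1) * y ^ k = c * y ^ (k + 1) - c * y ^ k := by ring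
    have e4 : b * y ^ k = Λ * (((k + 1 : ℕ) * 2 ^ k) * y ^ k) + c * y ^ k := by rw [hb]; ring
    simp only [sub_add_cancel]
    linarith

lemma finite_powLyapunov_le (m : ℕ) (R : ℝ) :
    {s : (Fin d → ℕ) × Fin K | powLyapunov (m + 1) s ≤ R}.Finite := by
  refine ((Set.finite_Icc (0 : Fin d → ℕ) fun _ => ⌊R⌋₊).prod Set.finite_univ).subset ?_
  intro s hs
  refine ⟨⟨fun i => Nat.zero_le _, fun i => ?_⟩, Set.mem_univ _⟩
  refine Nat.le_floor (le_trans ?_ hs)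
  refine le_trans ?_ (Finset.single_le_sum (f := fun i => ((s.1 i : ℝ) + 1) ^ (m + 1))
      (fun j _ => by positivity) (Finset.mem_univ i))
  have h1 : (1 : ℝ) ≤ (s.1 i : ℝ) + 1 := by linarith [Nat.cast_nonneg (α := ℝ) (s.1 i)]
  have := le_self_pow₀ h1 (Nat.succ_ne_zero m)
  simp only [Nat.succ_eq_add_one] at this
  linarith

/-- The empty system is accessible from every state: customers leave at positive rates, and the
environment is irreducible. -/
lemma Standing.accessible (hM : M.Standing) {n : ℕ} (hn : 0 < n) (k₀ : Fin K)
    (s : (Fin d → ℕ) × Fin K) :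
    Relation.ReflTransGen (fun a b => a ≠ b ∧ 0 < M.rate n a b) s (0, k₀) := by
  have hA := hM.isJumpRate hn
  have hn' : (0 : ℝ) < n := by exact_mod_cast hn
  have hdiag : ∀ k, M.Q k k ≤ 0 := by
    intro k
    have h1 := hM.Q_row k
    rw [← Finset.add_sum_erase _ _ (Finset.mem_univ k)] at h1
    have h2 : 0 ≤ ∑ k' ∈ Finset.univ.erase k, M.Q k k' := Finset.sum_nonneg fun k' hk' =>
      hM.Q_nonneg _ _ (Finset.ne_of_mem_erase hk').symm
    linarith
  obtain ⟨x, k⟩ := s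
  induction hN : ∑ i, x i using Nat.strong_induction_on generalizing x with
  | _ N ih =>
    by_cases hx : ∃ i, 0 < x i
    · obtain ⟨i, hi⟩ := hx
      have hlt : ∑ j, (x - Pi.single i 1 : Fin d → ℕ) j < N := by
        rw [← hN]
        refine Finset.sum_lt_sum (fun j _ => Nat.sub_le _ _) ⟨i, Finset.mem_univ i, ?_⟩
        simp only [Pi.sub_apply, Pi.single_eq_same]
        omega
      refine Relation.ReflTransGen.head ?_ (ih _ hlt (x - Pi.single i 1) rfl)
      have hne : (x, k) ≠ (x - Pi.single i 1, k) := by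
        intro h
        have := congrFun (congrArg Prod.fst h) i
        simp only [Pi.sub_apply, Pi.single_eq_same] at this
        omega
      refine ⟨hne, hA.pos_of_rate_pos hne (j := .inl (.inr i)) rfl ?_⟩
      obtain ⟨c, hc, h⟩ := hM.min_mul_le_departure hn
      refine lt_of_lt_of_le (mul_pos hc ?_) (h (embed (x, k)).1 (fun i => Nat.cast_nonneg _) i k)
      exact Nat.cast_pos.2 hi
    · have hx0 : x = 0 := by
        ext i
        by_contra h
        exact hx ⟨i, Nat.pos_of_ne_zero h⟩
      subst hx0
      refine Relation.ReflTransGen.lift (fun k => ((0 : Fin d → ℕ), k)) (fun a b hab => ?_)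
        k k₀ (hM.Q_irred k k₀)
      change _ ∧ _
      have hne : a ≠ b := by
        rintro rfl
        exact absurd hab (not_lt.2 (hdiag a))
      have hne' : ((0 : Fin d → ℕ), a) ≠ (0, b) := fun h => hne (congrArg Prod.snd h)
      refine ⟨hne', hA.pos_of_rate_pos hne' (j := .inr b) rfl ?_⟩
      simp only [labelRate, if_neg hne.symm]
      positivity

theorem Standing.geometricallyErgodic (hM : M.Standing) {n : ℕ} (hn : 0 < n) :
    GeometricallyErgodic (M.rate n) := by
  obtain ⟨k₀⟩ := hM.nonempty_env
  obtain ⟨c, C, h⟩ := hM.hasDrift_powLyapunov hn 0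
  exact h.geometricallyErgodic (hM.isJumpRate hn).isConservative (finite_powLyapunov_le 0) (0, k₀)
    (hM.accessible hn k₀)

/-! ### Long-run moments -/

lemma tsum_initialLaw (x₀ : Fin d → ℕ)
    (F : (Fin d → ℕ) × Fin K → ℝ≥0∞) :
    ∑' s, M.initialLaw x₀ s * F s = ∑ k, ENNReal.ofReal (M.π k) * F (x₀, k) := by
  have h1 : ∀ s : (Fin d → ℕ) × Fin K, s ∉ (Finset.univ.image fun k => (x₀, k)) →
      M.initialLaw x₀ s * F s = 0 := by
    intro s hs
    have : s.1 ≠ x₀ := by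
      rintro rfl
      exact hs (Finset.mem_image.2 ⟨s.2, Finset.mem_univ _, rfl⟩)
    simp [initialLaw, this]
  rw [tsum_eq_sum h1, Finset.sum_image fun a _ b _ h => congrArg Prod.snd h]
  exact Finset.sum_congr rfl fun k _ => by simp [initialLaw]

/-- The long-run moments are bounded through any Lyapunov function that dominates them. -/
lemma Standing.longRunMoment_le (hM : M.Standing) {n : ℕ} (hn : 0 < n)
    {V : (Fin d → ℕ) × Fin K → ℝ} {c C : ℝ} (h : HasDrift (M.rate n) V c C) {p : ℝ} (b : ℝ≥0)
    (hb : ∀ s, ‖WithLp.toLp 2 (M.scale n (embed s).1)‖ ^ p ≤ b * V s)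
    {Ω : Type*} [MeasurableSpace Ω] {P : Measure Ω} [IsProbabilityMeasure P]
    {x₀ : Fin d → ℕ} {Y : ℝ≥0 → Ω → (Fin d → ℕ) × Fin K}
    (hY : IsChain (M.rate n) (M.initialLaw x₀) P Y) :
    M.longRunMoment n p P Y ≤ (b * (C / c).toNNReal : ℝ≥0) := by
  have h1 := h.limsup_average_le (hM.isJumpRate hn).isConservative (ν := M.initialLaw x₀) ?_ ?_ hY
    (fun s => ENNReal.ofReal (‖WithLp.toLp 2 (M.scale n (embed s).1)‖ ^ p)) b ?_
  · rw [ENNReal.coe_mul]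
    exact h1
  · have := tsum_initialLaw (M := M) x₀ fun _ => 1
    simp only [mul_one] at this
    rw [this, ← ENNReal.ofReal_sum_of_nonneg fun k _ => hM.π_nonneg k, hM.π_sum]
    simp
  · rw [tsum_initialLaw]
    exact ENNReal.sum_ne_top.2 fun k _ => ENNReal.mul_ne_top ENNReal.ofReal_ne_top
      ENNReal.ofReal_ne_top
  · intro s
    rw [← ENNReal.ofReal_coe_nnreal, ← ENNReal.ofReal_mul b.coe_nonneg]
    exact ENNReal.ofReal_le_ofReal (hb s)

/-- For each fixed `n` the long-run moments are bounded uniformly in the initial state. -/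
lemma Standing.exists_longRunMoment_le (hM : M.Standing) {n : ℕ} (hn : 0 < n) {p : ℝ}
    (hp : 0 ≤ p) :
    ∃ B : ℝ≥0, ∀ (Ω : Type*) [MeasurableSpace Ω] (P : Measure Ω) [IsProbabilityMeasure P]
      (x₀ : Fin d → ℕ) (Y : ℝ≥0 → Ω → (Fin d → ℕ) × Fin K),
      IsChain (M.rate n) (M.initialLaw x₀) P Y → M.longRunMoment n p P Y ≤ B := by
  have := hM.nonempty_class
  set k := ⌈p⌉₊ with hk
  obtain ⟨c, C, h⟩ := hM.hasDrift_powLyapunov hn k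
  obtain ⟨R, hR, hρ⟩ := exists_abs_le M.ρ
  have hn' : (0 : ℝ) < n := by exact_mod_cast hn
  set e : ℝ := (n : ℝ) ^ (-M.β) with he
  have he0 : 0 < e := Real.rpow_pos_of_pos hn' _
  set a : ℝ := e * (1 + R * n) with ha
  have ha0 : 0 < a := by positivity
  set D : ℝ := 2 ^ k * ((d : ℝ) ^ k + 1) * (1 + a ^ (k + 1)) with hD
  have hD0 : 0 ≤ D := by positivity
  refine ⟨D.toNNReal * (C / c).toNNReal, fun Ω _ P _ x₀ Y hY =>
    hM.longRunMoment_le hn h D.toNNReal (fun s => ?_) hY⟩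
  rw [Real.coe_toNNReal D hD0]
  refine (norm_toLp_rpow_le _ hp (k := k) ?_).trans ?_
  · push_cast
    linarith [Nat.le_ceil p]
  rw [hD, mul_assoc (2 ^ k * ((d : ℝ) ^ k + 1))]
  refine mul_le_mul_of_nonneg_left ?_ (by positivity)
  have h1 : 1 ≤ powLyapunov (k + 1) s := h.one_le s
  have h2 : ∑ i, |M.scale n (embed s).1 i| ^ (k + 1) ≤ a ^ (k + 1) * powLyapunov (k + 1) s := by
    rw [powLyapunov, Finset.mul_sum]
    refine Finset.sum_le_sum fun i _ => ?_
    rw [← mul_pow]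
    gcongr
    have hx : (0 : ℝ) ≤ s.1 i := Nat.cast_nonneg _
    rw [scale, abs_mul, ← he, abs_of_pos he0, ha, mul_assoc]
    gcongr
    simp only [embed]
    refine (abs_sub _ _).trans ?_
    rw [abs_of_nonneg hx, abs_mul, abs_of_pos hn']
    have := mul_le_mul_of_nonneg_right (hρ i) hn'.le
    nlinarith [mul_nonneg (mul_nonneg hR.le hn'.le) hx]
  linarith

end Queue

/-! ### Finite differences of powers -/

lemma abs_add_pow_sub_le {t δ s : ℝ} (hδ : |δ| ≤ 1) (hs : |t| + 1 ≤ s) (k : ℕ) :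
    |(t + δ) ^ (k + 1) - t ^ (k + 1)| ≤ (k + 1 : ℕ) * s ^ k := by
  refine (abs_pow_sub_pow_le _ _ _).trans ?_
  rw [add_sub_cancel_left, Nat.add_sub_cancel]
  have h1 : max |t + δ| |t| ≤ s := max_le ((abs_add_le _ _).trans (by linarith)) (by linarith)
  have h2 : 0 ≤ max |t + δ| |t| := le_max_of_le_right (abs_nonneg _)
  calc |δ| * (k + 1 : ℕ) * max |t + δ| |t| ^ k ≤ 1 * (k + 1 : ℕ) * s ^ k := by gcongr
    _ = _ := by ring

/-- The constant of the second-order Taylor bound for powers. -/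
def taylorConst : ℕ → ℝ
  | 0 => 4
  | k + 1 => 2 * taylorConst k + 4 * (k + 2 : ℕ)

lemma taylorConst_nonneg (k : ℕ) : 0 ≤ taylorConst k := by
  induction k with
  | zero => norm_num [taylorConst]
  | succ k ih => rw [taylorConst]; positivity

lemma abs_taylor_pow_le {t δ s : ℝ} (hδ : |δ| ≤ 2) (hs : |t| + 1 ≤ s) (k : ℕ) :
    |(t + δ) ^ (k + 2) - t ^ (k + 2) - (k + 2 : ℕ) * δ * t ^ (k + 1)| ≤ taylorConst k * s ^ k := by
  have hδ2 : |δ ^ 2| ≤ 4 := by rw [abs_pow]; nlinarith [abs_nonneg δ]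
  have hs0 : 0 ≤ s := by linarith [abs_nonneg t]
  induction k with
  | zero =>
    rw [show (t + δ) ^ (0 + 2) - t ^ (0 + 2) - (0 + 2 : ℕ) * δ * t ^ (0 + 1) = δ ^ 2 by
      push_cast; ring]
    simpa [taylorConst] using hδ2
  | succ k ih =>
    have e : (t + δ) ^ (k + 1 + 2) - t ^ (k + 1 + 2) - (k + 1 + 2 : ℕ) * δ * t ^ (k + 1 + 1) =
        (t + δ) * ((t + δ) ^ (k + 2) - t ^ (k + 2) - (k + 2 : ℕ) * δ * t ^ (k + 1)) +
          (k + 2 : ℕ) * δ ^ 2 * t ^ (k + 1) := by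
      push_cast; ring
    rw [e, taylorConst]
    refine (abs_add_le _ _).trans ?_
    rw [abs_mul, abs_mul, abs_mul, abs_of_nonneg (Nat.cast_nonneg (α := ℝ) (k + 2)), abs_pow t]
    have h1 : |t + δ| ≤ 2 * s := (abs_add_le _ _).trans (by linarith [abs_nonneg t])
    have h2 : |t| ^ (k + 1) ≤ s ^ (k + 1) := pow_le_pow_left₀ (abs_nonneg t) (by linarith) _
    have h3 := taylorConst_nonneg k
    calc _ ≤ 2 * s * (taylorConst k * s ^ k) + (k + 2 : ℕ) * 4 * s ^ (k + 1) := by gcongr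
      _ = _ := by ring

/-- Second differences with increments of size at most one. -/
lemma abs_second_diff_pow_le {t a b s : ℝ} (ha : |a| ≤ 1) (hb : |b| ≤ 1) (hs : |t| + 1 ≤ s)
    (k : ℕ) :
    |((t + b + a) ^ (k + 2) - (t + b) ^ (k + 2)) - ((t + a) ^ (k + 2) - t ^ (k + 2))| ≤
      3 * taylorConst k * s ^ k := by
  have hab : |a + b| ≤ 2 := (abs_add_le _ _).trans (by linarith)
  have h1 := abs_taylor_pow_le hab hs k
  have h2 := abs_taylor_pow_le (ha.trans one_le_two) hs k
  have h3 := abs_taylor_pow_le (hb.trans one_le_two) hs k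
  have e : ((t + b + a) ^ (k + 2) - (t + b) ^ (k + 2)) - ((t + a) ^ (k + 2) - t ^ (k + 2)) =
      ((t + (a + b)) ^ (k + 2) - t ^ (k + 2) - (k + 2 : ℕ) * (a + b) * t ^ (k + 1)) -
      ((t + a) ^ (k + 2) - t ^ (k + 2) - (k + 2 : ℕ) * a * t ^ (k + 1)) -
      ((t + b) ^ (k + 2) - t ^ (k + 2) - (k + 2 : ℕ) * b * t ^ (k + 1)) := by
    rw [show t + b + a = t + (a + b) by ring]
    ring
  rw [e]
  refine (abs_sub _ _).trans ((add_le_add_left (abs_sub _ _) _).trans ?_)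
  linarith

namespace Queue

variable {d K : ℕ} {M : Queue d K}

/-! ### Uniform bounds on the rates -/

lemma Standing.abs_avg_le (hM : M.Standing) {a : Fin d → Fin K → ℝ} {i : Fin d} {C : ℝ}
    (h : ∀ k, |a i k| ≤ C) : |M.avg a i| ≤ C := by
  refine (Finset.abs_sum_le_sum_abs _ _).trans ?_
  calc ∑ k, |M.π k * a i k| ≤ ∑ k, M.π k * C := by
        refine Finset.sum_le_sum fun k _ => ?_
        rw [abs_mul, abs_of_nonneg (hM.π_nonneg k)]
        exact mul_le_mul_of_nonneg_left (h k) (hM.π_nonneg k)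
    _ = C := by rw [← Finset.sum_mul, hM.π_sum, one_mul]

lemma Standing.avg_pos (hM : M.Standing) {a : Fin d → Fin K → ℝ} {i : Fin d}
    (h : ∀ k, 0 < a i k) : 0 < M.avg a i := by
  have h0 : ∀ k ∈ Finset.univ, 0 ≤ M.π k * a i k := fun k _ =>
    mul_nonneg (hM.π_nonneg k) (h k).le
  refine lt_of_le_of_ne (Finset.sum_nonneg h0) fun h1 => ?_
  have h2 := (Finset.sum_eq_zero_iff_of_nonneg h0).1 h1.symm
  have h3 : ∑ k, M.π k = 0 := Finset.sum_eq_zero fun k hk =>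
    (mul_eq_zero.1 (h2 k hk)).resolve_right (h k).ne'
  rw [hM.π_sum] at h3
  exact one_ne_zero h3

lemma tendsto_avg {a : ℕ → Fin d → Fin K → ℝ} {b : Fin d → Fin K → ℝ} {i : Fin d}
    (h : ∀ k, Tendsto (fun n => a n i k) atTop (𝓝 (b i k))) :
    Tendsto (fun n => M.avg (a n) i) atTop (𝓝 (M.avg b i)) :=
  tendsto_finsetSum _ fun k _ => (h k).const_mul _

lemma Standing.ρ_pos (hM : M.Standing) (i : Fin d) : 0 < M.ρ i :=
  div_pos (hM.avg_pos (hM.lamLim_pos i)) (hM.avg_pos (hM.muLim_pos i))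

lemma Standing.ρ_le_one (hM : M.Standing) (i : Fin d) : M.ρ i ≤ 1 := by
  rw [← hM.critical]
  exact Finset.single_le_sum (f := M.ρ) (fun j _ => (hM.ρ_pos j).le) (Finset.mem_univ i)

lemma eventually_abs_le {ι : Type*} [Finite ι] {a : ℕ → ι → ℝ} {b : ι → ℝ}
    (h : ∀ i, Tendsto (fun n => a n i) atTop (𝓝 (b i))) :
    ∃ C, 0 < C ∧ ∀ᶠ n in atTop, ∀ i, |a n i| ≤ C := by
  obtain ⟨C, hC, hb⟩ := exists_abs_le b
  refine ⟨C + 1, by positivity, eventually_all.2 fun i => ?_⟩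
  have := (h i).abs.eventually (gt_mem_nhds (show |b i| < C + 1 by linarith [hb i]))
  exact this.mono fun n hn => hn.le

/-- The rates of the `n`-th system are of the order of their limits, with the bound `Λ`. -/
structure RateBounds (M : Queue d K) (Λ : ℝ) (n : ℕ) : Prop where
  n_pos : 0 < n
  lam : ∀ i k, |M.lam n i k| ≤ Λ * n
  mu : ∀ i k, |M.mu n i k| ≤ Λ
  gam : ∀ i k, |M.gam n i k| ≤ Λ

lemma Standing.eventually_rateBounds (hM : M.Standing) :
    ∃ Λ, 0 < Λ ∧ ∀ᶠ n in atTop, RateBounds M Λ n := by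
  obtain ⟨C₁, hC₁, h₁⟩ := eventually_abs_le
    (a := fun n (q : Fin d × Fin K) => (n : ℝ)⁻¹ * M.lam n q.1 q.2) fun q => hM.lam_tendsto q.1 q.2
  obtain ⟨C₂, hC₂, h₂⟩ := eventually_abs_le
    (a := fun n (q : Fin d × Fin K) => M.mu n q.1 q.2) fun q => hM.mu_tendsto q.1 q.2
  obtain ⟨C₃, hC₃, h₃⟩ := eventually_abs_le
    (a := fun n (q : Fin d × Fin K) => M.gam n q.1 q.2) fun q => hM.gam_tendsto q.1 q.2
  refine ⟨C₁ + C₂ + C₃, by positivity, ?_⟩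
  filter_upwards [h₁, h₂, h₃, eventually_gt_atTop 0] with n h₁ h₂ h₃ hn
  have hn' : (0 : ℝ) < n := by exact_mod_cast hn
  refine ⟨hn, fun i k => ?_, fun i k => (h₂ (i, k)).trans (by linarith),
    fun i k => (h₃ (i, k)).trans (by linarith)⟩
  have := h₁ (i, k)
  rw [abs_mul, abs_of_pos (inv_pos.2 hn'), inv_mul_le_iff₀ hn'] at this
  nlinarith [mul_pos hC₂ hn', mul_pos hC₃ hn']

/-- Critical load: the averaged arrival rates match the service capacity of `ρ_i n` servers up to
`n^β`. -/
lemma Standing.eventually_centering (hM : M.Standing) :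
    ∃ C, 0 < C ∧ ∀ᶠ n : ℕ in atTop, ∀ i,
      |M.avg (M.lam n) i - M.avg (M.mu n) i * (M.ρ i * n)| ≤ C * (n : ℝ) ^ M.β := by
  have h : ∀ i, Tendsto (fun n : ℕ => M.avg (fun i k => (n : ℝ) ^ (-M.β) *
      (M.lam n i k - n * M.lamLim i k)) i - M.ρ i * M.avg (fun i k => (n : ℝ) ^ (1 - M.β) *
      (M.mu n i k - M.muLim i k)) i) atTop (𝓝 (M.avg M.lamHat i - M.ρ i * M.avg M.muHat i)) :=
    fun i => (tendsto_avg (hM.lamHat_tendsto i)).sub ((tendsto_avg (hM.muHat_tendsto i)).const_mul _)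
  obtain ⟨C, hC, h'⟩ := eventually_abs_le h
  refine ⟨C, hC, ?_⟩
  filter_upwards [h', eventually_gt_atTop 0] with n hn hn0 i
  have hn' : (0 : ℝ) < n := by exact_mod_cast hn0
  have hb : 0 < (n : ℝ) ^ M.β := Real.rpow_pos_of_pos hn' _
  have h1 := hn i
  have h2 : M.avg (fun i k => (n : ℝ) ^ (-M.β) * (M.lam n i k - n * M.lamLim i k)) i =
      (n : ℝ) ^ (-M.β) * (M.avg (M.lam n) i - n * M.avg M.lamLim i) := by
    simp only [avg, Finset.mul_sum, ← Finset.sum_sub_distrib]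
    exact Finset.sum_congr rfl fun k _ => by ring
  have h3 : M.avg (fun i k => (n : ℝ) ^ (1 - M.β) * (M.mu n i k - M.muLim i k)) i =
      (n : ℝ) ^ (1 - M.β) * (M.avg (M.mu n) i - M.avg M.muLim i) := by
    simp only [avg, Finset.mul_sum, ← Finset.sum_sub_distrib]
    exact Finset.sum_congr rfl fun k _ => by ring
  have hmu := (hM.avg_pos (hM.muLim_pos i)).ne'
  have h4 : M.avg M.lamLim i = M.ρ i * M.avg M.muLim i := by rw [ρ, div_mul_cancel₀ _ hmu]
  rw [h2, h3, h4, show (1 - M.β : ℝ) = 1 + -M.β by ring, Real.rpow_add hn', Real.rpow_one,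
    show (n : ℝ) ^ (-M.β) * (M.avg (M.lam n) i - n * (M.ρ i * M.avg M.muLim i)) -
      M.ρ i * (n * (n : ℝ) ^ (-M.β) * (M.avg (M.mu n) i - M.avg M.muLim i)) =
      (n : ℝ) ^ (-M.β) * (M.avg (M.lam n) i - M.avg (M.mu n) i * (M.ρ i * n)) by ring,
    abs_mul, Real.rpow_neg hn'.le, abs_of_pos (inv_pos.2 hb), inv_mul_le_iff₀ hb] at h1
  linarith

/-! ### Powers of `n` -/

lemma half_le_β : 1 / 2 ≤ M.β := le_max_left _ _

lemma one_le_pow_β {n : ℕ} (hn : 0 < n) : 1 ≤ (n : ℝ) ^ M.β :=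
  Real.one_le_rpow (by exact_mod_cast hn) (by linarith [half_le_β (M := M)])

lemma le_pow_β_sq {n : ℕ} (hn : 0 < n) : (n : ℝ) ≤ (n : ℝ) ^ M.β * (n : ℝ) ^ M.β := by
  have hn' : (0 : ℝ) < n := by exact_mod_cast hn
  rw [← Real.rpow_add hn']
  conv_lhs => rw [← Real.rpow_one (n : ℝ)]
  exact Real.rpow_le_rpow_of_exponent_le (by exact_mod_cast hn)
    (by linarith [half_le_β (M := M)])

/-- The choice of `β`: the speed of the environment makes `n^{2 - α}` at most `n^{2β}`. -/
lemma sq_le_pow_mul {n : ℕ} (hn : 0 < n) :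
    ((n : ℝ) ^ M.α)⁻¹ * ((n : ℝ) * n) ≤ (n : ℝ) ^ M.β * (n : ℝ) ^ M.β := by
  have hn' : (0 : ℝ) < n := by exact_mod_cast hn
  have h1 : 1 - M.α / 2 ≤ M.β := le_max_right _ _
  rw [← Real.rpow_neg hn'.le, ← Real.rpow_add hn']
  nth_rewrite 2 [← Real.rpow_one (n : ℝ)]
  nth_rewrite 3 [← Real.rpow_one (n : ℝ)]
  rw [← Real.rpow_add hn', ← Real.rpow_add hn']
  exact Real.rpow_le_rpow_of_exponent_le (by exact_mod_cast hn) (by linarith)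

lemma Standing.self_le_pow_mul (hM : M.Standing) {n : ℕ} (hn : 0 < n) :
    ((n : ℝ) ^ M.α)⁻¹ * (n : ℝ) ≤ (n : ℝ) ^ M.β := by
  have hn' : (0 : ℝ) < n := by exact_mod_cast hn
  have h1 : 1 - M.α / 2 ≤ M.β := le_max_right _ _
  have h2 := hM.α_pos
  rw [← Real.rpow_neg hn'.le]
  nth_rewrite 2 [← Real.rpow_one (n : ℝ)]
  rw [← Real.rpow_add hn']
  exact Real.rpow_le_rpow_of_exponent_le (by exact_mod_cast hn) (by linarith)

/-! ### Growth of birth-death operators on the uncorrected Lyapunov function -/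

variable (M) in
/-- The magnitude `n^β + ∑ |x_i - n ρ_i|` of a state relative to its fluid limit; all estimates
are expressed through it. -/
noncomputable def size (n : ℕ) (x : Fin d → ℝ) : ℝ := (n : ℝ) ^ M.β + ∑ i, |x i - M.ρ i * n|

variable (M) in
/-- The function `f_n = ∑ ξ_i |x_i - n ρ_i|^m`. -/
noncomputable def shiftedV (m : ℕ) (ξ : Fin d → ℝ) (n : ℕ) (x : Fin d → ℝ) : ℝ :=
  V m ξ fun i => x i - M.ρ i * n

lemma pow_β_le_size (n : ℕ) (x : Fin d → ℝ) : (n : ℝ) ^ M.β ≤ M.size n x :=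
  le_add_of_nonneg_right (Finset.sum_nonneg fun _ _ => abs_nonneg _)

lemma one_le_size {n : ℕ} (hn : 0 < n) (x : Fin d → ℝ) : 1 ≤ M.size n x :=
  (one_le_pow_β hn).trans (pow_β_le_size n x)

lemma abs_add_one_le_size {n : ℕ} (hn : 0 < n) (x : Fin d → ℝ) (i : Fin d) :
    |x i - M.ρ i * n| + 1 ≤ M.size n x := by
  have h1 := one_le_pow_β (M := M) hn
  have h2 := Finset.single_le_sum (f := fun i => |x i - M.ρ i * n|) (fun _ _ => abs_nonneg _)
    (Finset.mem_univ i)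
  unfold size
  linarith

lemma Standing.abs_le_size (hM : M.Standing) {n : ℕ} (hn : 0 < n) (x : Fin d → ℝ) (i : Fin d) :
    |x i| ≤ M.size n x + n := by
  have h1 := abs_add_one_le_size (M := M) hn x i
  have h2 : |M.ρ i * n| ≤ n := by
    rw [abs_of_nonneg (mul_nonneg (hM.ρ_pos i).le (Nat.cast_nonneg n))]
    exact mul_le_of_le_one_left (Nat.cast_nonneg n) (hM.ρ_le_one i)
  have h3 : |x i| ≤ |x i - M.ρ i * n| + |M.ρ i * n| := by
    simpa using abs_add_le (x i - M.ρ i * n) (M.ρ i * n)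
  linarith

/-- Bounds on the coefficients of a birth-death operator. -/
structure CoeffBounds (Λ : ℝ) (n : ℕ) (l u g : Fin d → ℝ) : Prop where
  nonneg : 0 ≤ Λ
  l : ∀ i, |l i| ≤ Λ * n
  u : ∀ i, |u i| ≤ Λ
  g : ∀ i, |g i| ≤ Λ

lemma CoeffBounds.abs_departure_le {Λ : ℝ} {n : ℕ} {l u g : Fin d → ℝ}
    (h : CoeffBounds Λ n l u g) (x : Fin d → ℝ) (i : Fin d) :
    |u i * priority n x i + g i * (x i - priority n x i)| ≤ 2 * Λ * |x i| := by
  refine (abs_add_le _ _).trans ?_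
  rw [abs_mul, abs_mul]
  have h0 := h.nonneg
  have h1 := mul_le_mul (h.u i) (abs_priority_le n x i) (abs_nonneg _) h0
  have h2 := mul_le_mul (h.g i) (abs_sub_priority_le n x i) (abs_nonneg _) h0
  linarith

lemma CoeffBounds.abs_birthDeath_le (hM : M.Standing) {Λ : ℝ} {n : ℕ} (hn : 0 < n)
    {l u g : Fin d → ℝ} (h : CoeffBounds Λ n l u g) {f : (Fin d → ℝ) → ℝ} {x : Fin d → ℝ} {F : ℝ}
    (hF : ∀ i, |f (x + Pi.single i 1) - f x| ≤ F) (hF' : ∀ i, |f (x - Pi.single i 1) - f x| ≤ F) :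
    |birthDeath l u g (priority n) f x| ≤ 3 * d * Λ * (n + M.size n x) * F := by
  have h0 := h.nonneg
  have e : birthDeath l u g (priority n) f x = ∑ i, (l i * (f (x + Pi.single i 1) - f x) +
      (u i * priority n x i + g i * (x i - priority n x i)) * (f (x - Pi.single i 1) - f x)) := by
    simp only [birthDeath, ← Finset.sum_add_distrib]
    exact Finset.sum_congr rfl fun i _ => by ring
  rw [e]
  refine (Finset.abs_sum_le_sum_abs _ _).trans ?_
  have hi : ∀ i ∈ Finset.univ, |l i * (f (x + Pi.single i 1) - f x) +
      (u i * priority n x i + g i * (x i - priority n x i)) * (f (x - Pi.single i 1) - f x)| ≤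
      3 * Λ * (n + M.size n x) * F := by
    intro i _
    have hF0 : 0 ≤ F := (abs_nonneg _).trans (hF i)
    refine (abs_add_le _ _).trans ?_
    rw [abs_mul, abs_mul]
    have h1 := mul_le_mul (h.l i) (hF i) (abs_nonneg _) (by positivity)
    have h2 : 2 * Λ * |x i| ≤ 2 * Λ * (M.size n x + n) := by
      gcongr
      exact hM.abs_le_size hn x i
    have h3 := mul_le_mul ((h.abs_departure_le x i).trans h2) (hF' i) (abs_nonneg _)
      (by have := one_le_size (M := M) hn x; positivity)
    have h4 : 0 ≤ Λ * M.size n x * F := by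
      have := one_le_size (M := M) hn x; positivity
    nlinarith
  refine (Finset.sum_le_sum hi).trans (le_of_eq ?_)
  rw [Finset.sum_const, Finset.card_univ, Fintype.card_fin, nsmul_eq_mul]
  ring

section EvenPower

variable {m k : ℕ} (hm : Even m) (hmk : m = k + 2) {ξ : Fin d → ℝ} {Ξ : ℝ} (hξ : ∀ i, 0 < ξ i)
  (hΞ : ∀ i, ξ i ≤ Ξ)

include hξ in
lemma shiftedV_nonneg (n : ℕ) (x : Fin d → ℝ) : 0 ≤ M.shiftedV m ξ n x := by
  unfold shiftedV V
  exact Finset.sum_nonneg fun i _ => mul_nonneg (hξ i).le (pow_nonneg (abs_nonneg _) _)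

include hm in
lemma birthDeath_shiftedV (l u g : Fin d → ℝ) (z : (Fin d → ℝ) → Fin d → ℝ) (n : ℕ)
    (x : Fin d → ℝ) :
    birthDeath l u g z (M.shiftedV m ξ n) x =
      ∑ i, ξ i * (l i * ((x i - M.ρ i * n + 1) ^ m - (x i - M.ρ i * n) ^ m) +
        (u i * z x i + g i * (x i - z x i)) *
          ((x i - M.ρ i * n + -1) ^ m - (x i - M.ρ i * n) ^ m)) := by
  have := birthDeath_separable l u g z (fun i t => ξ i * |t - M.ρ i * n| ^ m) x
  simp only [hm.pow_abs] at this
  have e : M.shiftedV m ξ n = fun y => ∑ i, ξ i * (y i - M.ρ i * n) ^ m := by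
    funext y
    simp only [shiftedV, V, hm.pow_abs]
  rw [e, this]
  refine Finset.sum_congr rfl fun i _ => ?_
  rw [show x i + 1 - M.ρ i * n = x i - M.ρ i * n + 1 by ring,
    show x i - 1 - M.ρ i * n = x i - M.ρ i * n + -1 by ring]
  ring

include hm hmk hξ hΞ in
lemma abs_shiftedV_sub_le {n : ℕ} (hn : 0 < n) (x : Fin d → ℝ) (i : Fin d) {δ : ℝ}
    (hδ : |δ| ≤ 1) :
    |M.shiftedV m ξ n (x + Pi.single i δ) - M.shiftedV m ξ n x| ≤
      Ξ * (m * M.size n x ^ (k + 1)) := by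
  have e : M.shiftedV m ξ n (x + Pi.single i δ) - M.shiftedV m ξ n x =
      ξ i * ((x i - M.ρ i * n + δ) ^ m - (x i - M.ρ i * n) ^ m) := by
    simp only [shiftedV, V, hm.pow_abs]
    rw [← Finset.sum_sub_distrib, Finset.sum_eq_single i]
    · rw [Pi.add_apply, Pi.single_eq_same, ← mul_sub]
      ring
    · intro j _ hj; simp [hj]
    · simp
  rw [e, abs_mul, abs_of_pos (hξ i)]
  have h1 := abs_add_pow_sub_le hδ (abs_add_one_le_size (M := M) hn x i) (k + 1)
  subst hmk
  exact mul_le_mul (hΞ i) h1 (abs_nonneg _) ((hξ i).le.trans (hΞ i))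

include hm hmk hξ hΞ in
lemma CoeffBounds.abs_birthDeath_shiftedV_le (hM : M.Standing) {Λ : ℝ} {n : ℕ} (hn : 0 < n)
    {l u g : Fin d → ℝ} (h : CoeffBounds Λ n l u g) (x : Fin d → ℝ) :
    |birthDeath l u g (priority n) (M.shiftedV m ξ n) x| ≤
      3 * d * Λ * (n + M.size n x) * (Ξ * (m * M.size n x ^ (k + 1))) := by
  refine h.abs_birthDeath_le hM hn (fun i => ?_) fun i => ?_
  · exact abs_shiftedV_sub_le hm hmk hξ hΞ hn x i (by simp)
  · rw [show x - Pi.single i 1 = x + Pi.single i (-1 : ℝ) by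
      rw [Pi.single_neg, sub_eq_add_neg]]
    exact abs_shiftedV_sub_le hm hmk hξ hΞ hn x i (by simp)

lemma CoeffBounds.abs_departure_sub_le {Λ : ℝ} {n : ℕ} {l u g : Fin d → ℝ}
    (h : CoeffBounds Λ n l u g) {x y : Fin d → ℝ} (hxy : ∑ j, |x j - y j| ≤ 1) (i : Fin d) :
    |(u i * priority n x i + g i * (x i - priority n x i)) -
      (u i * priority n y i + g i * (y i - priority n y i))| ≤ 3 * Λ := by
  have hpri := (abs_priority_sub_le n x y i).trans hxy
  have hi : |x i - y i| ≤ 1 := (Finset.single_le_sum (f := fun j => |x j - y j|)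
    (fun j _ => abs_nonneg _) (Finset.mem_univ i)).trans hxy
  have e : (u i * priority n x i + g i * (x i - priority n x i)) -
      (u i * priority n y i + g i * (y i - priority n y i)) =
      u i * (priority n x i - priority n y i) +
      g i * ((x i - y i) - (priority n x i - priority n y i)) := by ring
  rw [e]
  refine (abs_add_le _ _).trans ?_
  rw [abs_mul, abs_mul]
  have h1 := mul_le_mul (h.u i) hpri (abs_nonneg _) h.nonneg
  have h3 : |(x i - y i) - (priority n x i - priority n y i)| ≤ 2 :=
    (abs_sub _ _).trans (by linarith)
  have h2 := mul_le_mul (h.g i) h3 (abs_nonneg _) h.nonneg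
  linarith

/-- The contribution of one class to the increment of a birth-death operator, with arrival
coefficient `l` and departure coefficients `a` before and `a'` after the increment. -/
lemma abs_class_increment_le {Λ n s l a a' w b : ℝ} (hΛ : 0 ≤ Λ) (hn : 0 ≤ n) (hl : |l| ≤ Λ * n)
    (haa : |a' - a| ≤ 3 * Λ) (ha : |a| ≤ 2 * Λ * (s + n)) (hb : |b| ≤ 1) (hws : |w| + 1 ≤ s)
    (k : ℕ) :
    |(l * ((w + b + 1) ^ (k + 2) - (w + b) ^ (k + 2)) +
        a' * ((w + b + -1) ^ (k + 2) - (w + b) ^ (k + 2))) -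
      (l * ((w + 1) ^ (k + 2) - w ^ (k + 2)) + a * ((w + -1) ^ (k + 2) - w ^ (k + 2)))| ≤
      Λ * (18 * taylorConst k + 3 * (k + 2 : ℕ)) * (n + s) * s ^ k := by
  have hs1 : 1 ≤ s := by linarith [abs_nonneg w]
  have hT := taylorConst_nonneg k
  have hD1 := abs_second_diff_pow_le (a := 1) (by simp) hb hws k
  have hD2 := abs_second_diff_pow_le (a := -1) (by simp) hb hws k
  have hD3 := abs_add_pow_sub_le (δ := -1) (by simp) hws (k + 1)
  rw [pow_succ s, add_assoc k 1 1, one_add_one_eq_two] at hD3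
  generalize (w + b + 1) ^ (k + 2) - (w + b) ^ (k + 2) = A1 at *
  generalize (w + 1) ^ (k + 2) - w ^ (k + 2) = A0 at *
  generalize (w + b + -1) ^ (k + 2) - (w + b) ^ (k + 2) = B1 at *
  generalize (w + -1) ^ (k + 2) - w ^ (k + 2) = B0 at *
  have hQ : 0 ≤ s ^ k := by positivity
  generalize s ^ k = Q at *
  generalize taylorConst k = T at *
  generalize ((k + 2 : ℕ) : ℝ) = m at *
  have hm : 0 ≤ m * (Q * s) := (abs_nonneg _).trans hD3
  have hm' : 0 ≤ m * Q := by
    by_contra h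
    nlinarith
  have e : l * A1 + a' * B1 - (l * A0 + a * B0) =
      l * (A1 - A0) + ((a' - a) * B0 + (a' - a) * (B1 - B0) + a * (B1 - B0)) := by ring
  rw [e]
  have t1 : |l * (A1 - A0)| ≤ Λ * n * (3 * T * Q) := by
    rw [abs_mul]; exact mul_le_mul hl hD1 (abs_nonneg _) (by positivity)
  have t2 : |(a' - a) * B0| ≤ 3 * Λ * (m * (Q * s)) := by
    rw [abs_mul]; exact mul_le_mul haa hD3 (abs_nonneg _) (by positivity)
  have t3 : |(a' - a) * (B1 - B0)| ≤ 3 * Λ * (3 * T * Q) := by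
    rw [abs_mul]; exact mul_le_mul haa hD2 (abs_nonneg _) (by positivity)
  have t4 : |a * (B1 - B0)| ≤ 2 * Λ * (s + n) * (3 * T * Q) := by
    rw [abs_mul]; exact mul_le_mul ha hD2 (abs_nonneg _) (by positivity)
  have t5 : 3 * Λ * (3 * T * Q) ≤ 3 * Λ * (3 * T * Q) * s :=
    le_mul_of_one_le_right (by positivity) hs1
  have t6 : 0 ≤ Λ * T * Q * n := by positivity
  have t7 : 0 ≤ Λ * T * Q * s := by positivity
  have t8 : 0 ≤ Λ * n * (m * Q) := by positivity
  refine (abs_add_le _ _).trans ((add_le_add t1 ((abs_add_le _ _).trans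
    (add_le_add ((abs_add_le _ _).trans (add_le_add t2 t3)) t4))).trans ?_)
  linarith

include hm hmk hξ hΞ in
/-- A birth-death operator gains one power: its increments on the uncorrected Lyapunov function are
one order smaller than its values. -/
lemma CoeffBounds.abs_birthDeath_shiftedV_sub_le (hM : M.Standing) {Λ : ℝ} {n : ℕ} (hn : 0 < n)
    {l u g : Fin d → ℝ} (h : CoeffBounds Λ n l u g) (x : Fin d → ℝ) (j : Fin d) {δ : ℝ}
    (hδ : |δ| ≤ 1) :
    |birthDeath l u g (priority n) (M.shiftedV m ξ n) (x + Pi.single j δ) -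
      birthDeath l u g (priority n) (M.shiftedV m ξ n) x| ≤
      d * (Ξ * (Λ * (18 * taylorConst k + 3 * m))) * (n + M.size n x) * M.size n x ^ k := by
  have h0 := h.nonneg
  obtain ⟨y, hy⟩ : ∃ y, y = x + Pi.single j δ := ⟨_, rfl⟩
  have hyx : ∀ i, y i - x i = if i = j then δ else 0 := fun i => by
    rw [hy, Pi.add_apply, Pi.single_apply, add_sub_cancel_left]
  have hb1 : ∀ i, |y i - x i| ≤ 1 := fun i => by
    rw [hyx]
    split_ifs
    · exact hδ
    · simp
  have hsum : ∑ i, |y i - x i| ≤ 1 := by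
    simp only [hyx]
    rw [Finset.sum_eq_single j]
    · simpa using hδ
    · intro i _ hij; simp [hij]
    · simp
  rw [← hy, birthDeath_shiftedV hm, birthDeath_shiftedV hm, ← Finset.sum_sub_distrib]
  refine (Finset.abs_sum_le_sum_abs _ _).trans ?_
  refine (Finset.sum_le_sum (g := fun _ => Ξ * (Λ * (18 * taylorConst k + 3 * m) *
    (n + M.size n x) * M.size n x ^ k)) fun i _ => ?_).trans (le_of_eq ?_)
  · rw [← mul_sub, abs_mul, abs_of_pos (hξ i),
      show y i - M.ρ i * n = x i - M.ρ i * n + (y i - x i) by ring]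
    subst hmk
    refine mul_le_mul (hΞ i) ?_ (abs_nonneg _) ((hξ i).le.trans (hΞ i))
    refine abs_class_increment_le h0 (Nat.cast_nonneg n) (h.l i) (h.abs_departure_sub_le hsum i)
      ((h.abs_departure_le x i).trans ?_) (hb1 i) (abs_add_one_le_size hn x i) k
    gcongr
    exact hM.abs_le_size hn x i
  · rw [Finset.sum_const, Finset.card_univ, Fintype.card_fin, nsmul_eq_mul]
    ring

include hm hmk hξ hΞ in
lemma CoeffBounds.abs_birthDeath_birthDeath_le (hM : M.Standing) {Λ Λ' : ℝ} {n : ℕ} (hn : 0 < n)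
    {l u g l' u' g' : Fin d → ℝ} (h : CoeffBounds Λ n l u g) (h' : CoeffBounds Λ' n l' u' g')
    (x : Fin d → ℝ) :
    |birthDeath l' u' g' (priority n) (birthDeath l u g (priority n) (M.shiftedV m ξ n)) x| ≤
      3 * d * Λ' * (d * (Ξ * (Λ * (18 * taylorConst k + 3 * m)))) *
        ((n + M.size n x) ^ 2 * M.size n x ^ k) := by
  refine (h'.abs_birthDeath_le hM hn (fun i => h.abs_birthDeath_shiftedV_sub_le hm hmk hξ hΞ hM hn
    x i (δ := 1) (by simp)) fun i => ?_).trans (le_of_eq ?_)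
  · rw [show x - Pi.single i 1 = x + Pi.single i (-1 : ℝ) by
      rw [Pi.single_neg, sub_eq_add_neg]]
    exact h.abs_birthDeath_shiftedV_sub_le hm hmk hξ hΞ hM hn x i (by simp)
  · ring

/-! ### Absorbing lower-order terms -/

include hξ in
lemma exists_size_pow_le : ∃ C, 0 < C ∧ ∀ (n : ℕ) (x : Fin d → ℝ),
    M.size n x ^ (k + 2) ≤ C * (((n : ℝ) ^ M.β) ^ (k + 2) + M.shiftedV (k + 2) ξ n x) := by
  obtain ⟨c, hc, hcξ⟩ := exists_pos_le ξ hξ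
  set D : ℝ := 2 ^ (k + 1) * ((d : ℝ) ^ (k + 1) + 1) with hD
  refine ⟨D * (1 + c⁻¹), by positivity, fun n x => ?_⟩
  have hN : 0 ≤ (n : ℝ) ^ M.β := Real.rpow_nonneg (Nat.cast_nonneg n) _
  have h1 := add_sum_pow_le (fun i => abs_nonneg (x i - M.ρ i * n)) hN (k + 1)
  refine h1.trans ?_
  have hD0 : 0 ≤ D := by positivity
  rw [← hD, mul_assoc D]
  refine mul_le_mul_of_nonneg_left ?_ hD0
  have h2 : ∑ i, |x i - M.ρ i * n| ^ (k + 2) ≤ c⁻¹ * M.shiftedV (k + 2) ξ n x := by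
    rw [shiftedV, V, Finset.mul_sum]
    refine Finset.sum_le_sum fun i _ => ?_
    rw [← mul_assoc]
    refine le_mul_of_one_le_left (pow_nonneg (abs_nonneg _) _) ?_
    rw [inv_mul_eq_div, one_le_div hc]
    exact hcξ i
  have h3 := shiftedV_nonneg (M := M) (m := k + 2) hξ n x
  have h4 : 0 ≤ c⁻¹ * ((n : ℝ) ^ M.β) ^ (k + 2) := by positivity
  simp only [add_assoc, Nat.reduceAdd] at h2 h3 h4 ⊢
  nlinarith

include hξ in
lemma exists_mul_size_pow_le {η : ℝ} (hη : 0 < η) : ∃ C, 0 < C ∧ ∀ (n : ℕ) (x : Fin d → ℝ),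
    (n : ℝ) ^ M.β * M.size n x ^ (k + 1) ≤
      η * M.shiftedV (k + 2) ξ n x + C * ((n : ℝ) ^ M.β) ^ (k + 2) := by
  obtain ⟨D, hD, h⟩ := exists_size_pow_le (M := M) (k := k) hξ
  refine ⟨η + ((η / D) ^ (k + 1))⁻¹, by positivity, fun n x => ?_⟩
  have hN : 0 ≤ (n : ℝ) ^ M.β := Real.rpow_nonneg (Nat.cast_nonneg n) _
  have h1 := mul_pow_le_young (hN.trans (pow_β_le_size n x)) hN (div_pos hη hD) (k + 1)
  have h2 := mul_le_mul_of_nonneg_left (h n x) (div_pos hη hD).le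
  have e : η / D * (D * (((n : ℝ) ^ M.β) ^ (k + 2) + M.shiftedV (k + 2) ξ n x)) =
      η * (((n : ℝ) ^ M.β) ^ (k + 2) + M.shiftedV (k + 2) ξ n x) := by
    field_simp
  rw [e] at h2
  simp only [add_assoc, Nat.reduceAdd] at h1 ⊢
  rw [div_eq_mul_inv (((n : ℝ) ^ M.β) ^ (k + 2))] at h1
  linarith

end EvenPower

lemma n_add_size_le {n : ℕ} (hn : 0 < n) (x : Fin d → ℝ) :
    n + M.size n x ≤ 2 * ((n : ℝ) ^ M.β * M.size n x) := by
  have h1 := one_le_pow_β (M := M) hn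
  have h2 := le_pow_β_sq (M := M) hn
  have h3 := pow_β_le_size (M := M) n x
  have h4 := mul_le_mul_of_nonneg_left h3 (zero_le_one.trans h1)
  have h5 := le_mul_of_one_le_left (zero_le_one.trans (one_le_size (M := M) hn x)) h1
  linarith

lemma Standing.inv_mul_n_add_size_le (hM : M.Standing) {n : ℕ} (hn : 0 < n) (x : Fin d → ℝ) :
    ((n : ℝ) ^ M.α)⁻¹ * (n + M.size n x) ≤ (n : ℝ) ^ M.β + ((n : ℝ) ^ M.α)⁻¹ * M.size n x := by
  have := hM.self_le_pow_mul hn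
  linarith

lemma Standing.inv_mul_sq_le (hM : M.Standing) {n : ℕ} (hn : 0 < n) (x : Fin d → ℝ) :
    ((n : ℝ) ^ M.α)⁻¹ * (n + M.size n x) ^ 2 ≤
      3 * ((n : ℝ) ^ M.β * M.size n x) + ((n : ℝ) ^ M.α)⁻¹ * M.size n x ^ 2 := by
  have h0 := one_le_size (M := M) hn x
  have h1 := sq_le_pow_mul (M := M) hn
  have h2 := mul_le_mul_of_nonneg_right (hM.self_le_pow_mul hn) (zero_le_one.trans h0)
  have h3 := mul_le_mul_of_nonneg_left (pow_β_le_size (M := M) n x)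
    (zero_le_one.trans (one_le_pow_β (M := M) hn))
  nlinarith

/-! ### A Foster-Lyapunov function for the averaged process -/

/-- Under the static priority policy the total service and abandonment rate of class `i` pushes
`x_i` towards `n ρ_i`, up to an error caused by the classes of higher priority: these leave at
least `n ρ_i - ∑ j < i, |x_j - n ρ_j|` servers for class `i`. -/
lemma Standing.restoring_drift (hM : M.Standing) {n : ℕ} {c Λ μ γ : ℝ} (hc : 0 < c) (hcμ : c ≤ μ)
    (hcγ : c ≤ γ) (hμ : μ ≤ Λ) (hγ : γ ≤ Λ) (x : Fin d → ℝ) (i : Fin d) :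
    c * |x i - M.ρ i * n| ^ 2 -
      Λ * |x i - M.ρ i * n| * ∑ j ∈ Finset.Iio i, |x j - M.ρ j * n| ≤
    (x i - M.ρ i * n) *
      (μ * priority n x i + γ * (x i - priority n x i) - μ * (M.ρ i * n)) := by
  set S := ∑ j ∈ Finset.Iio i, |x j - M.ρ j * n| with hS
  have hS0 : 0 ≤ S := Finset.sum_nonneg fun _ _ => abs_nonneg _
  have hcap : M.ρ i * n - S ≤ (n : ℝ) - ∑ j ∈ Finset.Iio i, x j := by
    have h1 : ∑ j ∈ Finset.Iio i, x j ≤ S + (∑ j ∈ Finset.Iio i, M.ρ j) * n := by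
      rw [hS, Finset.sum_mul, ← Finset.sum_add_distrib]
      exact Finset.sum_le_sum fun j _ => by linarith [le_abs_self (x j - M.ρ j * n)]
    have h2 : M.ρ i + ∑ j ∈ Finset.Iio i, M.ρ j ≤ 1 := by
      rw [← Finset.sum_insert (by simp), ← hM.critical]
      exact Finset.sum_le_sum_of_subset_of_nonneg (Finset.subset_univ _) fun j _ _ => (hM.ρ_pos j).le
    nlinarith [mul_le_mul_of_nonneg_right h2 (Nat.cast_nonneg (α := ℝ) n)]
  have hz : min (x i) (M.ρ i * n - S) ≤ priority n x i :=
    min_le_min le_rfl (hcap.trans (le_max_left _ _))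
  have hzx := priority_le n x i
  generalize priority n x i = z at *
  generalize M.ρ i * (n : ℝ) = r at *
  have hΛ : 0 < Λ := by linarith
  rcases le_total 0 (x i - r) with hw | hw
  · rw [abs_of_nonneg hw]
    rw [min_eq_right (by linarith)] at hz
    have key : c * (x i - r) - Λ * S ≤ μ * z + γ * (x i - z) - μ * r := by
      rcases le_total 0 (z - r) with ha | ha
      · nlinarith [mul_nonneg (sub_nonneg.2 hcμ) ha, mul_nonneg (sub_nonneg.2 hcγ)
          (sub_nonneg.2 hzx), mul_nonneg hΛ.le hS0]
      · have h1 : μ * (r - z) ≤ Λ * S := mul_le_mul hμ (by linarith) (by linarith) hΛ.le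
        have h2 : c * (x i - r) ≤ γ * (x i - z) :=
          mul_le_mul hcγ (by linarith) hw (by linarith)
        nlinarith
    nlinarith [mul_le_mul_of_nonneg_left key hw]
  · rw [abs_of_nonpos hw]
    have hq : x i - z ≤ S := by
      rcases min_le_iff.1 hz with h | h
      · linarith
      · linarith
    have h1 : (γ - μ) * (x i - z) ≤ Λ * S :=
      mul_le_mul (by linarith) hq (by linarith) hΛ.le
    have h2 : μ * (x i - r) ≤ c * (x i - r) := mul_le_mul_of_nonpos_right hcμ hw
    have key : μ * z + γ * (x i - z) - μ * r ≤ c * (x i - r) + Λ * S := by nlinarith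
    nlinarith [mul_le_mul_of_nonpos_left key hw]

/-- Second-order expansion of the contribution of one class with arrival rate `l` and departure
rate `a`. -/
lemma class_drift_le {c Λ N n s S l a w : ℝ} {k : ℕ} (hk : Even k) (hΛ : 0 ≤ Λ) (hn : 0 ≤ n)
    (hN : 0 ≤ N) (hl : |l| ≤ Λ * n) (ha : |a| ≤ 2 * Λ * (s + n)) (hws : |w| + 1 ≤ s)
    (hdrift : w * (l - a) ≤ Λ * N * |w| - c * |w| ^ 2 + Λ * |w| * S) :
    l * ((w + 1) ^ (k + 2) - w ^ (k + 2)) + a * ((w + -1) ^ (k + 2) - w ^ (k + 2)) ≤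
      (k + 2 : ℕ) * (Λ * (N * s ^ (k + 1)) - c * |w| ^ (k + 2) + Λ * (S * |w| ^ (k + 1))) +
        3 * Λ * taylorConst k * ((n + s) * s ^ k) := by
  have h1 := abs_taylor_pow_le (δ := 1) (by simp) hws k
  have h2 := abs_taylor_pow_le (δ := -1) (by simp) hws k
  have hs : 0 ≤ s := by linarith [abs_nonneg w]
  have hTQ : 0 ≤ taylorConst k * s ^ k := (abs_nonneg _).trans h1
  have e1 : l * ((w + 1) ^ (k + 2) - w ^ (k + 2) - (k + 2 : ℕ) * 1 * w ^ (k + 1)) ≤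
      Λ * n * (taylorConst k * s ^ k) := by
    refine (le_abs_self _).trans ?_
    rw [abs_mul]
    exact mul_le_mul hl h1 (abs_nonneg _) (by positivity)
  have e2 : a * ((w + -1) ^ (k + 2) - w ^ (k + 2) - (k + 2 : ℕ) * -1 * w ^ (k + 1)) ≤
      2 * Λ * (s + n) * (taylorConst k * s ^ k) := by
    refine (le_abs_self _).trans ?_
    rw [abs_mul]
    exact mul_le_mul ha h2 (abs_nonneg _) (by positivity)
  have e3 : w ^ (k + 1) * (l - a) ≤
      Λ * (N * s ^ (k + 1)) - c * |w| ^ (k + 2) + Λ * (S * |w| ^ (k + 1)) := by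
    have h3 : w ^ (k + 1) * (l - a) = |w| ^ k * (w * (l - a)) := by
      rw [hk.pow_abs]; ring
    have h4 := mul_le_mul_of_nonneg_left hdrift (pow_nonneg (abs_nonneg w) k)
    have h5 : Λ * (N * |w| ^ (k + 1)) ≤ Λ * (N * s ^ (k + 1)) := by
      have : |w| ≤ s := by linarith
      gcongr
    rw [h3]
    refine h4.trans ?_
    have e : |w| ^ k * (Λ * N * |w| - c * |w| ^ 2 + Λ * |w| * S) =
      Λ * (N * |w| ^ (k + 1)) - c * |w| ^ (k + 2) + Λ * (S * |w| ^ (k + 1)) := by ring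
    linarith
  have e4 := mul_le_mul_of_nonneg_left e3 (Nat.cast_nonneg (α := ℝ) (k + 2))
  have e5 : 0 ≤ Λ * s * (taylorConst k * s ^ k) := by positivity
  linarith

lemma Standing.eventually_avg_lower (hM : M.Standing) :
    ∃ c, 0 < c ∧ ∀ᶠ n in atTop, ∀ i, c ≤ M.avg (M.mu n) i ∧ c ≤ M.avg (M.gam n) i := by
  obtain ⟨c₁, hc₁, h₁⟩ := exists_pos_le (M.avg M.muLim) fun i => hM.avg_pos (hM.muLim_pos i)
  obtain ⟨c₂, hc₂, h₂⟩ := exists_pos_le (M.avg M.gamLim) fun i => hM.avg_pos (hM.gamLim_pos i)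
  have hc : 0 < min c₁ c₂ := lt_min hc₁ hc₂
  refine ⟨min c₁ c₂ / 2, by positivity, eventually_all.2 fun i => ?_⟩
  have e1 := (tendsto_avg (M := M) (hM.mu_tendsto i)).eventually (lt_mem_nhds
    (show min c₁ c₂ / 2 < M.avg M.muLim i by linarith [h₁ i, min_le_left c₁ c₂]))
  have e2 := (tendsto_avg (M := M) (hM.gam_tendsto i)).eventually (lt_mem_nhds
    (show min c₁ c₂ / 2 < M.avg M.gamLim i by linarith [h₂ i, min_le_right c₁ c₂]))
  filter_upwards [e1, e2] with n h1 h2 using ⟨h1.le, h2.le⟩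

/-- Weights decreasing geometrically in the priority dominate the influence of the classes of
higher priority. -/
lemma sum_pow_mul_sum_le {θ : ℝ} (hθ : 0 ≤ θ) (hθ1 : θ ≤ 1) {v : Fin d → ℝ} (hv : ∀ i, 0 ≤ v i) :
    ∑ i : Fin d, θ ^ (i : ℕ) * ∑ j ∈ Finset.Iio i, v j ≤
      d * θ * ∑ j : Fin d, θ ^ (j : ℕ) * v j := by
  have h : ∀ i ∈ (Finset.univ : Finset (Fin d)), θ ^ (i : ℕ) * ∑ j ∈ Finset.Iio i, v j ≤
      θ * ∑ j : Fin d, θ ^ (j : ℕ) * v j := by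
    intro i _
    calc θ ^ (i : ℕ) * ∑ j ∈ Finset.Iio i, v j
        = ∑ j ∈ Finset.Iio i, θ ^ (i : ℕ) * v j := Finset.mul_sum _ _ _
      _ ≤ ∑ j ∈ Finset.Iio i, θ ^ ((j : ℕ) + 1) * v j := by
          refine Finset.sum_le_sum fun j hj => mul_le_mul_of_nonneg_right ?_ (hv j)
          exact pow_le_pow_of_le_one hθ hθ1 (Finset.mem_Iio.1 hj)
      _ ≤ ∑ j : Fin d, θ ^ ((j : ℕ) + 1) * v j :=
          Finset.sum_le_sum_of_subset_of_nonneg (Finset.subset_univ _) fun j _ _ =>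
            mul_nonneg (pow_nonneg hθ _) (hv j)
      _ = θ * ∑ j : Fin d, θ ^ (j : ℕ) * v j := by
          rw [Finset.mul_sum]
          exact Finset.sum_congr rfl fun j _ => by ring
  refine (Finset.sum_le_sum h).trans (le_of_eq ?_)
  rw [Finset.sum_const, Finset.card_univ, Fintype.card_fin, nsmul_eq_mul, mul_assoc]

theorem Standing.exists_averagedWeight (hM : M.Standing) {m : ℕ} (hm : Even m) (hm2 : 2 ≤ m) :
    ∃ ξ, M.AveragedWeight m ξ := by
  obtain ⟨k, rfl⟩ : ∃ k, m = k + 2 := ⟨m - 2, by omega⟩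
  have hk : Even k := by
    rw [Nat.even_add] at hm
    exact hm.2 even_two
  have hd : (0 : ℝ) < d := by
    obtain ⟨i⟩ := hM.nonempty_class
    exact_mod_cast i.pos
  obtain ⟨Λ₁, hΛ₁, hev₁⟩ := hM.eventually_rateBounds
  obtain ⟨Λ₂, hΛ₂, hev₂⟩ := hM.eventually_centering
  obtain ⟨c, hc, hev₃⟩ := hM.eventually_avg_lower
  set Λ := Λ₁ + Λ₂ with hΛ
  have hΛ0 : 0 < Λ := by positivity
  -- Young's inequality with `ε` leaves a quarter of the restoring drift for the cross terms
  set ε := c / (4 * Λ * d) with hε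
  have hε0 : 0 < ε := by positivity
  set E := (ε ^ (k + 1))⁻¹ with hE
  have hE0 : 0 < E := by positivity
  set θ := c / (c + 4 * Λ * E * d) with hθ
  have hθ0 : 0 < θ := by positivity
  have hθ1 : θ ≤ 1 := (div_le_one (by positivity)).2 (le_add_of_nonneg_right (by positivity))
  have hθc : Λ * E * (d * θ) ≤ c / 4 := by
    rw [hθ, mul_div_assoc', mul_div_assoc', div_le_iff₀ (by positivity)]
    nlinarith [mul_pos hc hc]
  set ξ : Fin d → ℝ := fun i => θ ^ (i : ℕ) with hξ
  have hξ0 : ∀ i, 0 < ξ i := fun i => pow_pos hθ0 _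
  have hξ1 : ∀ i, ξ i ≤ 1 := fun i => pow_le_one₀ hθ0.le hθ1
  set D : ℝ := d * ((k + 2 : ℕ) * Λ + 6 * Λ * taylorConst k) + 1 with hD
  have hT := taylorConst_nonneg k
  have hD0 : 0 < D := by positivity
  obtain ⟨C, hC, habs⟩ := exists_mul_size_pow_le (M := M) (k := k) hξ0
    (show 0 < c / (2 * D) by positivity)
  obtain ⟨n₀, hn₀⟩ := eventually_atTop.1 (hev₁.and (hev₂.and hev₃))
  refine ⟨ξ, hξ0, D * C, by positivity, c / 2, by positivity, n₀, fun n hn x => ?_⟩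
  obtain ⟨hb, hcen, hlow⟩ := hn₀ n hn
  have hn0 := hb.n_pos
  have hn' : (0 : ℝ) < n := by exact_mod_cast hn0
  set N := (n : ℝ) ^ M.β with hN
  have hN1 : 1 ≤ N := one_le_pow_β hn0
  set X : Fin d → ℝ := fun i => (x i : ℝ) with hX
  set s := M.size n X with hs
  have hs1 : 1 ≤ s := one_le_size hn0 X
  change M.genAvg n (M.shiftedV (k + 2) ξ n) X ≤ _ - _ * M.shiftedV (k + 2) ξ n X
  have hcoef : CoeffBounds Λ n (M.avg (M.lam n)) (M.avg (M.mu n)) (M.avg (M.gam n)) := by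
    refine ⟨hΛ0.le, fun i => (hM.abs_avg_le (hb.lam i)).trans ?_, fun i => (hM.abs_avg_le
      (hb.mu i)).trans (by linarith), fun i => (hM.abs_avg_le (hb.gam i)).trans (by linarith)⟩
    gcongr
    linarith
  have hclass : ∀ i, M.avg (M.lam n) i * ((X i - M.ρ i * n + 1) ^ (k + 2) -
        (X i - M.ρ i * n) ^ (k + 2)) + (M.avg (M.mu n) i * priority n X i +
        M.avg (M.gam n) i * (X i - priority n X i)) * ((X i - M.ρ i * n + -1) ^ (k + 2) -
        (X i - M.ρ i * n) ^ (k + 2)) ≤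
      (k + 2 : ℕ) * (Λ * (N * s ^ (k + 1)) - 3 / 4 * c * |X i - M.ρ i * n| ^ (k + 2) +
        Λ * E * ∑ j ∈ Finset.Iio i, |X j - M.ρ j * n| ^ (k + 2)) +
        3 * Λ * taylorConst k * ((n + s) * s ^ k) := by
    intro i
    have hrest := hM.restoring_drift hc (hlow i).1 (hlow i).2
      ((le_abs_self _).trans (hcoef.u i)) ((le_abs_self _).trans (hcoef.g i)) X (n := n) i
    have hdr : (X i - M.ρ i * n) * (M.avg (M.lam n) i - (M.avg (M.mu n) i * priority n X i +
        M.avg (M.gam n) i * (X i - priority n X i))) ≤ Λ * N * |X i - M.ρ i * n| -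
        c * |X i - M.ρ i * n| ^ 2 + Λ * |X i - M.ρ i * n| *
          ∑ j ∈ Finset.Iio i, |X j - M.ρ j * n| := by
      have h1 : (X i - M.ρ i * n) * (M.avg (M.lam n) i - M.avg (M.mu n) i * (M.ρ i * n)) ≤
          Λ * N * |X i - M.ρ i * n| := by
        refine (le_abs_self _).trans ?_
        rw [abs_mul, mul_comm]
        gcongr
        refine (hcen i).trans ?_
        gcongr
        linarith
      linarith
    refine (class_drift_le hk hΛ0.le hn'.le (zero_le_one.trans hN1) (hcoef.l i)
      ((hcoef.abs_departure_le X i).trans ?_) (abs_add_one_le_size hn0 X i) hdr).trans ?_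
    · have := hM.abs_le_size hn0 X i
      gcongr
    have hyoung : (∑ j ∈ Finset.Iio i, |X j - M.ρ j * n|) * |X i - M.ρ i * n| ^ (k + 1) ≤
        d * ε * |X i - M.ρ i * n| ^ (k + 2) +
          E * ∑ j ∈ Finset.Iio i, |X j - M.ρ j * n| ^ (k + 2) := by
      rw [Finset.sum_mul, Finset.mul_sum]
      have h1 : ∀ j ∈ Finset.Iio i, |X j - M.ρ j * n| * |X i - M.ρ i * n| ^ (k + 1) ≤
          ε * |X i - M.ρ i * n| ^ (k + 2) + E * |X j - M.ρ j * n| ^ (k + 2) := by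
        intro j _
        refine (mul_pow_le_young (abs_nonneg _) (abs_nonneg _) hε0 (k + 1)).trans (le_of_eq ?_)
        rw [hE, div_eq_inv_mul]
      refine (Finset.sum_le_sum h1).trans ?_
      rw [Finset.sum_add_distrib, Finset.sum_const, nsmul_eq_mul, ← mul_assoc]
      gcongr
      exact_mod_cast (Finset.card_le_univ (Finset.Iio i)).trans_eq (Fintype.card_fin d)
    have hε' : Λ * (d * ε) = c / 4 := by rw [hε]; field_simp
    have h2 := mul_le_mul_of_nonneg_left hyoung hΛ0.le
    have h3 : Λ * (d * ε * |X i - M.ρ i * n| ^ (k + 2)) = c / 4 * |X i - M.ρ i * n| ^ (k + 2) := by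
      rw [← hε']; ring
    gcongr ?_ + _
    refine mul_le_mul_of_nonneg_left ?_ (Nat.cast_nonneg _)
    linarith
  rw [genAvg, birthDeath_shiftedV hm]
  set f := M.shiftedV (k + 2) ξ n X with hf
  have hf0 : 0 ≤ f := shiftedV_nonneg hξ0 n X
  have hfe : f = ∑ j : Fin d, θ ^ (j : ℕ) * |X j - M.ρ j * n| ^ (k + 2) := rfl
  set R : ℝ := (k + 2 : ℕ) * (Λ * (N * s ^ (k + 1))) + 3 * Λ * taylorConst k * ((n + s) * s ^ k)
    with hR
  have hR0 : 0 ≤ R := by positivity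
  have hsum : ∑ i, ξ i * (M.avg (M.lam n) i * ((X i - M.ρ i * n + 1) ^ (k + 2) -
        (X i - M.ρ i * n) ^ (k + 2)) + (M.avg (M.mu n) i * priority n X i +
        M.avg (M.gam n) i * (X i - priority n X i)) * ((X i - M.ρ i * n + -1) ^ (k + 2) -
        (X i - M.ρ i * n) ^ (k + 2))) ≤ d * R - (k + 2 : ℕ) * (c / 2) * f := by
    calc _ ≤ ∑ i : Fin d, (R - (k + 2 : ℕ) * (3 / 4 * c) * (θ ^ (i : ℕ) * |X i - M.ρ i * n| ^ (k + 2)) +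
          (k + 2 : ℕ) * (Λ * E) * (θ ^ (i : ℕ) *
            ∑ j ∈ Finset.Iio i, |X j - M.ρ j * n| ^ (k + 2))) := by
          refine Finset.sum_le_sum fun i _ => ?_
          have h1 := mul_le_mul_of_nonneg_left (hclass i) (hξ0 i).le
          have h2 := mul_le_mul_of_nonneg_right (hξ1 i) hR0
          refine h1.trans ?_
          simp only [hR, hξ] at h2 ⊢
          linarith
      _ = d * R - (k + 2 : ℕ) * (3 / 4 * c) * f + (k + 2 : ℕ) * (Λ * E) *
          ∑ i : Fin d, θ ^ (i : ℕ) * ∑ j ∈ Finset.Iio i, |X j - M.ρ j * n| ^ (k + 2) := by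
          rw [Finset.sum_add_distrib, Finset.sum_sub_distrib, ← Finset.mul_sum, ← Finset.mul_sum,
            ← hfe, Finset.sum_const, Finset.card_univ, Fintype.card_fin, nsmul_eq_mul]
      _ ≤ d * R - (k + 2 : ℕ) * (3 / 4 * c) * f + (k + 2 : ℕ) * (c / 4 * f) := by
          gcongr ?_ + ?_
          · exact le_rfl
          have h1 := sum_pow_mul_sum_le hθ0.le hθ1 (v := fun j => |X j - M.ρ j * n| ^ (k + 2))
            fun j => by positivity
          rw [← hfe] at h1
          rw [mul_assoc]
          refine mul_le_mul_of_nonneg_left ?_ (Nat.cast_nonneg _)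
          calc _ ≤ Λ * E * (d * θ * f) := mul_le_mul_of_nonneg_left h1 (by positivity)
            _ = Λ * E * (d * θ) * f := by ring
            _ ≤ _ := mul_le_mul_of_nonneg_right hθc hf0
      _ = _ := by ring
  refine hsum.trans ?_
  have hRle : d * R ≤ D * (N * s ^ (k + 1)) := by
    have h1 : (n + s) * s ^ k ≤ 2 * (N * s) * s ^ k := by
      have := n_add_size_le hn0 X (M := M)
      gcongr
    have h2 : 0 ≤ N * s ^ (k + 1) := by positivity
    have h3 : R ≤ ((k + 2 : ℕ) * Λ + 6 * Λ * taylorConst k) * (N * s ^ (k + 1)) := by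
      have h4 : 0 ≤ 3 * Λ * taylorConst k := by positivity
      have h5 := mul_le_mul_of_nonneg_left h1 h4
      have h6 : 3 * Λ * taylorConst k * (2 * (N * s) * s ^ k) =
        6 * Λ * taylorConst k * (N * s ^ (k + 1)) := by ring
      rw [hR]
      linarith
    have h7 := mul_le_mul_of_nonneg_left h3 hd.le
    rw [hD]
    linarith
  have hab := mul_le_mul_of_nonneg_left (habs n X) hD0.le
  have h8 : D * (c / (2 * D) * f + C * N ^ (k + 2)) = c / 2 * f + D * C * N ^ (k + 2) := by
    field_simp
  have h9 : N ^ (k + 2) = (n : ℝ) ^ ((k + 2 : ℕ) * M.β) := by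
    rw [hN, ← Real.rpow_natCast, ← Real.rpow_mul hn'.le, mul_comm]
  have h10 : c * f ≤ (k + 2 : ℕ) * (c / 2) * f := by
    have : (2 : ℝ) ≤ (k + 2 : ℕ) := by push_cast; linarith [Nat.cast_nonneg (α := ℝ) k]
    nlinarith [mul_nonneg hc.le hf0]
  rw [← h9]
  rw [← hs, ← hN, ← hf] at hab
  linarith

/-! ### The corrected Lyapunov function -/

lemma birthDeath_add_mul_sum {ι : Type*} [Fintype ι] (l u g : Fin d → ℝ)
    (z : (Fin d → ℝ) → Fin d → ℝ) (f : (Fin d → ℝ) → ℝ) (F : ι → (Fin d → ℝ) → ℝ) (r : ℝ)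
    (a : ι → ℝ) (x : Fin d → ℝ) :
    birthDeath l u g z (fun y => f y + r * ∑ j, a j * F j y) x =
      birthDeath l u g z f x + r * ∑ j, a j * birthDeath l u g z (F j) x := by
  have h1 : ∀ y, ∑ j, a j * F j y - ∑ j, a j * F j x = ∑ j, a j * (F j y - F j x) := fun y => by
    rw [← Finset.sum_sub_distrib]
    exact Finset.sum_congr rfl fun j _ => by ring
  have h2 : ∀ (b : Fin d → ℝ) (y : Fin d → Fin d → ℝ),
      ∑ i, b i * (f (y i) + r * ∑ j, a j * F j (y i) - (f x + r * ∑ j, a j * F j x)) =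
      ∑ i, b i * (f (y i) - f x) + r * ∑ j, a j * ∑ i, b i * (F j (y i) - F j x) := by
    intro b y
    have h3 : ∑ j, a j * ∑ i, b i * (F j (y i) - F j x) =
        ∑ i, b i * ∑ j, a j * (F j (y i) - F j x) := by
      simp only [Finset.mul_sum]
      rw [Finset.sum_comm]
      exact Finset.sum_congr rfl fun i _ => Finset.sum_congr rfl fun j _ => by ring
    rw [h3, Finset.mul_sum (s := Finset.univ) (a := r)
      (f := fun i => b i * ∑ j, a j * (F j (y i) - F j x)), ← Finset.sum_add_distrib]
    refine Finset.sum_congr rfl fun i _ => ?_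
    rw [← h1]
    ring
  simp only [birthDeath, h2, mul_add, Finset.sum_add_distrib]
  ring

lemma birthDeath_const_mul (l u g : Fin d → ℝ) (z : (Fin d → ℝ) → Fin d → ℝ)
    (f : (Fin d → ℝ) → ℝ) (e : ℝ) (x : Fin d → ℝ) :
    birthDeath l u g z (fun y => e * f y) x = e * birthDeath l u g z f x := by
  simp only [birthDeath, ← mul_sub, mul_add, Finset.mul_sum]
  congr 1
  · congr 1 <;> exact Finset.sum_congr rfl fun i _ => by ring
  · exact Finset.sum_congr rfl fun i _ => by ring

lemma genDelta_eq (n : ℕ) (k : Fin K) (f : (Fin d → ℝ) → ℝ) (x : Fin d → ℝ) :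
    M.genDelta n k f x = M.genAvg n f x - M.genEnv n k f x := by
  simp only [genDelta, genAvg, genEnv, birthDeath, sub_mul, Finset.sum_sub_distrib]
  ring

lemma genAvg_eq_sum (n : ℕ) (f : (Fin d → ℝ) → ℝ) (x : Fin d → ℝ) :
    M.genAvg n f x = ∑ k, M.π k * M.genEnv n k f x := by
  have h : ∀ (a : Fin d → Fin K → ℝ) (b : Fin d → ℝ),
      ∑ i, M.avg a i * b i = ∑ k, M.π k * ∑ i, a i k * b i := by
    intro a b
    simp only [avg, Finset.mul_sum, Finset.sum_mul]
    rw [Finset.sum_comm]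
    exact Finset.sum_congr rfl fun i _ => Finset.sum_congr rfl fun j _ => by ring
  simp only [genAvg, genEnv, birthDeath, mul_assoc, h, mul_add, Finset.sum_add_distrib]

lemma Standing.sum_π_genDelta (hM : M.Standing) (n : ℕ) (f : (Fin d → ℝ) → ℝ) (x : Fin d → ℝ) :
    ∑ k, M.π k * M.genDelta n k f x = 0 := by
  simp only [genDelta_eq, mul_sub, Finset.sum_sub_distrib, ← genAvg_eq_sum]
  rw [← Finset.sum_mul, hM.π_sum, one_mul, sub_self]

variable (M) in
/-- The unscaled corrected Lyapunov function `f_n + n^{-α} ∑ c_{kl} ΔL_l f_n`. -/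
noncomputable def corrected (c : Fin K → Fin K → ℝ) (n m : ℕ) (ξ : Fin d → ℝ) (x : Fin d → ℝ)
    (k : Fin K) : ℝ :=
  M.shiftedV m ξ n x + (1 / (n : ℝ) ^ M.α) * ∑ l, c k l * M.genDelta n l (M.shiftedV m ξ n) x

/-- The Poisson equation turns the generator at frozen environment into the averaged one, at the
price of the second-order term `n^{-α} ∑ c_{kl} L_k ΔL_l f_n`. -/
lemma Standing.gen_corrected (hM : M.Standing) {c : Fin K → Fin K → ℝ} (hc : M.PoissonKernel c)
    {n : ℕ} (hn : 0 < n) (m : ℕ) (ξ : Fin d → ℝ) (x : Fin d → ℝ) (k : Fin K) :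
    M.gen n (M.corrected c n m ξ) x k = M.genAvg n (M.shiftedV m ξ n) x +
      (1 / (n : ℝ) ^ M.α) *
        ∑ l, c k l * M.genEnv n k (M.genDelta n l (M.shiftedV m ξ n)) x := by
  have hα : (n : ℝ) ^ M.α ≠ 0 := (Real.rpow_pos_of_pos (by exact_mod_cast hn) _).ne'
  have h1 := hc (fun l => M.genDelta n l (M.shiftedV m ξ n) x)
    (hM.sum_π_genDelta n _ x) k
  have h2 : ∑ k', (n : ℝ) ^ M.α * M.Q k k' * (M.corrected c n m ξ x k' - M.corrected c n m ξ x k) =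
      M.genDelta n k (M.shiftedV m ξ n) x := by
    rw [← h1]
    refine Finset.sum_congr rfl fun k' _ => ?_
    simp only [corrected]
    field_simp
    ring
  have h3 : M.genEnv n k (fun y => M.corrected c n m ξ y k) x =
      M.genEnv n k (M.shiftedV m ξ n) x + (1 / (n : ℝ) ^ M.α) *
        ∑ l, c k l * M.genEnv n k (M.genDelta n l (M.shiftedV m ξ n)) x :=
    birthDeath_add_mul_sum _ _ _ _ _ _ _ _ _
  rw [gen, h2, h3, genDelta_eq]
  ring

lemma RateBounds.coeffBounds_env {Λ : ℝ} (hΛ : 0 ≤ Λ) {n : ℕ} (h : RateBounds M Λ n) (k : Fin K) :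
    CoeffBounds Λ n (M.lam n · k) (M.mu n · k) (M.gam n · k) :=
  ⟨hΛ, fun i => h.lam i k, fun i => h.mu i k, fun i => h.gam i k⟩

lemma RateBounds.coeffBounds_delta (hM : M.Standing) {Λ : ℝ} (hΛ : 0 ≤ Λ) {n : ℕ}
    (h : RateBounds M Λ n) (k : Fin K) :
    CoeffBounds (2 * Λ) n (fun i => M.avg (M.lam n) i - M.lam n i k)
      (fun i => M.avg (M.mu n) i - M.mu n i k) (fun i => M.avg (M.gam n) i - M.gam n i k) := by
  refine ⟨by positivity, fun i => ?_, fun i => ?_, fun i => ?_⟩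
  · refine (abs_sub _ _).trans ?_
    linarith [hM.abs_avg_le (h.lam i), h.lam i k]
  · refine (abs_sub _ _).trans ?_
    linarith [hM.abs_avg_le (h.mu i), h.mu i k]
  · refine (abs_sub _ _).trans ?_
    linarith [hM.abs_avg_le (h.gam i), h.gam i k]

/-- The orders of magnitude of the correction and of its generator are negligible with respect to
`f_n`, up to a multiple of `n^{mβ}`. -/
lemma Standing.eventually_correction_small (hM : M.Standing) {k : ℕ} {ξ : Fin d → ℝ}
    (hξ : ∀ i, 0 < ξ i) {η : ℝ} (hη : 0 < η) :
    ∃ C, 0 < C ∧ ∀ᶠ n : ℕ in atTop, ∀ x : Fin d → ℝ,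
      1 / (n : ℝ) ^ M.α * ((n + M.size n x) * M.size n x ^ (k + 1)) ≤
        η * M.shiftedV (k + 2) ξ n x + C * ((n : ℝ) ^ M.β) ^ (k + 2) ∧
      1 / (n : ℝ) ^ M.α * ((n + M.size n x) ^ 2 * M.size n x ^ k) ≤
        η * M.shiftedV (k + 2) ξ n x + C * ((n : ℝ) ^ M.β) ^ (k + 2) := by
  obtain ⟨D, hD, hpow⟩ := exists_size_pow_le (M := M) (k := k) hξ
  obtain ⟨C, hC, habs⟩ := exists_mul_size_pow_le (M := M) (k := k) hξ
    (show 0 < η / 6 by positivity)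
  refine ⟨3 * C + η / 2, by positivity, ?_⟩
  have hlim : Tendsto (fun n : ℕ => ((n : ℝ) ^ M.α)⁻¹) atTop (𝓝 0) :=
    tendsto_inv_atTop_zero.comp
      ((tendsto_rpow_atTop hM.α_pos).comp tendsto_natCast_atTop_atTop)
  have hev := hlim.eventually (gt_mem_nhds (show (0:ℝ) < η / (2 * D) by positivity))
  filter_upwards [hev, eventually_gt_atTop 0] with n hsmall hn x
  have hn' : (0 : ℝ) < n := by exact_mod_cast hn
  set r := ((n : ℝ) ^ M.α)⁻¹ with hr
  have hr0 : 0 ≤ r := by positivity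
  set N := (n : ℝ) ^ M.β with hN
  set s := M.size n x with hs
  set f := M.shiftedV (k + 2) ξ n x with hf
  have hf0 : 0 ≤ f := shiftedV_nonneg hξ n x
  have hs1 : 1 ≤ s := one_le_size hn x
  have hN1 : 1 ≤ N := one_le_pow_β hn
  have hmain : 3 * (N * s ^ (k + 1)) + r * s ^ (k + 2) ≤
      η * f + (3 * C + η / 2) * N ^ (k + 2) := by
    have h1 := habs n x
    have h2 : r * s ^ (k + 2) ≤ η / (2 * D) * (D * (N ^ (k + 2) + f)) :=
      mul_le_mul hsmall.le (hpow n x) (by positivity) (by positivity)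
    have h3 : η / (2 * D) * (D * (N ^ (k + 2) + f)) = η / 2 * (N ^ (k + 2) + f) := by
      field_simp
    rw [← hs, ← hN, ← hf] at h1
    linarith
  rw [one_div, ← hr]
  refine ⟨le_trans ?_ hmain, le_trans ?_ hmain⟩
  · have h1 := mul_le_mul_of_nonneg_right (hM.inv_mul_n_add_size_le hn x)
      (by positivity : 0 ≤ s ^ (k + 1))
    rw [← hr, ← hs, ← hN] at h1
    have h2 : 0 ≤ N * s ^ (k + 1) := by positivity
    have h3 : (N + r * s) * s ^ (k + 1) = N * s ^ (k + 1) + r * s ^ (k + 2) := by ring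
    linarith
  · have h1 := mul_le_mul_of_nonneg_right (hM.inv_mul_sq_le hn x)
      (by positivity : 0 ≤ s ^ k)
    rw [← hr, ← hs, ← hN] at h1
    have h3 : (3 * (N * s) + r * s ^ 2) * s ^ k = 3 * (N * s ^ (k + 1)) + r * s ^ (k + 2) := by
      ring
    linarith

lemma abs_sum_mul_le {c : Fin K → Fin K → ℝ} {A B : ℝ} (hc : ∀ k l, |c k l| ≤ A) (hA : 0 ≤ A)
    {b : Fin K → ℝ} (hb : ∀ l, |b l| ≤ B) (k : Fin K) : |∑ l, c k l * b l| ≤ K * A * B := by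
  refine (Finset.abs_sum_le_sum_abs _ _).trans ?_
  calc ∑ l, |c k l * b l| ≤ ∑ _l : Fin K, A * B := by
        refine Finset.sum_le_sum fun l _ => ?_
        rw [abs_mul]
        exact mul_le_mul (hc k l) (hb l) (abs_nonneg _) hA
    _ = K * A * B := by
        rw [Finset.sum_const, Finset.card_univ, Fintype.card_fin, nsmul_eq_mul, mul_assoc]

/-- The corrected function is comparable with `f_n` and satisfies a Foster-Lyapunov inequality for
the full generator. -/
theorem Standing.exists_corrected_drift (hM : M.Standing) {c : Fin K → Fin K → ℝ}
    (hc : M.PoissonKernel c) {m : ℕ} (hm : Even m) (hm2 : 2 ≤ m) {ξ : Fin d → ℝ}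
    (hξ : M.AveragedWeight m ξ) :
    ∃ C₁ > 0, ∃ C₂ > 0, ∃ n₀ : ℕ, 0 < n₀ ∧ ∀ n ≥ n₀, ∀ (x : Fin d → ℕ) (k : Fin K),
      M.shiftedV m ξ n (fun i => (x i : ℝ)) / 2 - C₁ * ((n : ℝ) ^ M.β) ^ m ≤
        M.corrected c n m ξ (fun i => (x i : ℝ)) k ∧
      M.gen n (M.corrected c n m ξ) (fun i => (x i : ℝ)) k ≤ C₁ * ((n : ℝ) ^ M.β) ^ m -
        C₂ * M.corrected c n m ξ (fun i => (x i : ℝ)) k := by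
  obtain ⟨j, rfl⟩ : ∃ j, m = j + 2 := ⟨m - 2, by omega⟩
  obtain ⟨hξ0, D₁, hD₁, D₂, hD₂, n₁, hn₁⟩ := hξ
  obtain ⟨Ξ, hΞ0, hΞ'⟩ := exists_abs_le ξ
  have hΞ : ∀ i, ξ i ≤ Ξ := fun i => (le_abs_self _).trans (hΞ' i)
  obtain ⟨A, hA, hcA'⟩ := exists_abs_le fun q : Fin K × Fin K => c q.1 q.2
  have hcA : ∀ k l, |c k l| ≤ A := fun k l => hcA' (k, l)
  obtain ⟨Λ, hΛ, hev₁⟩ := hM.eventually_rateBounds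
  have hT := taylorConst_nonneg j
  -- the constants of the bounds on the correction and on the second-order term
  set G₁ : ℝ := K * A * (3 * d * (2 * Λ) * (Ξ * (j + 2 : ℕ))) with hG₁
  set G₂ : ℝ := K * A * (3 * d * Λ * (d * (Ξ * (2 * Λ * (18 * taylorConst j +
    3 * (j + 2 : ℕ)))))) with hG₂
  have hG₁0 : 0 ≤ G₁ := by positivity
  have hG₂0 : 0 ≤ G₂ := by positivity
  set G : ℝ := G₁ + G₂ + 1 with hG
  have hG0 : 0 < G := by positivity
  set η : ℝ := min (1 / 2) (D₂ / 4) with hη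
  have hη0 : 0 < η := lt_min (by norm_num) (by positivity)
  have hη1 : η ≤ 1 / 2 := min_le_left _ _
  have hη2 : η ≤ D₂ / 4 := min_le_right _ _
  obtain ⟨C, hC, hev₂⟩ := hM.eventually_correction_small (k := j) hξ0
    (show 0 < η / G by positivity)
  obtain ⟨n₂, hn₂⟩ := eventually_atTop.1 (hev₁.and hev₂)
  refine ⟨D₁ + G * C + D₂ / 2 * (G * C), by positivity, D₂ / 2, by positivity,
    max (max n₁ n₂) 1, by positivity, fun n hn x k => ?_⟩
  have hn₁' : n₁ ≤ n := ((le_max_left _ _).trans (le_max_left _ _)).trans hn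
  have hn₂' : n₂ ≤ n := ((le_max_right _ _).trans (le_max_left _ _)).trans hn
  obtain ⟨hb, hsmall⟩ := hn₂ n hn₂'
  have hn0 := hb.n_pos
  have hn' : (0 : ℝ) < n := by exact_mod_cast hn0
  set X : Fin d → ℝ := fun i => (x i : ℝ) with hX
  obtain ⟨hs1, hs2⟩ := hsmall X
  have havg : M.genAvg n (M.shiftedV (j + 2) ξ n) X ≤
      D₁ * ((n : ℝ) ^ M.β) ^ (j + 2) - D₂ * M.shiftedV (j + 2) ξ n X := by
    have h9 : ((n : ℝ) ^ M.β) ^ (j + 2) = (n : ℝ) ^ ((j + 2 : ℕ) * M.β) := by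
      rw [← Real.rpow_natCast, ← Real.rpow_mul hn'.le, mul_comm]
    rw [h9]
    exact hn₁ n hn₁' x
  have hr0 : 0 ≤ 1 / (n : ℝ) ^ M.α := by positivity
  have hdelta := fun l => (hb.coeffBounds_delta hM hΛ.le l).abs_birthDeath_shiftedV_le hm rfl hξ0
    hΞ hM hn0 X
  have hsecond := fun l => (hb.coeffBounds_delta hM hΛ.le l).abs_birthDeath_birthDeath_le hm rfl
    hξ0 hΞ hM hn0 (hb.coeffBounds_env hΛ.le k) X
  have hcorr := abs_sum_mul_le hcA hA.le hdelta k
  have hcorr2 := abs_sum_mul_le hcA hA.le hsecond k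
  have hgen := hM.gen_corrected hc hn0 (j + 2) ξ X k
  set f := M.shiftedV (j + 2) ξ n X with hf
  have hf0 : 0 ≤ f := shiftedV_nonneg hξ0 n X
  set N := (n : ℝ) ^ M.β with hN
  set s := M.size n X with hs
  set r := 1 / (n : ℝ) ^ M.α with hr
  have hs1' : 1 ≤ s := one_le_size hn0 X
  have hN0 : 0 ≤ N ^ (j + 2) := by positivity
  have hscale : ∀ {P Q S : ℝ}, 0 ≤ P → P ≤ G → |Q| ≤ P * S → 0 ≤ S →
      r * S ≤ η / G * f + C * N ^ (j + 2) → |r * Q| ≤ η * f + G * C * N ^ (j + 2) := by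
    intro P Q S _ hPG hQ hS hrS
    rw [abs_mul, abs_of_nonneg hr0]
    calc r * |Q| ≤ r * (G * S) := by
          refine mul_le_mul_of_nonneg_left (hQ.trans ?_) hr0
          gcongr
      _ = G * (r * S) := by ring
      _ ≤ G * (η / G * f + C * N ^ (j + 2)) := by gcongr
      _ = η * f + G * C * N ^ (j + 2) := by field_simp
  have hb1 : |r * ∑ l, c k l * M.genDelta n l (M.shiftedV (j + 2) ξ n) X| ≤
      η * f + G * C * N ^ (j + 2) := by
    refine hscale hG₁0 (by linarith) (hcorr.trans (le_of_eq ?_)) (by positivity) hs1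
    rw [hG₁]; ring
  have hb2 : |r * ∑ l, c k l * M.genEnv n k (M.genDelta n l (M.shiftedV (j + 2) ξ n)) X| ≤
      η * f + G * C * N ^ (j + 2) := by
    refine hscale hG₂0 (by linarith) (hcorr2.trans (le_of_eq ?_)) (by positivity) hs2
    rw [hG₂]; ring
  have hF : M.corrected c n (j + 2) ξ X k =
      f + r * ∑ l, c k l * M.genDelta n l (M.shiftedV (j + 2) ξ n) X := rfl
  rw [hgen, hF]
  rw [abs_le] at hb1 hb2
  have hηf : η * f ≤ 1 / 2 * f := mul_le_mul_of_nonneg_right hη1 hf0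
  have hηf2 : η * f ≤ D₂ / 4 * f := mul_le_mul_of_nonneg_right hη2 hf0
  have hp1 : 0 ≤ D₁ * N ^ (j + 2) := by positivity
  have hp2 : 0 ≤ D₂ / 2 * (G * C) * N ^ (j + 2) := by positivity
  constructor
  · linarith [hb1.1]
  · have h1 := mul_le_mul_of_nonneg_left (hb1.2.trans (add_le_add_left hηf _))
      (by positivity : 0 ≤ D₂ / 2)
    have h2 := hb2.2
    linarith

/-! ### Diffusion scaling -/

lemma unscale_scale {n : ℕ} (hn : 0 < n) (x : Fin d → ℝ) : M.unscale n (M.scale n x) = x := by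
  have hn' : (0 : ℝ) < n := by exact_mod_cast hn
  ext i
  rw [unscale, scale, ← mul_assoc, ← Real.rpow_add hn', add_neg_cancel, Real.rpow_zero, one_mul,
    sub_add_cancel]

lemma V_scale (n m : ℕ) (ξ : Fin d → ℝ) (x : Fin d → ℝ) :
    V m ξ (M.scale n x) = ((n : ℝ) ^ (-M.β)) ^ m * M.shiftedV m ξ n x := by
  have hn : 0 ≤ (n : ℝ) ^ (-M.β) := Real.rpow_nonneg (Nat.cast_nonneg n) _
  rw [V, shiftedV, V, Finset.mul_sum]
  refine Finset.sum_congr rfl fun i _ => ?_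
  rw [scale, abs_mul, abs_of_nonneg hn, mul_pow]
  ring

lemma VHat_scale (c : Fin K → Fin K → ℝ) {n : ℕ} (hn : 0 < n) (m : ℕ) (ξ : Fin d → ℝ)
    (x : Fin d → ℝ) (k : Fin K) :
    M.VHat c n m ξ (M.scale n x) k = ((n : ℝ) ^ (-M.β)) ^ m * M.corrected c n m ξ x k := by
  have h : ∀ l, M.genDeltaHat n l (V m ξ) (M.scale n x) =
      ((n : ℝ) ^ (-M.β)) ^ m * M.genDelta n l (M.shiftedV m ξ n) x := by
    intro l
    rw [genDeltaHat, unscale_scale hn]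
    simp only [V_scale]
    exact birthDeath_const_mul _ _ _ _ _ _ _
  simp only [VHat, V_scale, corrected, h, mul_add, Finset.mul_sum]
  congr 1
  exact Finset.sum_congr rfl fun l _ => by ring

lemma genHat_VHat_scale (c : Fin K → Fin K → ℝ) {n : ℕ} (hn : 0 < n) (m : ℕ) (ξ : Fin d → ℝ)
    (x : Fin d → ℝ) (k : Fin K) :
    M.genHat n (M.VHat c n m ξ) (M.scale n x) k =
      ((n : ℝ) ^ (-M.β)) ^ m * M.gen n (M.corrected c n m ξ) x k := by
  rw [genHat, unscale_scale hn]
  simp only [VHat_scale c hn]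
  rw [gen, gen, mul_add, Finset.mul_sum]
  congr 1
  · exact birthDeath_const_mul _ _ _ _ _ _ _
  · exact Finset.sum_congr rfl fun l _ => by ring

theorem Standing.exists_VHat_drift (hM : M.Standing) {c : Fin K → Fin K → ℝ}
    (hc : M.PoissonKernel c) {m : ℕ} (hm : Even m) (hm2 : 2 ≤ m) {ξ : Fin d → ℝ}
    (hξ : M.AveragedWeight m ξ) :
    ∃ C₁ > 0, ∃ C₂ > 0, ∃ n₀ : ℕ, 0 < n₀ ∧ ∀ n ≥ n₀, ∀ y ∈ M.lattice n, ∀ k,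
      V m ξ y / 2 - C₁ ≤ M.VHat c n m ξ y k ∧
      M.genHat n (M.VHat c n m ξ) y k ≤ C₁ - C₂ * M.VHat c n m ξ y k := by
  obtain ⟨C₁, hC₁, C₂, hC₂, n₀, hn₀, h⟩ := hM.exists_corrected_drift hc hm hm2 hξ
  refine ⟨C₁, hC₁, C₂, hC₂, n₀, hn₀, ?_⟩
  rintro n hn _ ⟨x, rfl⟩ k
  have hn0 : 0 < n := hn₀.trans_le hn
  have hn' : (0 : ℝ) < n := by exact_mod_cast hn0
  obtain ⟨h1, h2⟩ := h n hn x k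
  have he : 0 ≤ ((n : ℝ) ^ (-M.β)) ^ m := by positivity
  have hone : ((n : ℝ) ^ (-M.β)) ^ m * ((n : ℝ) ^ M.β) ^ m = 1 := by
    rw [← mul_pow, ← Real.rpow_add hn', neg_add_cancel, Real.rpow_zero, one_pow]
  rw [V_scale, VHat_scale c hn0, genHat_VHat_scale c hn0]
  have h1' := mul_le_mul_of_nonneg_left h1 he
  have h2' := mul_le_mul_of_nonneg_left h2 he
  have e1 : ((n : ℝ) ^ (-M.β)) ^ m * (C₁ * ((n : ℝ) ^ M.β) ^ m) = C₁ := by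
    rw [mul_left_comm, hone, mul_one]
  rw [mul_sub, e1] at h1' h2'
  constructor <;> linarith

/-- The scaled moments are bounded uniformly over large `n`, through the corrected Lyapunov
function of an even order above `p`. -/
theorem Standing.exists_uniform_longRunMoment_le (hM : M.Standing) {p : ℝ} (hp : 0 ≤ p) :
    ∃ B : ℝ≥0, ∃ n₀ : ℕ, ∀ n ≥ n₀,
      ∀ (Ω : Type*) [MeasurableSpace Ω] (P : Measure Ω) [IsProbabilityMeasure P]
        (x₀ : Fin d → ℕ) (Y : ℝ≥0 → Ω → (Fin d → ℕ) × Fin K),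
        IsChain (M.rate n) (M.initialLaw x₀) P Y → M.longRunMoment n p P Y ≤ B := by
  set j := 2 * ⌈p⌉₊ with hj
  have hm : Even (j + 2) := ⟨⌈p⌉₊ + 1, by omega⟩
  obtain ⟨c, hc⟩ := hM.exists_poissonKernel
  obtain ⟨ξ, hξ⟩ := hM.exists_averagedWeight hm (by omega)
  obtain ⟨C₁, hC₁, C₂, hC₂, n₀, hn₀, h⟩ := hM.exists_VHat_drift hc hm (by omega) hξ
  obtain ⟨q, hq, hqξ⟩ := exists_pos_le ξ hξ.1
  set D : ℝ := 2 ^ (j + 1) * ((d : ℝ) ^ (j + 1) + 1) * (1 + 2 / q) with hD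
  have hD0 : 0 ≤ D := by positivity
  refine ⟨D.toNNReal * ((C₁ + C₂ * (C₁ + 1)) / C₂).toNNReal, n₀,
    fun n hn Ω _ P _ x₀ Y hY => ?_⟩
  have hn0 : 0 < n := hn₀.trans_le hn
  let W : (Fin d → ℕ) × Fin K → ℝ := fun s =>
    M.VHat c n (j + 2) ξ (M.scale n (embed s).1) s.2 + (C₁ + 1)
  have hlow : ∀ s, V (j + 2) ξ (M.scale n (embed s).1) / 2 + 1 ≤ W s := fun s => by
    have := (h n hn _ ⟨s.1, rfl⟩ s.2).1
    simp only [W]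
    have e : M.scale n (embed s).1 = M.scale n (fun i => (s.1 i : ℝ)) := rfl
    rw [e]
    linarith
  have hVn : ∀ y, 0 ≤ V (j + 2) ξ y := fun y => Finset.sum_nonneg fun i _ =>
    mul_nonneg (hξ.1 i).le (pow_nonneg (abs_nonneg _) _)
  have hdrift : HasDrift (M.rate n) W C₂ (C₁ + C₂ * (C₁ + 1)) := by
    refine (hM.isJumpRate hn0).hasDrift hC₂ (by positivity) (fun s => ?_) fun s => ?_
    · linarith [hlow s, hVn (M.scale n (embed s).1)]
    · have h1 := gen_embed (M := M) n (fun y l => M.VHat c n (j + 2) ξ (M.scale n y) l) s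
      have h2 := (h n hn _ ⟨s.1, rfl⟩ s.2).2
      rw [genHat, unscale_scale hn0] at h2
      have h3 : ∑ l, M.labelRate n s l * (W (target s l) - W s) = M.gen n
          (fun y l => M.VHat c n (j + 2) ξ (M.scale n y) l) (embed s).1 (embed s).2 := by
        rw [h1]
        refine Finset.sum_congr rfl fun l _ => ?_
        simp only [W, Function.uncurry]
        rw [add_sub_add_right_eq_sub]
        rfl
      rw [h3]
      refine h2.trans (le_of_eq ?_)
      simp only [W]
      have e : M.scale n (embed s).1 = M.scale n (fun i => (s.1 i : ℝ)) := rfl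
      rw [e]
      ring
  refine hM.longRunMoment_le hn0 hdrift D.toNNReal (fun s => ?_) hY
  rw [Real.coe_toNNReal D hD0]
  refine (norm_toLp_rpow_le _ hp (k := j + 1) ?_).trans ?_
  · have := Nat.le_ceil p
    rw [hj]
    push_cast
    linarith [Nat.cast_nonneg (α := ℝ) ⌈p⌉₊]
  rw [hD, mul_assoc (2 ^ (j + 1) * ((d : ℝ) ^ (j + 1) + 1))]
  refine mul_le_mul_of_nonneg_left ?_ (by positivity)
  have h1 := hlow s
  have h2 : ∑ i, |M.scale n (embed s).1 i| ^ (j + 2) ≤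
      1 / q * V (j + 2) ξ (M.scale n (embed s).1) := by
    rw [V, Finset.mul_sum]
    refine Finset.sum_le_sum fun i _ => ?_
    rw [← mul_assoc]
    refine le_mul_of_one_le_left (pow_nonneg (abs_nonneg _) _) ?_
    rw [div_mul_eq_mul_div, one_mul, one_le_div hq]
    exact hqξ i
  have h3 : 1 / q * V (j + 2) ξ (M.scale n (embed s).1) ≤ 1 / q * (2 * W s) := by
    gcongr
    linarith
  have h4 : 1 ≤ W s := by linarith [hVn (M.scale n (embed s).1)]
  have h5 : 1 / q * (2 * W s) = 2 / q * W s := by ring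
  simp only [add_assoc, Nat.reduceAdd] at h2 ⊢
  linarith

end Queue

end MMQ

theorem theorem3p1 {d K : ℕ} (M : MMQ.Queue d K) (hM : M.Standing)
    (m : ℕ) (hm : Even m) (hm2 : 2 ≤ m) :
    (∃ c, M.PoissonKernel c) ∧ (∃ ξ, M.AveragedWeight m ξ) ∧
    ∀ c, M.PoissonKernel c → ∀ ξ, M.AveragedWeight m ξ →
      ∃ n₂ : ℕ, 0 < n₂ ∧
        (∃ C₁ > 0, ∃ C₂ > 0, ∀ n ≥ n₂, ∀ y ∈ M.lattice n, ∀ k,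
          M.genHat n (M.VHat c n m ξ) y k ≤ C₁ - C₂ * M.VHat c n m ξ y k) ∧
        (∀ n ≥ n₂, MMQ.GeometricallyErgodic (M.rate n)) ∧
        (∀ p : ℝ, 0 < p → ∃ B : ℝ≥0, ∀ n ≥ n₂,
          ∀ (Ω : Type*) [MeasurableSpace Ω] (P : Measure Ω) [IsProbabilityMeasure P]
            (x₀ : Fin d → ℕ) (Y : ℝ≥0 → Ω → (Fin d → ℕ) × Fin K),
            MMQ.IsChain (M.rate n) (M.initialLaw x₀) P Y → M.longRunMoment n p P Y ≤ B) := by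
  refine ⟨hM.exists_poissonKernel, hM.exists_averagedWeight hm hm2, fun c hc ξ hξ => ?_⟩
  obtain ⟨C₁, hC₁, C₂, hC₂, n₀, hn₀, h⟩ := hM.exists_VHat_drift hc hm hm2 hξ
  refine ⟨n₀, hn₀, ⟨C₁, hC₁, C₂, hC₂, fun n hn y hy k => (h n hn y hy k).2⟩,
    fun n hn => hM.geometricallyErgodic (hn₀.trans_le hn), fun p hp => ?_⟩
  -- `n₀` does not depend on `p`: the finitely many `n` for which the uniform bound is not yet valid
  -- are handled one by one
  obtain ⟨B, n₁, hB⟩ := hM.exists_uniform_longRunMoment_le hp.le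
  choose b hb using fun n : {n : ℕ // 0 < n} => hM.exists_longRunMoment_le n.2 hp.le
  refine ⟨B + ∑ n ∈ Finset.range n₁, if hn : 0 < n then b ⟨n, hn⟩ else 0,
    fun n hn Ω _ P _ x₀ Y hY => ?_⟩
  rcases lt_or_ge n n₁ with hlt | hge
  · have hn0 : 0 < n := hn₀.trans_le hn
    refine (hb ⟨n, hn0⟩ Ω P x₀ Y hY).trans (ENNReal.coe_le_coe.2 ?_)
    have := Finset.single_le_sum (f := fun n => if hn : 0 < n then b ⟨n, hn⟩ else 0)
      (fun _ _ => zero_le) (Finset.mem_range.2 hlt)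
    rw [dif_pos hn0] at this
    exact this.trans le_add_self
  · exact (hB n hge Ω P x₀ Y hY).trans (ENNReal.coe_le_coe.2 le_self_add)
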